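/- Let $X$ be a complex manifold of dimension $n$. Let $\mathfrak g=\bigoplus_{p,q}\Omega^{0,q}(X,\Lambda^pT)$, with $\Omega^{0,q}(X,\Lambda^pT)$ in degree $q-p+1$, be the differential graded Lie algebra with the Dolbeault differential $\bar\partial$ and the Schouten–Nijenhuis bracket extended by the exterior product of $(0,*)$-forms. For $\gamma\in\mathfrak g$ let $i_\gamma$ be the contraction of forms with $\Lambda^*T$, combined with left exterior multiplication by $(0,*)$-forms; signs are normalized so that $[\bar\partial,i_\gamma]=i_{\bar\partial\gamma}$ and $[[\partial,i_{\gamma_1}],i_{\gamma_2}]=i_{[\gamma_1,\gamma_2]}$. Let $R$ be a graded-commutative $\mathbb Z$-graded local Artin $\mathbb C$-algebra with residue field $\mathbb C$, or the limit of a tower of such algebras with surjective transition maps, with maximal ideal $\mathfrak M_R$ (tensor products with $R$ are completed). Let $MC(R)$ be the set of $\gamma\in(\mathfrak g[1]\otimes\mathfrak M_R)^0$ with $\bar\partial\gamma+\frac12[\gamma,\gamma]=0$, and let $\mathcal M(R)$ be its quotient by the gauge action of $\exp((\mathfrak g\otimes\mathfrak M_R)^0)$, generated by $\dot\gamma=\bar\partial\alpha+[\gamma,\alpha]$.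 Let $Der(R)$ be the space of continuous graded derivations of $R$ (sums of an even and an odd one). Let $\Omega^*(X,\mathbb C)[[\hbar^{-1},\hbar]]$ denote two-sided formal series in which even forms carry integral and odd forms half-integral powers of $\hbar$; the cohomology of $(\Omega^*(X,\mathbb C)[[\hbar^{-1},\hbar]]\otimes R,\ \hbar^{1/2}(\bar\partial+\partial))$ is written $H^*(X,\mathbb C)[[\hbar^{-1},\hbar]]\otimes R$. Let $l_\hbar\varphi^{p,q}=\hbar^{(q-p)/2}\varphi^{p,q}$. For $\phi\in\mathcal M(R)$ described by $\gamma\in MC(R)$, let $L(\phi)\subset H^*(X,\mathbb C)[[\hbar^{-1},\hbar]]\otimes R$ be the set of classes of cocycles of the form $$l_\hbar\exp(\tfrac1\hbar i_\gamma)(\varphi_0+\varphi_1\hbar+\varphi_2\hbar^2+\dots),\qquad \varphi_j\in\Omega^*(X,\mathbb C)\otimes R.$$ Let $\mathcal H^\hbar_\gamma$ be the cohomology of $(\Omega^{*,*}\otimes\mathbb C[[\hbar^{-1},\hbar]]\otimes R,\ \bar\partial+[\partial,i_\gamma]+\hbar\partial)$, with integral powers of $\hbar$. Then for every $\phi\in\mathcal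 M(R)$, every $\gamma\in MC(R)$ describing $\phi$ and every $v\in Der(R)$: 1. the operator $\nabla_v=\partial_v+\hbar^{-1}i_{\partial_v\gamma}$ induces a well-defined linear operator on $\mathcal H^\hbar_\gamma$ (the Gauss–Manin connection), the operator $l_\hbar\exp(\frac1\hbar i_\gamma)$ induces a linear isomorphism $P_\gamma:\mathcal H^\hbar_\gamma\to H^*(X,\mathbb C)[[\hbar^{-1},\hbar]]\otimes R$, and $P_\gamma\nabla_v=\partial_vP_\gamma$; 2. (semi-infinite Griffiths transversality) $\nabla L\subset\hbar^{-1}L$: if $P_\gamma x\in L(\phi)$, then $P_\gamma(\nabla_vx)\in\hbar^{-1}L(\phi)$; equivalently $\partial_vL(\phi)\subset\hbar^{-1}L(\phi)$. -/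

import Mathlib

open scoped TensorProduct Manifold ContDiff

noncomputable section

namespace SemiInfinite

/-! ### Fibres: the exterior algebra on `dz_1, …, dz_n, dz̄_1, …, dz̄_n` -/

/-- The model space `ℂⁿ`. -/
abbrev Cn (n : ℕ) : Type := Fin n → ℂ

/-- The exterior algebra over `ℂ` on `ℂⁿ ⊕ ℂⁿ`. It serves as the fibre, written in local
holomorphic coordinates, of two bundles:
* differential forms: `(ξ, η)` stands for `∑ ξ_i dz_i + ∑ η_i dz̄_i`;
* `(0,*)`-forms with values in polyvectors `Λ^*T`: `(a, η)` stands for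
  `∑ a_i ∂/∂z_i + ∑ η_i dz̄_i`. -/
abbrev Lam (n : ℕ) : Type := ExteriorAlgebra ℂ (Cn n × Cn n)

instance instFiniteLam (n : ℕ) : Module.Finite ℂ (Lam n) :=
  Module.Finite.of_basis (Module.finBasis ℂ (Cn n × Cn n)).ExteriorAlgebra

variable {n : ℕ}

/-- Generators of the first kind (`∑ a_i dz_i`, respectively `∑ a_i ∂/∂z_i`). -/
def gen₁ : Cn n →ₗ[ℂ] Lam n := ExteriorAlgebra.ι ℂ ∘ₗ LinearMap.inl ℂ (Cn n) (Cn n)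

/-- Generators of the second kind, `∑ b_i dz̄_i`. -/
def gen₂ : Cn n →ₗ[ℂ] Lam n := ExteriorAlgebra.ι ℂ ∘ₗ LinearMap.inr ℂ (Cn n) (Cn n)

/-- The functional `(ξ, η) ↦ ∑ a_i ξ_i`. -/
def pair₁ : Cn n →ₗ[ℂ] Module.Dual ℂ (Cn n × Cn n) :=
  LinearMap.mk₂ ℂ (fun a w => a ⬝ᵥ w.1) (by intros; simp [add_dotProduct])
    (by intros; simp [smul_dotProduct]) (by intros; simp [dotProduct_add])
    (by intros; simp [dotProduct_smul])

/-- The generators of polyvector-valued forms acting on forms: `∂/∂z_i` contracts, `dz̄_i`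
multiplies from the left. -/
def contrGen : Cn n × Cn n →ₗ[ℂ] Module.End ℂ (Lam n) :=
  CliffordAlgebra.contractLeft ∘ₗ pair₁ ∘ₗ LinearMap.fst ℂ (Cn n) (Cn n) +
    LinearMap.mul ℂ (Lam n) ∘ₗ gen₂ ∘ₗ LinearMap.snd ℂ (Cn n) (Cn n)

theorem contrGen_apply (w : Cn n × Cn n) (x : Lam n) :
    contrGen w x = CliffordAlgebra.contractLeft (pair₁ w.1) x + gen₂ w.2 * x := rfl

theorem contrGen_sq (w : Cn n × Cn n) : contrGen w * contrGen w = 0 := by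
  refine LinearMap.ext fun x => ?_
  have h2 : gen₂ w.2 * (gen₂ w.2 * x) = 0 := by
    rw [← mul_assoc]; simp [gen₂]
  have h3 : CliffordAlgebra.contractLeft (pair₁ w.1) (gen₂ w.2 * x) =
      - (gen₂ w.2 * CliffordAlgebra.contractLeft (pair₁ w.1) x) := by
    simp only [gen₂, LinearMap.comp_apply]
    erw [CliffordAlgebra.contractLeft_ι_mul]
    simp [pair₁]
  rw [Module.End.mul_apply, contrGen_apply, contrGen_apply, map_add, mul_add, h2, h3,
    CliffordAlgebra.contractLeft_contractLeft]
  simp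

/-- The contraction `γ ↦ i_γ` of forms with polyvector-valued `(0,*)`-forms: the algebra
morphism with `i_{∂/∂z_i}` the contraction and `i_{dz̄_i}` the left exterior multiplication. -/
def contr : Lam n →ₐ[ℂ] Module.End ℂ (Lam n) :=
  ExteriorAlgebra.lift ℂ ⟨contrGen, contrGen_sq⟩

/-- The generators placed in bidegrees `(1,0)` and `(0,1)`. -/
def bidegGen : Cn n × Cn n →ₗ[ℂ] AddMonoidAlgebra (Lam n) (ℕ × ℕ) :=
  AddMonoidAlgebra.lsingle (1, 0) ∘ₗ gen₁ ∘ₗ LinearMap.fst ℂ (Cn n) (Cn n) +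
    AddMonoidAlgebra.lsingle (0, 1) ∘ₗ gen₂ ∘ₗ LinearMap.snd ℂ (Cn n) (Cn n)

theorem bidegGen_sq (w : Cn n × Cn n) : bidegGen w * bidegGen w = 0 := by
  have h1 : gen₁ w.1 * gen₁ w.1 = 0 := by simp [gen₁]
  have h2 : gen₂ w.2 * gen₂ w.2 = 0 := by simp [gen₂]
  have h3 : gen₁ w.1 * gen₂ w.2 + gen₂ w.2 * gen₁ w.1 = 0 := by
    simp only [gen₁, gen₂, LinearMap.comp_apply]
    exact ExteriorAlgebra.ι_add_mul_swap _ _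
  have e : bidegGen w = AddMonoidAlgebra.single (1, 0) (gen₁ w.1) +
      AddMonoidAlgebra.single (0, 1) (gen₂ w.2) := rfl
  rw [e, add_mul, mul_add, mul_add]
  simp only [AddMonoidAlgebra.single_mul_single, h1, h2, Prod.mk_add_mk]
  simp only [AddMonoidAlgebra.single_zero, zero_add, add_zero]
  rw [← AddMonoidAlgebra.single_add, h3, AddMonoidAlgebra.single_zero]

/-- The component of bidegree `(p,q)`: `p` factors of the first and `q` of the second kind. -/
def comp (p q : ℕ) : Lam n →ₗ[ℂ] Lam n where
  toFun a := (ExteriorAlgebra.lift ℂ ⟨bidegGen, bidegGen_sq⟩ a).coeff (p, q)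
  map_add' a b := by simp
  map_smul' c a := by simp

/-- The parity involution `(-1)^{p+q}` of the exterior algebra. -/
def inv : Lam n →ₗ[ℂ] Lam n := (CliffordAlgebra.involute (Q := 0)).toLinearMap

/-- Left contraction by `dz_i` on polyvectors, i.e. the left derivative `∂/∂(∂/∂z_i)`. -/
def leftDer (i : Fin n) : Lam n →ₗ[ℂ] Lam n :=
  CliffordAlgebra.contractLeft (pair₁ (Pi.single i 1))

/-! ### Graded Artin algebras and their projective limits -/

universe u

/-- A `ℤ`-graded local Artin `ℂ`-algebra, commutative in the graded sense, with residue
field `ℂ`. -/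
structure GradedArtin where
  carrier : Type u
  [ring : Ring carrier]
  [algebra : Algebra ℂ carrier]
  [finite : Module.Finite ℂ carrier]
  gr : ℤ → Submodule ℂ carrier
  [graded : GradedAlgebra gr]
  comm : ∀ {i j : ℤ} {a b : carrier}, a ∈ gr i → b ∈ gr j →
    a * b = (i * j).negOnePow • (b * a)
  /-- the maximal ideal -/
  max : Ideal carrier
  max_homogeneous : ∀ (i : ℤ) {r : carrier}, r ∈ max → GradedRing.proj gr i r ∈ max
  residue : ∀ r : carrier, ∃! c : ℂ, r - algebraMap ℂ carrier c ∈ max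
  max_nilpotent : ∃ N : ℕ, (max.restrictScalars ℂ) ^ N = ⊥

attribute [instance] GradedArtin.ring GradedArtin.algebra GradedArtin.finite GradedArtin.graded

/-- The even part of an element of a graded Artin algebra. -/
def GradedArtin.evenPart (A : GradedArtin.{u}) : A.carrier →ₗ[ℂ] A.carrier :=
  DirectSum.toModule ℂ ℤ A.carrier (fun k => if Even k then (A.gr k).subtype else 0) ∘ₗ
    (DirectSum.decomposeLinearEquiv A.gr).toLinearMap

/-- The odd part of an element of a graded Artin algebra. -/
def GradedArtin.oddPart (A : GradedArtin.{u}) : A.carrier →ₗ[ℂ] A.carrier :=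
  LinearMap.id - A.evenPart

/-- A pro-Artin algebra `R = lim R_i`: a tower of graded Artin algebras with surjective graded
transition morphisms. A constant tower is a graded Artin algebra. -/
structure ProArtin where
  level : ℕ → GradedArtin.{u}
  map : ∀ {i j : ℕ}, i ≤ j → (level j).carrier →ₐ[ℂ] (level i).carrier
  map_id : ∀ (i : ℕ) (r : (level i).carrier), map (le_refl i) r = r
  map_map : ∀ {i j k : ℕ} (hij : i ≤ j) (hjk : j ≤ k) (r : (level k).carrier),
    map hij (map hjk r) = map (hij.trans hjk) r
  map_surjective : ∀ {i j : ℕ} (h : i ≤ j), Function.Surjective (map h)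
  map_gr : ∀ {i j : ℕ} (h : i ≤ j) (d : ℤ) {r : (level j).carrier},
    r ∈ (level j).gr d → map h r ∈ (level i).gr d

/-- A graded Artin algebra as a (constant) pro-Artin algebra. -/
def GradedArtin.toPro (A : GradedArtin.{u}) : ProArtin.{u} where
  level _ := A
  map _ := AlgHom.id ℂ A.carrier
  map_id _ _ := rfl
  map_map _ _ _ := rfl
  map_surjective _ := Function.surjective_id
  map_gr _ _ _ h := h

/-- A vector field `v ∈ Der(R)`: a continuous derivation of `R = lim R_i`, in the graded sense,
written as the sum of its even and its odd part. By continuity, `v r` modulo the `i`-th level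
depends only on `r` modulo some level `shift i`. -/
structure ProArtin.Der (R : ProArtin.{u}) where
  shift : ℕ → ℕ
  le_shift : ∀ i, i ≤ shift i
  even : ∀ i, (R.level (shift i)).carrier →ₗ[ℂ] (R.level i).carrier
  odd : ∀ i, (R.level (shift i)).carrier →ₗ[ℂ] (R.level i).carrier
  even_compat : ∀ {i j m : ℕ} (h : i ≤ j) (hi : shift i ≤ m) (hj : shift j ≤ m)
    (r : (R.level m).carrier), R.map h (even j (R.map hj r)) = even i (R.map hi r)
  odd_compat : ∀ {i j m : ℕ} (h : i ≤ j) (hi : shift i ≤ m) (hj : shift j ≤ m)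
    (r : (R.level m).carrier), R.map h (odd j (R.map hj r)) = odd i (R.map hi r)
  even_parity : ∀ i r, even i ((R.level (shift i)).evenPart r) = (R.level i).evenPart (even i r)
  odd_parity : ∀ i r, odd i ((R.level (shift i)).evenPart r) = (R.level i).oddPart (odd i r)
  even_mul : ∀ i r s, even i (r * s) =
    even i r * R.map (le_shift i) s + R.map (le_shift i) r * even i s
  odd_mul : ∀ i r s, odd i (r * s) = odd i r * R.map (le_shift i) s +
    R.map (le_shift i)
      ((R.level (shift i)).evenPart r - (R.level (shift i)).oddPart r) * odd i s

/-- The fibre with coefficients in a graded Artin algebra. -/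
abbrev Fib (n : ℕ) (A : GradedArtin.{u}) : Type u := Lam n ⊗[ℂ] A.carrier

variable {A : GradedArtin.{u}}

/-- The extension of an even bilinear operation on `Lam n` to coefficients in `A`, with the Koszul
sign: `(a ⊗ r) ⋆ (b ⊗ s) = (-1)^{|r||b|} (a ⋆ b) ⊗ r s`. -/
def koszul (f : Lam n →ₗ[ℂ] Lam n →ₗ[ℂ] Lam n) : Fib n A →ₗ[ℂ] Fib n A →ₗ[ℂ] Fib n A :=
  TensorProduct.map₂ f (LinearMap.mul ℂ A.carrier ∘ₗ A.evenPart) +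
    TensorProduct.map₂ (f.compl₂ inv) (LinearMap.mul ℂ A.carrier ∘ₗ A.oddPart)

/-- The product of `Lam n ⊗ A`. -/
def fibMul : Fib n A →ₗ[ℂ] Fib n A →ₗ[ℂ] Fib n A := koszul (LinearMap.mul ℂ (Lam n))

/-- The contraction `i_γ` with coefficients in `A`. -/
def fibContr : Fib n A →ₗ[ℂ] Fib n A →ₗ[ℂ] Fib n A := koszul contr.toLinearMap

/-- The even part of an element of `Lam n ⊗ A` for the total parity. -/
def fibEven : Fib n A →ₗ[ℂ] Fib n A :=
  (2⁻¹ : ℂ) • (LinearMap.id + TensorProduct.map inv (A.evenPart - A.oddPart))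

/-- The odd part of an element of `Lam n ⊗ A` for the total parity. -/
def fibOdd : Fib n A →ₗ[ℂ] Fib n A :=
  (2⁻¹ : ℂ) • (LinearMap.id - TensorProduct.map inv (A.evenPart - A.oddPart))

/-- `(𝔤[1] ⊗ 𝔐_A)^d`: spanned by the `a ⊗ r` with `a ∈ Ω^{0,q}(Λ^p T)`, `r` in the maximal ideal
and `(q - p) + deg r = d`. -/
def polyDeg (n : ℕ) (A : GradedArtin.{u}) (d : ℤ) : Submodule ℂ (Fib n A) :=
  Submodule.span ℂ {t | ∃ (p q : ℕ) (a : Lam n) (r : A.carrier),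
    r ∈ A.gr (d + p - q) ∧ r ∈ A.max ∧ t = comp p q a ⊗ₜ[ℂ] r}

/-! ### Fields on a complex manifold

A field is written, at each point `x`, in the preferred chart at `x`. -/

set_option linter.unusedSectionVars false

section Fields

variable {X : Type*} [TopologicalSpace X] [ChartedSpace (Cn n) X] [IsManifold 𝓘(ℂ, Cn n) ω X]

/-- The Jacobian matrix `∂z_b/∂z_a` at `x` of the coordinates of the chart at `b` with respect to
those of the chart at `a`. -/
def jac (a b x : X) : Matrix (Fin n) (Fin n) ℂ :=
  LinearMap.toMatrix' (tangentCoordChange 𝓘(ℂ, Cn n) a b x).toLinearMap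

/-- Rewriting `dz`, `dz̄` from the chart at `x` to the chart at `x₀`, at the point `x`. -/
def formChange (x₀ x : X) : Cn n × Cn n →ₗ[ℂ] Cn n × Cn n :=
  LinearMap.prodMap (Matrix.toLin' (jac x₀ x x).transpose)
    (Matrix.toLin' (jac x₀ x x).conjTranspose)

/-- Rewriting `∂/∂z`, `dz̄` from the chart at `x` to the chart at `x₀`, at the point `x`. -/
def polyChange (x₀ x : X) : Cn n × Cn n →ₗ[ℂ] Cn n × Cn n :=
  LinearMap.prodMap (Matrix.toLin' (jac x x₀ x)) (Matrix.toLin' (jac x₀ x x).conjTranspose)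

/-- The expression in the chart at `x₀` of a field that transforms by `T`. -/
def read (T : X → X → Cn n × Cn n →ₗ[ℂ] Cn n × Cn n) (x₀ : X) (s : X → Fib n A) (y : Cn n) :
    Fib n A :=
  (ExteriorAlgebra.map (T x₀ ((chartAt (Cn n) x₀).symm y))).toLinearMap.rTensor A.carrier
    (s ((chartAt (Cn n) x₀).symm y))

/-- Linear coordinates on a finite-dimensional complex vector space. -/
def coords (W : Type*) [AddCommGroup W] [Module ℂ W] [Module.Finite ℂ W] :
    W ≃ₗ[ℂ] (Fin (Module.finrank ℂ W) → ℂ) :=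
  (Module.finBasis ℂ W).equivFun

/-- The (real) derivative at `y` in the direction `u` of a function with values in a
finite-dimensional complex vector space. -/
def dirDeriv {W : Type*} [AddCommGroup W] [Module ℂ W] [Module.Finite ℂ W]
    (f : Cn n → W) (y u : Cn n) : W :=
  (coords W).symm (fderiv ℝ (fun z => coords W (f z)) y u)

/-- `∂f/∂z_i` -/
def dz {W : Type*} [AddCommGroup W] [Module ℂ W] [Module.Finite ℂ W]
    (f : Cn n → W) (y : Cn n) (i : Fin n) : W :=
  (2⁻¹ : ℂ) • (dirDeriv f y (Pi.single i 1) - Complex.I • dirDeriv f y (Pi.single i Complex.I))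

/-- `∂f/∂z̄_i` -/
def dzbar {W : Type*} [AddCommGroup W] [Module ℂ W] [Module.Finite ℂ W]
    (f : Cn n → W) (y : Cn n) (i : Fin n) : W :=
  (2⁻¹ : ℂ) • (dirDeriv f y (Pi.single i 1) + Complex.I • dirDeriv f y (Pi.single i Complex.I))

/-- Left multiplication by an element of `Lam n` on `Lam n ⊗ A`. -/
def lmul (a : Lam n) : Fib n A →ₗ[ℂ] Fib n A := (LinearMap.mul ℂ (Lam n) a).rTensor A.carrier

/-- Smoothness (in the real sense) of a field that transforms by `T`. -/
def IsSmooth (T : X → X → Cn n × Cn n →ₗ[ℂ] Cn n × Cn n) (s : X → Fib n A) : Prop :=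
  ∀ x₀ : X, ContDiffOn ℝ ∞ (fun y => coords (Fib n A) (read T x₀ s y)) (chartAt (Cn n) x₀).target

/-- The operator `∂ = ∑ dz_i ∧ ∂/∂z_i` on forms. -/
def del (s : X → Fib n A) (x : X) : Fib n A :=
  ∑ i, lmul (gen₁ (Pi.single i 1)) (dz (read formChange x s) (chartAt (Cn n) x x) i)

/-- The operator `∂̄ = ∑ dz̄_i ∧ ∂/∂z̄_i` on forms. -/
def delbar (s : X → Fib n A) (x : X) : Fib n A :=
  ∑ i, lmul (gen₂ (Pi.single i 1)) (dzbar (read formChange x s) (chartAt (Cn n) x x) i)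

/-- The Dolbeault operator `∂̄ = ∑ dz̄_i ∧ ∂/∂z̄_i` on polyvector-valued `(0,*)`-forms, with respect
to the holomorphic frame `∂/∂z_i`. -/
def polyDelbar (s : X → Fib n A) (x : X) : Fib n A :=
  ∑ i, lmul (gen₂ (Pi.single i 1)) (dzbar (read polyChange x s) (chartAt (Cn n) x x) i)

/-- One half of the bracket: `∑ ∂α/∂(∂/∂z_i) · ∂β/∂z_i`. -/
def halfSchouten (α β : X → Fib n A) (x : X) : Fib n A :=
  ∑ i, fibMul ((leftDer i).rTensor A.carrier (α x))
    (dz (read polyChange x β) (chartAt (Cn n) x x) i)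

/-- The Schouten–Nijenhuis bracket extended by the exterior product of `(0,*)`-forms, in local
coordinates, where `|·|` is the degree in `𝔤[1]`:
`[α,β] = ∑ ∂α/∂(∂/∂z_i) · ∂β/∂z_i + (-1)^{|α||β|} ∑ ∂β/∂(∂/∂z_i) · ∂α/∂z_i`. For vector fields
it is the Lie bracket, and `[v,f] = v(f)`. With this normalization
`[[∂, i_α], i_β] = i_{[α,β]}`. -/
def schouten (α β : X → Fib n A) (x : X) : Fib n A :=
  halfSchouten α β x + halfSchouten β (fun y => fibEven (α y)) x +
    halfSchouten (fun y => fibEven (β y) - fibOdd (β y)) (fun y => fibOdd (α y)) x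

/-! Linearity of these operations on smooth fields. -/

section Linearity

variable {W W' : Type*} [AddCommGroup W] [Module ℂ W] [Module.Finite ℂ W]
  [AddCommGroup W'] [Module ℂ W'] [Module.Finite ℂ W']

/-- Differentiability in linear coordinates. -/
def DiffAt (f : Cn n → W) (y : Cn n) : Prop := DifferentiableAt ℝ (fun z => coords W (f z)) y

/-- A complex-linear map in linear coordinates, as a real continuous linear map. -/
def coordMap (L : W →ₗ[ℂ] W') :
    (Fin (Module.finrank ℂ W) → ℂ) →L[ℝ] (Fin (Module.finrank ℂ W') → ℂ) :=
  (LinearMap.toContinuousLinearMap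
    ((coords W').toLinearMap ∘ₗ L ∘ₗ (coords W).symm.toLinearMap)).restrictScalars ℝ

theorem coordMap_apply (L : W →ₗ[ℂ] W') (w : W) : coordMap L (coords W w) = coords W' (L w) := by
  simp [coordMap]

theorem dirDeriv_linear (L : W →ₗ[ℂ] W') {f : Cn n → W} {y : Cn n} (hf : DiffAt f y) (u : Cn n) :
    dirDeriv (fun z => L (f z)) y u = L (dirDeriv f y u) := by
  have h1 : (fun z => coords W' (L (f z))) = fun z => coordMap L (coords W (f z)) := by
    funext z; rw [coordMap_apply]
  have h2 : HasFDerivAt (fun z => coordMap L (coords W (f z)))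
      ((coordMap L).comp (fderiv ℝ (fun z => coords W (f z)) y)) y :=
    (coordMap L).hasFDerivAt.comp y hf.hasFDerivAt
  unfold dirDeriv
  rw [h1, h2.fderiv, LinearEquiv.symm_apply_eq, ← coordMap_apply]
  simp

theorem dirDeriv_add {f g : Cn n → W} {y : Cn n} (hf : DiffAt f y) (hg : DiffAt g y) (u : Cn n) :
    dirDeriv (fun z => f z + g z) y u = dirDeriv f y u + dirDeriv g y u := by
  have h : (fun z => coords W (f z + g z)) =
      (fun z => coords W (f z)) + fun z => coords W (g z) := by funext z; simp
  unfold dirDeriv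
  rw [h, fderiv_add hf hg]
  simp

theorem dz_linear (L : W →ₗ[ℂ] W') {f : Cn n → W} {y : Cn n} (hf : DiffAt f y) (i : Fin n) :
    dz (fun z => L (f z)) y i = L (dz f y i) := by
  simp [dz, dirDeriv_linear L hf]

theorem dzbar_linear (L : W →ₗ[ℂ] W') {f : Cn n → W} {y : Cn n} (hf : DiffAt f y) (i : Fin n) :
    dzbar (fun z => L (f z)) y i = L (dzbar f y i) := by
  simp [dzbar, dirDeriv_linear L hf]

theorem dz_add {f g : Cn n → W} {y : Cn n} (hf : DiffAt f y) (hg : DiffAt g y) (i : Fin n) :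
    dz (fun z => f z + g z) y i = dz f y i + dz g y i := by
  simp only [dz, dirDeriv_add hf hg, smul_add, smul_sub]
  abel

theorem dzbar_add {f g : Cn n → W} {y : Cn n} (hf : DiffAt f y) (hg : DiffAt g y) (i : Fin n) :
    dzbar (fun z => f z + g z) y i = dzbar f y i + dzbar g y i := by
  simp only [dzbar, dirDeriv_add hf hg, smul_add]
  abel

end Linearity

section Smooth

variable {T : X → X → Cn n × Cn n →ₗ[ℂ] Cn n × Cn n} {s t : X → Fib n A}
  {B : GradedArtin.{u}}

theorem IsSmooth.diffAt (h : IsSmooth T s) (x : X) :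
    DiffAt (read T x s) (chartAt (Cn n) x x) :=
  ((h x).contDiffAt ((chartAt (Cn n) x).open_target.mem_nhds
    (mem_chart_target (Cn n) x))).differentiableAt (by simp)

theorem read_add (x : X) : read T x (s + t) = fun y => read T x s y + read T x t y := by
  funext y; simp [read]

theorem IsSmooth.add (hs : IsSmooth T s) (ht : IsSmooth T t) : IsSmooth T (s + t) := by
  intro x
  simp only [read_add, map_add]
  exact (hs x).add (ht x)

theorem IsSmooth.zero : IsSmooth T (0 : X → Fib n A) := by
  intro x
  have : (fun y => coords (Fib n A) (read T x (0 : X → Fib n A) y)) = fun _ => 0 := by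
    funext y; simp [read]
  rw [this]
  exact contDiffOn_const

/-- Application of `L ⊗ f` to the values of a field, for `L` that commutes with changes of
coordinates. -/
theorem read_map (L : Lam n →ₗ[ℂ] Lam n) (f : A.carrier →ₗ[ℂ] B.carrier)
    (hL : ∀ g : Cn n × Cn n →ₗ[ℂ] Cn n × Cn n,
      (ExteriorAlgebra.map g).toLinearMap ∘ₗ L = L ∘ₗ (ExteriorAlgebra.map g).toLinearMap)
    (x : X) : read T x (fun z => TensorProduct.map L f (s z)) =
      fun y => TensorProduct.map L f (read T x s y) := by
  funext y
  simp only [read, ← LinearMap.comp_apply, LinearMap.rTensor_comp_map, LinearMap.map_comp_rTensor,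
    hL]

theorem IsSmooth.map (L : Lam n →ₗ[ℂ] Lam n) (f : A.carrier →ₗ[ℂ] B.carrier)
    (hL : ∀ g : Cn n × Cn n →ₗ[ℂ] Cn n × Cn n,
      (ExteriorAlgebra.map g).toLinearMap ∘ₗ L = L ∘ₗ (ExteriorAlgebra.map g).toLinearMap)
    (hs : IsSmooth T s) : IsSmooth T (fun z => TensorProduct.map L f (s z)) := by
  intro x
  simp only [read_map L f hL, ← coordMap_apply]
  exact (coordMap (TensorProduct.map L f)).contDiff.comp_contDiffOn (hs x)

theorem map_comp_id (g : Cn n × Cn n →ₗ[ℂ] Cn n × Cn n) :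
    (ExteriorAlgebra.map g).toLinearMap ∘ₗ LinearMap.id =
      LinearMap.id ∘ₗ (ExteriorAlgebra.map g).toLinearMap := rfl

theorem map_comp_inv (g : Cn n × Cn n →ₗ[ℂ] Cn n × Cn n) :
    (ExteriorAlgebra.map g).toLinearMap ∘ₗ inv = inv ∘ₗ (ExteriorAlgebra.map g).toLinearMap := by
  have : (ExteriorAlgebra.map g).comp (CliffordAlgebra.involute (Q := 0)) =
      (CliffordAlgebra.involute (Q := 0)).comp (ExteriorAlgebra.map g) := by
    apply ExteriorAlgebra.hom_ext
    ext v <;> simp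
  exact congrArg AlgHom.toLinearMap this

theorem IsSmooth.smul (c : ℂ) (hs : IsSmooth T s) : IsSmooth T (c • s) := by
  have h := hs.map (c • LinearMap.id) LinearMap.id (by intro g; ext; simp)
  convert h using 1
  funext z
  simp [TensorProduct.map_smul_left]

theorem del_add (hs : IsSmooth formChange s) (ht : IsSmooth formChange t) :
    del (s + t) = del s + del t := by
  funext x
  simp only [del, read_add, dz_add (hs.diffAt x) (ht.diffAt x), map_add, Finset.sum_add_distrib,
    Pi.add_apply]

theorem delbar_add (hs : IsSmooth formChange s) (ht : IsSmooth formChange t) :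
    delbar (s + t) = delbar s + delbar t := by
  funext x
  simp only [delbar, read_add, dzbar_add (hs.diffAt x) (ht.diffAt x), map_add,
    Finset.sum_add_distrib, Pi.add_apply]

theorem lmul_map (L : Lam n →ₗ[ℂ] Lam n) (f : A.carrier →ₗ[ℂ] B.carrier) (a : Lam n) (c : ℂ)
    (hL : ∀ b, a * L b = c • L (a * b)) (w : Fib n A) :
    lmul a (TensorProduct.map L f w) = c • TensorProduct.map L f (lmul a w) := by
  induction w using TensorProduct.induction_on with
  | zero => simp
  | tmul b r => simp [lmul, hL, TensorProduct.smul_tmul']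
  | add w w' h h' => simp only [map_add, h, h', smul_add]

theorem del_map (L : Lam n →ₗ[ℂ] Lam n) (f : A.carrier →ₗ[ℂ] B.carrier) (c : ℂ)
    (hL : ∀ g : Cn n × Cn n →ₗ[ℂ] Cn n × Cn n,
      (ExteriorAlgebra.map g).toLinearMap ∘ₗ L = L ∘ₗ (ExteriorAlgebra.map g).toLinearMap)
    (hc : ∀ v b, ExteriorAlgebra.ι ℂ v * L b = c • L (ExteriorAlgebra.ι ℂ v * b))
    (hs : IsSmooth formChange s) :
    del (fun z => TensorProduct.map L f (s z)) =
      fun x => c • TensorProduct.map L f (del s x) := by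
  funext x
  simp only [del, read_map L f hL, dz_linear (TensorProduct.map L f) (hs.diffAt x), map_sum,
    Finset.smul_sum]
  refine Finset.sum_congr rfl fun i _ => lmul_map L f _ c (fun b => hc _ b) _

theorem delbar_map (L : Lam n →ₗ[ℂ] Lam n) (f : A.carrier →ₗ[ℂ] B.carrier) (c : ℂ)
    (hL : ∀ g : Cn n × Cn n →ₗ[ℂ] Cn n × Cn n,
      (ExteriorAlgebra.map g).toLinearMap ∘ₗ L = L ∘ₗ (ExteriorAlgebra.map g).toLinearMap)
    (hc : ∀ v b, ExteriorAlgebra.ι ℂ v * L b = c • L (ExteriorAlgebra.ι ℂ v * b))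
    (hs : IsSmooth formChange s) :
    delbar (fun z => TensorProduct.map L f (s z)) =
      fun x => c • TensorProduct.map L f (delbar s x) := by
  funext x
  simp only [delbar, read_map L f hL, dzbar_linear (TensorProduct.map L f) (hs.diffAt x), map_sum,
    Finset.smul_sum]
  refine Finset.sum_congr rfl fun i _ => lmul_map L f _ c (fun b => hc _ b) _

end Smooth

section Contraction

theorem map_contractLeft (g : Cn n × Cn n →ₗ[ℂ] Cn n × Cn n) (d d' : Module.Dual ℂ (Cn n × Cn n))
    (h : ∀ w, d' (g w) = d w) (b : Lam n) :
    ExteriorAlgebra.map g (CliffordAlgebra.contractLeft d b) =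
      CliffordAlgebra.contractLeft d' (ExteriorAlgebra.map g b) := by
  induction b using CliffordAlgebra.left_induction with
  | algebraMap r =>
    rw [AlgHom.commutes, CliffordAlgebra.contractLeft_algebraMap,
      CliffordAlgebra.contractLeft_algebraMap, map_zero]
  | add x y hx hy => simp only [map_add, hx, hy]
  | ι_mul x v hx =>
    have e : ExteriorAlgebra.map g (CliffordAlgebra.ι 0 v) = CliffordAlgebra.ι 0 (g v) :=
      ExteriorAlgebra.map_apply_ι g v
    rw [CliffordAlgebra.contractLeft_ι_mul, map_sub, map_smul, map_mul, map_mul, hx, e,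
      CliffordAlgebra.contractLeft_ι_mul, h]

theorem map_contr (f g : Cn n × Cn n →ₗ[ℂ] Cn n × Cn n)
    (h₁ : ∀ v w, pair₁ (f v).1 (g w) = pair₁ v.1 w)
    (h₂ : ∀ v, g (0, v.2) = (0, (f v).2)) (a b : Lam n) :
    ExteriorAlgebra.map g (contr a b) =
      contr (ExteriorAlgebra.map f a) (ExteriorAlgebra.map g b) := by
  induction a using CliffordAlgebra.left_induction generalizing b with
  | algebraMap r =>
    simp [AlgHom.commutes, Module.algebraMap_end_apply]
  | add x y hx hy => simp only [map_add, LinearMap.add_apply, hx, hy]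
  | ι_mul x v hx =>
    have e : ∀ u : Cn n × Cn n, contr (CliffordAlgebra.ι 0 u) = contrGen u := fun u =>
      ExteriorAlgebra.lift_ι_apply ℂ contrGen contrGen_sq u
    have e' : ExteriorAlgebra.map f (CliffordAlgebra.ι 0 v) = CliffordAlgebra.ι 0 (f v) :=
      ExteriorAlgebra.map_apply_ι f v
    have e₂ : ExteriorAlgebra.map g (gen₂ v.2) = gen₂ (f v).2 := by
      simp only [gen₂, LinearMap.comp_apply, LinearMap.inr_apply, ExteriorAlgebra.map_apply_ι, h₂]
    rw [map_mul, map_mul, map_mul, e, e', e, Module.End.mul_apply, Module.End.mul_apply,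
      contrGen_apply, contrGen_apply, map_add, map_mul, hx, e₂,
      map_contractLeft g _ (pair₁ (f v).1) (h₁ v), hx]

theorem jac_mul_jac {x₀ x : X} (h : x ∈ (chartAt (Cn n) x₀).source) :
    (jac x₀ x x * jac x x₀ x : Matrix (Fin n) (Fin n) ℂ) = 1 := by
  have h₁ : x ∈ (extChartAt 𝓘(ℂ, Cn n) x).source := mem_extChartAt_source x
  have h₂ : x ∈ (extChartAt 𝓘(ℂ, Cn n) x₀).source := by rwa [extChartAt_source]
  rw [jac, jac, ← LinearMap.toMatrix'_comp, ← LinearMap.toMatrix'_id]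
  congr 1
  refine LinearMap.ext fun v => ?_
  exact (tangentCoordChange_comp ⟨⟨h₁, h₂⟩, h₁⟩).trans (tangentCoordChange_self h₁)

theorem map_contr_change {x₀ x : X} (h : x ∈ (chartAt (Cn n) x₀).source) (a b : Lam n) :
    ExteriorAlgebra.map (formChange x₀ x) (contr a b) =
      contr (ExteriorAlgebra.map (polyChange x₀ x) a)
        (ExteriorAlgebra.map (formChange x₀ x) b) := by
  refine map_contr _ _ (fun v w => ?_) (fun v => ?_) a b
  · change (jac x x₀ x).mulVec v.1 ⬝ᵥ (jac x₀ x x).transpose.mulVec w.1 = v.1 ⬝ᵥ w.1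
    rw [Matrix.dotProduct_mulVec, Matrix.vecMul_transpose, Matrix.mulVec_mulVec, jac_mul_jac h,
      Matrix.one_mulVec]
  · simp [formChange, polyChange]

theorem read_contr (γ s : X → Fib n A) {x₀ : X} {y : Cn n} (h : y ∈ (chartAt (Cn n) x₀).target) :
    read formChange x₀ (fun z => fibContr (γ z) (s z)) y =
      fibContr (read polyChange x₀ γ y) (read formChange x₀ s y) := by
  have hx : (chartAt (Cn n) x₀).symm y ∈ (chartAt (Cn n) x₀).source :=
    (chartAt (Cn n) x₀).map_target h
  simp only [read]
  generalize (chartAt (Cn n) x₀).symm y = x at hx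
  generalize γ x = a
  generalize s x = b
  have hinv : ∀ b : Lam n, ExteriorAlgebra.map (formChange x₀ x) (inv b) =
      inv (ExteriorAlgebra.map (formChange x₀ x) b) := fun b =>
    LinearMap.congr_fun (map_comp_inv (formChange x₀ x)) b
  induction a using TensorProduct.induction_on with
  | zero => simp
  | add a a' ha ha' => simp only [map_add, LinearMap.add_apply, ha, ha']
  | tmul a r =>
    induction b using TensorProduct.induction_on with
    | zero => simp
    | add b b' hb hb' => simp only [map_add, hb, hb']
    | tmul b r' =>
      simp [fibContr, koszul, TensorProduct.map₂_apply_tmul, map_contr_change hx, hinv]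

/-- A bilinear map in linear coordinates. -/
theorem contDiffOn_bilin {W : Type*} [AddCommGroup W] [Module ℂ W] [Module.Finite ℂ W]
    (F : W →ₗ[ℂ] W →ₗ[ℂ] W) {f g : Cn n → W} {U : Set (Cn n)}
    (hf : ContDiffOn ℝ ∞ (fun y => coords W (f y)) U)
    (hg : ContDiffOn ℝ ∞ (fun y => coords W (g y)) U) :
    ContDiffOn ℝ ∞ (fun y => coords W (F (f y) (g y))) U := by
  let N := Fin (Module.finrank ℂ W) → ℂ
  let G : N →ₗ[ℂ] N →ₗ[ℂ] N :=
    LinearMap.mk₂ ℂ (fun a b => coords W (F ((coords W).symm a) ((coords W).symm b)))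
      (by intros; simp) (by intros; simp) (by intros; simp) (by intros; simp)
  let G' : N →L[ℂ] N →L[ℂ] N := LinearMap.toContinuousLinearMap
    ((LinearMap.toContinuousLinearMap (𝕜 := ℂ) (E := N) (F' := N)).toLinearMap ∘ₗ G)
  have hG : ContDiff ℝ ∞ (fun p : N × N => G' p.1 p.2) :=
    (G'.isBoundedBilinearMap.contDiff (n := ∞)).restrict_scalars ℝ
  have := hG.comp_contDiffOn (hf.prodMk hg)
  convert this using 1
  funext y
  simp [G', G]

theorem IsSmooth.contr {γ s : X → Fib n A} (hγ : IsSmooth polyChange γ)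
    (hs : IsSmooth formChange s) : IsSmooth formChange (fun z => fibContr (γ z) (s z)) := by
  intro x₀
  refine (contDiffOn_bilin fibContr (hγ x₀) (hs x₀)).congr fun y hy => ?_
  rw [read_contr γ s hy]

end Contraction

end Fields

/-! ### Forms and polyvector fields with coefficients in a pro-Artin algebra -/

section Families

variable (n) (X : Type*) [TopologicalSpace X] [ChartedSpace (Cn n) X]
  [IsManifold 𝓘(ℂ, Cn n) ω X] (R : ProArtin.{u})

/-- Families of fields over the levels of `R`. -/
abbrev Fam := ∀ i : ℕ, X → Fib n (R.level i)

variable {n X R}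

/-- Compatibility with the transition maps of `R`. -/
def IsCompat (s : Fam n X R) : Prop :=
  ∀ (i j : ℕ) (h : i ≤ j) (x : X), (R.map h).toLinearMap.lTensor (Lam n) (s j x) = s i x

variable (n X R)

/-- `Ω^*(X,ℂ) ⊗̂ R = lim Ω^*(X,ℂ) ⊗ R_i`. As each `R_i` is finite-dimensional, an element of
`Ω^*(X,ℂ) ⊗ R_i` is a smooth section of the bundle of forms tensored with `R_i`. -/
def forms : Submodule ℂ (Fam n X R) where
  carrier := {s | (∀ i, IsSmooth formChange (s i)) ∧ IsCompat s}
  add_mem' {s t} hs ht := by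
    refine ⟨fun i => (hs.1 i).add (ht.1 i), fun i j h x => ?_⟩
    simp only [Pi.add_apply, map_add, hs.2 i j h x, ht.2 i j h x]
  zero_mem' := ⟨fun i => IsSmooth.zero, fun i j h x => by simp⟩
  smul_mem' c s hs := by
    refine ⟨fun i => (hs.1 i).smul c, fun i j h x => ?_⟩
    simp only [Pi.smul_apply, map_smul, hs.2 i j h x]

/-- `γ ∈ (𝔤[1] ⊗̂ 𝔐_R)^d` for `𝔤 = ⊕ Ω^{0,q}(X, Λ^p T)`, where `Ω^{0,q}(X, Λ^p T)` has degree
`q - p` in `𝔤[1]`. -/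
def IsPolyField (d : ℤ) (γ : Fam n X R) : Prop :=
  (∀ i, IsSmooth polyChange (γ i)) ∧ IsCompat γ ∧ ∀ i x, γ i x ∈ polyDeg n (R.level i) d

/-- `MC(R)`: the elements `γ ∈ (𝔤[1] ⊗̂ 𝔐_R)^0` with `∂̄γ + ½[γ,γ] = 0`. -/
structure MC where
  val : Fam n X R
  isPolyField : IsPolyField n X R 0 val
  maurerCartan : ∀ i x, polyDelbar (val i) x + (2⁻¹ : ℂ) • schouten (val i) (val i) x = 0

variable {n X R}

/-- The gauge transformation of `γ` by `exp α`, the time-one flow of `γ̇ = ∂̄α + [γ,α]`: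
`∑_k ((ad α)^k ∂̄α / (k+1)! + (ad α)^k γ / k!)`, where `ad α = [·, α]`. The sum is finite at
each level, as `α` has coefficients in the nilpotent maximal ideal. -/
def gauge (α γ : Fam n X R) : Fam n X R := fun i x =>
  ∑ᶠ k : ℕ,
    ((((k + 1).factorial : ℂ)⁻¹) • (fun s => schouten s (α i))^[k] (polyDelbar (α i)) x +
      ((k.factorial : ℂ)⁻¹) • (fun s => schouten s (α i))^[k] (γ i) x)

variable (n X R)

/-- `𝓜(R)`: the solutions of the Maurer–Cartan equation modulo gauge transformations by
`exp ((𝔤 ⊗̂ 𝔐_R)^0)`, where `𝔤^0 = 𝔤[1]^{-1}`. -/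
def Moduli : Type _ :=
  Quot fun γ γ' : MC n X R => ∃ α : Fam n X R, IsPolyField n X R (-1) α ∧ γ'.val = gauge α γ.val

variable {n X R}

/-- The point of `𝓜(R)` described by a solution of the Maurer–Cartan equation. -/
def MC.point (γ : MC n X R) : Moduli n X R := Quot.mk _ γ

/-- `∂_v` on forms and on polyvector fields with coefficients in `R`, with the Koszul sign for the
odd part of `v`. -/
def derFam (v : R.Der) (s : Fam n X R) : Fam n X R := fun i x =>
  TensorProduct.map LinearMap.id (v.even i) (s (v.shift i) x) +
    TensorProduct.map inv (v.odd i) (s (v.shift i) x)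

theorem derFam_mem (v : R.Der) {s : Fam n X R} (hs : s ∈ forms n X R) :
    derFam v s ∈ forms n X R := by
  refine ⟨fun i => ?_, fun i j h x => ?_⟩
  · exact ((hs.1 (v.shift i)).map _ _ map_comp_id).add ((hs.1 (v.shift i)).map _ _ map_comp_inv)
  · have hi : v.shift i ≤ max (v.shift i) (v.shift j) := le_max_left _ _
    have hj : v.shift j ≤ max (v.shift i) (v.shift j) := le_max_right _ _
    simp only [derFam, ← hs.2 _ _ hi x, ← hs.2 _ _ hj x]
    generalize s (max (v.shift i) (v.shift j)) x = w
    induction w using TensorProduct.induction_on with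
    | zero => simp
    | tmul a r => simp [v.even_compat h hi hj, v.odd_compat h hi hj]
    | add w w' hw hw' =>
      simp only [map_add] at hw hw' ⊢
      rw [add_add_add_comm, hw, hw', add_add_add_comm]

end Families

/-! ### Series in `ħ` and the two complexes -/

section Complexes

variable (n) (X : Type*) [TopologicalSpace X] [ChartedSpace (Cn n) X]
  [IsManifold 𝓘(ℂ, Cn n) ω X] (R : ProArtin.{u})

/-- Two-sided formal series with coefficients indexed by `ℤ`. -/
abbrev Series := ℤ → Fam n X R

/-- `Ω^{*,*} ⊗ ℂ[[ħ⁻¹,ħ]] ⊗̂ R`: the index `m` stands for `ħ^m`. -/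
def intSeries : Submodule ℂ (Series n X R) where
  carrier := {Φ | ∀ m, Φ m ∈ forms n X R}
  add_mem' hΦ hΨ m := add_mem (hΦ m) (hΨ m)
  zero_mem' _ := zero_mem _
  smul_mem' c _ hΦ m := Submodule.smul_mem _ c (hΦ m)

/-- `Ω^*(X,ℂ)[[ħ⁻¹,ħ]] ⊗̂ R`: the index `k` stands for `ħ^{k/2}`; forms of even degree come with
integral powers of `ħ` and forms of odd degree with half-integral ones. -/
def halfSeries : Submodule ℂ (Series n X R) where
  carrier := {Ψ | (∀ k, Ψ k ∈ forms n X R) ∧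
    ∀ k i x, inv.rTensor (R.level i).carrier (Ψ k i x) = k.negOnePow • Ψ k i x}
  add_mem' hΦ hΨ := ⟨fun m => add_mem (hΦ.1 m) (hΨ.1 m), fun k i x => by
    simp only [Pi.add_apply, map_add, hΦ.2, hΨ.2, smul_add]⟩
  zero_mem' := ⟨fun m => zero_mem _, fun k i x => by simp⟩
  smul_mem' c Φ hΦ := ⟨fun m => Submodule.smul_mem _ c (hΦ.1 m), fun k i x => by
    simp only [Pi.smul_apply, map_smul, hΦ.2]
    rw [smul_comm]⟩

variable {n X R}

/-- The differential `ħ^{1/2} (∂̄ + ∂)` on `Ω^*(X,ℂ)[[ħ⁻¹,ħ]] ⊗̂ R`. -/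
def dHalf (Ψ : Series n X R) : Series n X R := fun k i x =>
  delbar (Ψ (k - 1) i) x + del (Ψ (k - 1) i) x

theorem del_smul {A : GradedArtin.{u}} {s : X → Fib n A} (c : ℂ) (hs : IsSmooth formChange s) :
    del (c • s) = c • del s := by
  have h := del_map (c • LinearMap.id) (LinearMap.id (M := A.carrier)) 1 (by intro g; ext; simp)
    (by intros; simp) hs
  simpa [TensorProduct.map_smul_left, Pi.smul_def] using h

theorem delbar_smul {A : GradedArtin.{u}} {s : X → Fib n A} (c : ℂ)
    (hs : IsSmooth formChange s) : delbar (c • s) = c • delbar s := by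
  have h := delbar_map (c • LinearMap.id) (LinearMap.id (M := A.carrier)) 1
    (by intro g; ext; simp) (by intros; simp) hs
  simpa [TensorProduct.map_smul_left, Pi.smul_def] using h

theorem dHalf_add {Φ Ψ : Series n X R} (hΦ : ∀ k, Φ k ∈ forms n X R)
    (hΨ : ∀ k, Ψ k ∈ forms n X R) : dHalf (Φ + Ψ) = dHalf Φ + dHalf Ψ := by
  funext k i x
  have h₁ := congrFun (del_add ((hΦ (k - 1)).1 i) ((hΨ (k - 1)).1 i)) x
  have h₂ := congrFun (delbar_add ((hΦ (k - 1)).1 i) ((hΨ (k - 1)).1 i)) x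
  simp only [Pi.add_apply] at h₁ h₂
  simp only [dHalf, Pi.add_apply, h₁, h₂]
  abel

theorem dHalf_smul (c : ℂ) {Φ : Series n X R} (hΦ : ∀ k, Φ k ∈ forms n X R) :
    dHalf (c • Φ) = c • dHalf Φ := by
  funext k i x
  have h₁ := congrFun (del_smul c ((hΦ (k - 1)).1 i)) x
  have h₂ := congrFun (delbar_smul c ((hΦ (k - 1)).1 i)) x
  simp only [Pi.smul_apply] at h₁ h₂
  simp only [dHalf, Pi.smul_apply, h₁, h₂, smul_add]

theorem dHalf_zero : dHalf (0 : Series n X R) = 0 := by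
  simpa using dHalf_smul (0 : ℂ) (Φ := (0 : Series n X R)) (fun k => zero_mem _)

variable (n X R)

/-- The cocycles of `(Ω^*(X,ℂ)[[ħ⁻¹,ħ]] ⊗̂ R, ħ^{1/2}(∂̄ + ∂))`. -/
def dRCocycles : Submodule ℂ (Series n X R) where
  carrier := {Ψ | Ψ ∈ halfSeries n X R ∧ dHalf Ψ = 0}
  add_mem' hΦ hΨ := ⟨add_mem hΦ.1 hΨ.1, by
    rw [dHalf_add hΦ.1.1 hΨ.1.1, hΦ.2, hΨ.2, add_zero]⟩
  zero_mem' := ⟨zero_mem _, dHalf_zero⟩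
  smul_mem' c Φ hΦ := ⟨Submodule.smul_mem _ c hΦ.1, by
    rw [dHalf_smul c hΦ.1.1, hΦ.2, smul_zero]⟩

/-- The coboundaries of `(Ω^*(X,ℂ)[[ħ⁻¹,ħ]] ⊗̂ R, ħ^{1/2}(∂̄ + ∂))`. -/
def dRCoboundaries : Submodule ℂ (Series n X R) where
  carrier := {Ψ | ∃ η ∈ halfSeries n X R, dHalf η = Ψ}
  add_mem' := by
    rintro _ _ ⟨η, hη, rfl⟩ ⟨θ, hθ, rfl⟩
    exact ⟨η + θ, add_mem hη hθ, dHalf_add hη.1 hθ.1⟩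
  zero_mem' := ⟨0, zero_mem _, dHalf_zero⟩
  smul_mem' := by
    rintro c _ ⟨η, hη, rfl⟩
    exact ⟨c • η, Submodule.smul_mem _ c hη, dHalf_smul c hη.1⟩

/-- The cohomology of `(Ω^*(X,ℂ)[[ħ⁻¹,ħ]] ⊗̂ R, ħ^{1/2}(∂̄ + ∂))`, that is,
`H^*(X,ℂ)[[ħ⁻¹,ħ]] ⊗̂ R`. -/
abbrev dRCohomology : Type _ :=
  dRCocycles n X R ⧸ (dRCoboundaries n X R).comap (dRCocycles n X R).subtype

variable {n X R}

/-- The class of a cocycle. -/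
def dRClass (Ψ : Series n X R) (h : Ψ ∈ dRCocycles n X R) : dRCohomology n X R :=
  Submodule.Quotient.mk ⟨Ψ, h⟩

/-- Multiplication by `ħ⁻¹` on `Ω^*(X,ℂ)[[ħ⁻¹,ħ]] ⊗̂ R`. -/
def hbarInvSeries : Series n X R →ₗ[ℂ] Series n X R where
  toFun Ψ k := Ψ (k + 2)
  map_add' _ _ := rfl
  map_smul' _ _ := rfl

theorem dHalf_hbarInv (Ψ : Series n X R) :
    dHalf (hbarInvSeries Ψ) = hbarInvSeries (dHalf Ψ) := by
  funext k i x
  simp only [dHalf, hbarInvSeries, LinearMap.coe_mk, AddHom.coe_mk]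
  rw [show k - 1 + 2 = k + 2 - 1 by ring]

theorem hbarInv_mem_half {Ψ : Series n X R} (h : Ψ ∈ halfSeries n X R) :
    hbarInvSeries Ψ ∈ halfSeries n X R := by
  refine ⟨fun k => h.1 (k + 2), fun k i x => ?_⟩
  have := h.2 (k + 2) i x
  rwa [Int.negOnePow_add, show (2 : ℤ).negOnePow = 1 from rfl, mul_one] at this

theorem hbarInv_mem {Ψ : Series n X R} (h : Ψ ∈ dRCocycles n X R) :
    hbarInvSeries Ψ ∈ dRCocycles n X R :=
  ⟨hbarInv_mem_half h.1, by rw [dHalf_hbarInv, h.2, map_zero]⟩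

/-- Multiplication by `ħ⁻¹` on `H^*(X,ℂ)[[ħ⁻¹,ħ]] ⊗̂ R`. -/
def hbarInv : dRCohomology n X R →ₗ[ℂ] dRCohomology n X R :=
  Submodule.mapQ _ _ (hbarInvSeries.restrict fun _ h => hbarInv_mem h) <| by
    rintro ⟨Ψ, hΨ⟩ ⟨η, hη, e⟩
    refine ⟨hbarInvSeries η, hbarInv_mem_half hη, ?_⟩
    rw [dHalf_hbarInv, e]
    rfl

/-- `∂_v` on series. -/
def derSeries (v : R.Der) : Series n X R →ₗ[ℂ] Series n X R where
  toFun Φ m := derFam v (Φ m)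
  map_add' Φ Ψ := by
    funext m i x
    simp only [derFam, Pi.add_apply, map_add]
    abel
  map_smul' c Φ := by
    funext m i x
    simp only [derFam, Pi.smul_apply, map_smul, smul_add, RingHom.id_apply]

/-- The derivation `v₀ - v₁` for `v = v₀ + v₁` with `v₀` even and `v₁` odd. -/
def ProArtin.Der.conj (v : R.Der) : R.Der where
  shift := v.shift
  le_shift := v.le_shift
  even := v.even
  odd i := -v.odd i
  even_compat := v.even_compat
  odd_compat h hi hj r := by simp [v.odd_compat h hi hj]
  even_parity := v.even_parity
  odd_parity i r := by simp [v.odd_parity]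
  even_mul := v.even_mul
  odd_mul i r s := by simp [v.odd_mul]; abel

theorem ι_mul_inv (w : Cn n × Cn n) (b : Lam n) :
    ExteriorAlgebra.ι ℂ w * inv b = (-1 : ℂ) • inv (ExteriorAlgebra.ι ℂ w * b) := by
  have : inv (ExteriorAlgebra.ι ℂ w * b) = -(ExteriorAlgebra.ι ℂ w * inv b) := by
    change CliffordAlgebra.involute _ = _
    rw [map_mul]
    erw [CliffordAlgebra.involute_ι]
    rw [neg_mul]
    rfl
  simp [this]

theorem del_der {A B : GradedArtin.{u}} {s : X → Fib n A} (f g : A.carrier →ₗ[ℂ] B.carrier)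
    (hs : IsSmooth formChange s) (x : X) :
    del (fun z => TensorProduct.map LinearMap.id f (s z) + TensorProduct.map inv g (s z)) x =
      TensorProduct.map LinearMap.id f (del s x) - TensorProduct.map inv g (del s x) := by
  have h := congrFun (del_add (hs.map LinearMap.id f map_comp_id) (hs.map inv g map_comp_inv)) x
  rw [del_map LinearMap.id f 1 map_comp_id (by intros; simp) hs,
    del_map inv g (-1) map_comp_inv ι_mul_inv hs] at h
  refine h.trans ?_
  rw [Pi.add_apply, one_smul, neg_one_smul, sub_eq_add_neg]

theorem delbar_der {A B : GradedArtin.{u}} {s : X → Fib n A} (f g : A.carrier →ₗ[ℂ] B.carrier)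
    (hs : IsSmooth formChange s) (x : X) :
    delbar (fun z => TensorProduct.map LinearMap.id f (s z) + TensorProduct.map inv g (s z)) x =
      TensorProduct.map LinearMap.id f (delbar s x) - TensorProduct.map inv g (delbar s x) := by
  have h := congrFun
    (delbar_add (hs.map LinearMap.id f map_comp_id) (hs.map inv g map_comp_inv)) x
  rw [delbar_map LinearMap.id f 1 map_comp_id (by intros; simp) hs,
    delbar_map inv g (-1) map_comp_inv ι_mul_inv hs] at h
  refine h.trans ?_
  rw [Pi.add_apply, one_smul, neg_one_smul, sub_eq_add_neg]

theorem map_inv_neg {A B : GradedArtin.{u}} (g : A.carrier →ₗ[ℂ] B.carrier) (w : Fib n A) :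
    TensorProduct.map inv (-g) w = -TensorProduct.map inv g w := by
  induction w using TensorProduct.induction_on with
  | zero => simp
  | tmul a r => simp [TensorProduct.tmul_neg]
  | add w w' h h' => simp only [map_add, h, h', neg_add]

theorem derFam_conj (v : R.Der) (s : Fam n X R) (i : ℕ) (x : X) :
    derFam v.conj s i x = TensorProduct.map LinearMap.id (v.even i) (s (v.shift i) x) -
      TensorProduct.map inv (v.odd i) (s (v.shift i) x) :=
  (congrArg (TensorProduct.map LinearMap.id (v.even i) (s (v.shift i) x) + ·)
    (map_inv_neg (v.odd i) (s (v.shift i) x))).trans (sub_eq_add_neg _ _).symm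

theorem dHalf_der (v : R.Der) {Ψ : Series n X R} (h : ∀ k, Ψ k ∈ forms n X R) :
    dHalf (derSeries v Ψ) = derSeries v.conj (dHalf Ψ) := by
  funext k i x
  have hs := (h (k - 1)).1 (v.shift i)
  have e₁ := del_der (v.even i) (v.odd i) hs x
  have e₂ := delbar_der (v.even i) (v.odd i) hs x
  have e₃ := derFam_conj v (dHalf Ψ k) i x
  refine (congrArg₂ (· + ·) e₂ e₁).trans (Eq.trans ?_ e₃.symm)
  simp only [dHalf, map_add]
  abel

theorem dHalf_der_conj (v : R.Der) {Ψ : Series n X R} (h : ∀ k, Ψ k ∈ forms n X R) :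
    dHalf (derSeries v.conj Ψ) = derSeries v (dHalf Ψ) := by
  rw [dHalf_der v.conj h]
  funext k i x
  refine (derFam_conj v.conj (dHalf Ψ k) i x).trans ?_
  refine (congrArg (TensorProduct.map LinearMap.id (v.even i) (dHalf Ψ k (v.shift i) x) - ·)
    (map_inv_neg (v.odd i) (dHalf Ψ k (v.shift i) x))).trans ?_
  exact sub_neg_eq_add _ _

theorem derSeries_mem_half (v : R.Der) {Ψ : Series n X R} (h : Ψ ∈ halfSeries n X R) :
    derSeries v Ψ ∈ halfSeries n X R := by
  refine ⟨fun k => derFam_mem v (h.1 k), fun k i x => ?_⟩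
  have e := h.2 k (v.shift i) x
  have key : ∀ (f : (R.level (v.shift i)).carrier →ₗ[ℂ] (R.level i).carrier)
      (L : Lam n →ₗ[ℂ] Lam n) (_ : inv ∘ₗ L = L ∘ₗ inv),
      inv.rTensor (R.level i).carrier (TensorProduct.map L f (Ψ k (v.shift i) x)) =
        k.negOnePow • TensorProduct.map L f (Ψ k (v.shift i) x) := by
    intro f L hL
    rw [← LinearMap.comp_apply, LinearMap.rTensor_comp_map, hL, ← LinearMap.map_comp_rTensor,
      LinearMap.comp_apply, e]
    rcases Int.units_eq_one_or k.negOnePow with hk | hk <;> simp [hk]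
  simp only [derSeries, derFam, LinearMap.coe_mk, AddHom.coe_mk, map_add, smul_add]
  rw [key (v.even i) LinearMap.id rfl, key (v.odd i) inv rfl]

theorem derSeries_mem (v : R.Der) {Ψ : Series n X R} (h : Ψ ∈ dRCocycles n X R) :
    derSeries v Ψ ∈ dRCocycles n X R :=
  ⟨derSeries_mem_half v h.1, by rw [dHalf_der v h.1.1, h.2, map_zero]⟩

/-- `∂_v` on `H^*(X,ℂ)[[ħ⁻¹,ħ]] ⊗̂ R`. -/
def dRDer (v : R.Der) : dRCohomology n X R →ₗ[ℂ] dRCohomology n X R :=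
  Submodule.mapQ _ _ ((derSeries v).restrict fun _ h => derSeries_mem v h) <| by
    rintro ⟨Ψ, hΨ⟩ ⟨η, hη, e⟩
    refine ⟨derSeries v.conj η, derSeries_mem_half v.conj hη, ?_⟩
    rw [dHalf_der_conj v hη.1, e]
    rfl

/-! The fibre of the Gauss–Manin local system over the point described by `γ`. -/

/-- `i_γ` on families. -/
def contrFam (γ s : Fam n X R) : Fam n X R := fun i x => fibContr (γ i x) (s i x)

/-- The differential `∂̄ + [∂, i_γ] + ħ∂` on `Ω^{*,*} ⊗ ℂ[[ħ⁻¹,ħ]] ⊗̂ R`. For `γ` of degree `0` the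
operator `i_γ` is even, so that `[∂, i_γ] = ∂ i_γ - i_γ ∂`. -/
def dTwist (γ : Fam n X R) (Φ : Series n X R) : Series n X R := fun m i x =>
  delbar (Φ m i) x + (del (contrFam γ (Φ m) i) x - fibContr (γ i x) (del (Φ m i) x)) +
    del (Φ (m - 1) i) x

theorem dTwist_add (γ : MC n X R) {Φ Ψ : Series n X R} (hΦ : Φ ∈ intSeries n X R)
    (hΨ : Ψ ∈ intSeries n X R) :
    dTwist γ.val (Φ + Ψ) = dTwist γ.val Φ + dTwist γ.val Ψ := by
  funext m i x
  have c₁ := (γ.isPolyField.1 i).contr ((hΦ m).1 i)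
  have c₂ := (γ.isPolyField.1 i).contr ((hΨ m).1 i)
  have e : contrFam γ.val (Φ m + Ψ m) i =
      contrFam γ.val (Φ m) i + contrFam γ.val (Ψ m) i := by
    funext x; simp [contrFam]
  have h₁ := congrFun (delbar_add ((hΦ m).1 i) ((hΨ m).1 i)) x
  have h₂ := congrFun (del_add c₁ c₂) x
  have h₃ := congrFun (del_add ((hΦ m).1 i) ((hΨ m).1 i)) x
  have h₄ := congrFun (del_add ((hΦ (m - 1)).1 i) ((hΨ (m - 1)).1 i)) x
  change _ = del (contrFam γ.val (Φ m) i) x + del (contrFam γ.val (Ψ m) i) x at h₂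
  simp only [Pi.add_apply] at h₁ h₃ h₄
  change delbar (Φ m i + Ψ m i) x + (del (contrFam γ.val (Φ m + Ψ m) i) x -
    fibContr (γ.val i x) (del (Φ m i + Ψ m i) x)) + del (Φ (m - 1) i + Ψ (m - 1) i) x = _
  rw [e, h₁, h₃, h₄]
  erw [h₂]
  simp only [dTwist, Pi.add_apply, map_add]
  abel

theorem dTwist_smul (γ : MC n X R) (c : ℂ) {Φ : Series n X R} (hΦ : Φ ∈ intSeries n X R) :
    dTwist γ.val (c • Φ) = c • dTwist γ.val Φ := by
  funext m i x
  have c₁ := (γ.isPolyField.1 i).contr ((hΦ m).1 i)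
  have e : contrFam γ.val (c • Φ m) i = c • contrFam γ.val (Φ m) i := by
    funext x; simp [contrFam]
  have h₁ := congrFun (delbar_smul c ((hΦ m).1 i)) x
  have h₂ := congrFun (del_smul c c₁) x
  have h₃ := congrFun (del_smul c ((hΦ m).1 i)) x
  have h₄ := congrFun (del_smul c ((hΦ (m - 1)).1 i)) x
  change _ = c • del (contrFam γ.val (Φ m) i) x at h₂
  simp only [Pi.smul_apply] at h₁ h₃ h₄
  change delbar (c • Φ m i) x + (del (contrFam γ.val (c • Φ m) i) x -
    fibContr (γ.val i x) (del (c • Φ m i) x)) + del (c • Φ (m - 1) i) x = _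
  rw [e, h₁, h₃, h₄]
  erw [h₂]
  simp only [dTwist, Pi.smul_apply, map_smul, smul_add, smul_sub]

theorem dTwist_zero (γ : MC n X R) : dTwist γ.val (0 : Series n X R) = 0 := by
  simpa using dTwist_smul γ (0 : ℂ) (zero_mem (intSeries n X R))

/-- The cocycles of `(Ω^{*,*} ⊗ ℂ[[ħ⁻¹,ħ]] ⊗̂ R, ∂̄ + [∂, i_γ] + ħ∂)`. -/
def gmCocycles (γ : MC n X R) : Submodule ℂ (Series n X R) where
  carrier := {Φ | Φ ∈ intSeries n X R ∧ dTwist γ.val Φ = 0}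
  add_mem' hΦ hΨ := ⟨add_mem hΦ.1 hΨ.1, by
    rw [dTwist_add γ hΦ.1 hΨ.1, hΦ.2, hΨ.2, add_zero]⟩
  zero_mem' := ⟨zero_mem _, dTwist_zero γ⟩
  smul_mem' c Φ hΦ := ⟨Submodule.smul_mem _ c hΦ.1, by
    rw [dTwist_smul γ c hΦ.1, hΦ.2, smul_zero]⟩

/-- The coboundaries of `(Ω^{*,*} ⊗ ℂ[[ħ⁻¹,ħ]] ⊗̂ R, ∂̄ + [∂, i_γ] + ħ∂)`. -/
def gmCoboundaries (γ : MC n X R) : Submodule ℂ (Series n X R) where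
  carrier := {Φ | ∃ η ∈ intSeries n X R, dTwist γ.val η = Φ}
  add_mem' := by
    rintro _ _ ⟨η, hη, rfl⟩ ⟨θ, hθ, rfl⟩
    exact ⟨η + θ, add_mem hη hθ, dTwist_add γ hη hθ⟩
  zero_mem' := ⟨0, zero_mem _, dTwist_zero γ⟩
  smul_mem' := by
    rintro c _ ⟨η, hη, rfl⟩
    exact ⟨c • η, Submodule.smul_mem _ c hη, dTwist_smul γ c hη⟩

/-- The fibre over `γ` of the Gauss–Manin local system: the cohomology of
`(Ω^{*,*} ⊗ ℂ[[ħ⁻¹,ħ]] ⊗̂ R, ∂̄ + [∂, i_γ] + ħ∂)`. -/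
abbrev gmFibre (γ : MC n X R) : Type _ :=
  gmCocycles γ ⧸ (gmCoboundaries γ).comap (gmCocycles γ).subtype

/-- The class of a cocycle. -/
def gmClass (γ : MC n X R) (Φ : Series n X R) (h : Φ ∈ gmCocycles γ) : gmFibre γ :=
  Submodule.Quotient.mk ⟨Φ, h⟩

/-- The Gauss–Manin connection on representatives: `∇_v = ∂_v + ħ⁻¹ i_{∂_v γ}`. -/
def nablaSeries (γ : MC n X R) (v : R.Der) (Φ : Series n X R) : Series n X R := fun m =>
  derFam v (Φ m) + contrFam (derFam v γ.val) (Φ (m + 1))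

/-- The operator `exp(ħ⁻¹ i_γ)`. The sum is finite at each level. -/
def expContr (γ : MC n X R) (Φ : Series n X R) : Series n X R := fun m i x =>
  ∑ᶠ k : ℕ, ((k.factorial : ℂ)⁻¹) • ((fibContr (γ.val i x)) ^ k) (Φ (m + k) i x)

/-- The rescaling `l_ħ : φ^{p,q} ↦ ħ^{(q-p)/2} φ^{p,q}`, from series in `ħ` to series in
`ħ^{1/2}`. -/
def rescale (Φ : Series n X R) : Series n X R := fun k i x =>
  ∑ p ∈ Finset.range (n + 1), ∑ q ∈ Finset.range (n + 1),
    if Even (k - ((q : ℤ) - p)) then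
      (comp p q).rTensor (R.level i).carrier (Φ ((k - ((q : ℤ) - p)) / 2) i x)
    else 0

/-- The operator `l_ħ exp(ħ⁻¹ i_γ)`. -/
def transportSeries (γ : MC n X R) (Φ : Series n X R) : Series n X R := rescale (expContr γ Φ)

/-- `Ω^*(X,ℂ) ⊗̂ R [[ħ]]`: the series `φ₀ + φ₁ħ + φ₂ħ² + …`. -/
def powerSeries (n : ℕ) (X : Type*) [TopologicalSpace X] [ChartedSpace (Cn n) X]
    [IsManifold 𝓘(ℂ, Cn n) ω X] (R : ProArtin.{u}) : Set (Series n X R) :=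
  {Φ | Φ ∈ intSeries n X R ∧ ∀ m < 0, Φ m = 0}

/-- The classes in `H^*(X,ℂ)[[ħ⁻¹,ħ]] ⊗̂ R` represented by cocycles of the form
`l_ħ exp(ħ⁻¹ i_γ)(φ₀ + φ₁ħ + φ₂ħ² + …)`. -/
def semiInfOf (γ : MC n X R) : Set (dRCohomology n X R) :=
  {c | ∃ Φ ∈ powerSeries n X R, ∃ h : transportSeries γ Φ ∈ dRCocycles n X R,
    c = dRClass (transportSeries γ Φ) h}

/-- The semi-infinite subspace `L(φ)`, `φ ∈ 𝓜(R)`: the classes represented by cocycles of the form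
`l_ħ exp(ħ⁻¹ i_γ)(φ₀ + φ₁ħ + φ₂ħ² + …)`, where `γ` describes `φ`. -/
def semiInf (φ : Moduli n X R) : Set (dRCohomology n X R) :=
  {c | ∃ γ : MC n X R, γ.point = φ ∧ c ∈ semiInfOf γ}

end Complexes

end SemiInfinite

end

open scoped Manifold ContDiff
open SemiInfinite

open scoped TensorProduct

noncomputable section

namespace SemiInfinite

universe u

variable {n : ℕ}

/-! ### The exterior algebra on two kinds of generators -/

/-! Everything follows from two operator identities for e = l_ħ exp(ħ⁻¹ i_γ), both valid on cochains
and not only on classes.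

First, e intertwines ∂̄ + [∂, i_γ] + ħ∂ with ħ^{1/2}(∂̄ + ∂) (`transportSeries_dTwist`). Since γ has
total degree 0, i_γ is even and commutes with every contraction. Hence [∂̄, i_γ] = i_{∂̄γ} and [[∂,
i_γ], i_γ] = i_{[γ,γ]} commute with i_γ, and conjugating ∂̄ + ħ∂ by exp(ħ⁻¹ i_γ) stops after the
double commutator: the result is ∂̄ + ħ∂ + [∂, i_γ] + ħ⁻¹ i_{∂̄γ + ½[γ,γ]}. The Maurer–Cartan
equation removes exactly the term in ħ⁻¹ (`delbar_add_del_expSum`). The rescaling l_ħ then turns ∂̄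
+ ħ∂ into ħ^{1/2}(∂̄ + ∂), because ∂̄ has bidegree (0,1) and ∂ has bidegree (1,0) (`rescale_dInt`).

Second, ∂_v e = e ∇_v (`transportSeries_nabla`). This is the Leibniz rule for ∂_v and i_γ, which
carries no sign because γ is even, combined with the fact that i_γ commutes with i_{∂_vγ}
(`derSeries_expContr`).

Moreover e is a bijection from integral series to series with the parity condition. The coefficients
of γ lie in a nilpotent ideal at each level, so exp(−ħ⁻¹ i_γ) is a finite sum and inverts the
exponential (`expFam_neg_expFam`), and l_ħ is inverted one bidegree at a time. So e matches cocycles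
with cocycles and coboundaries with coboundaries, and P_γ is the induced map. The connection is ∂_v
on de Rham classes carried back by P_γ.

Transversality is then a count of powers of ħ: for Φ = φ₀ + φ₁ħ + … the series ∇_vΦ starts at ħ⁻¹ at
worst, so ħ∇_vΦ is again a power series, and multiplication by ħ commutes with both differentials
and with e (`dRDer_semiInfOf`). -/

theorem ι_eq_gen₁_add_gen₂ (w : Cn n × Cn n) :
    CliffordAlgebra.ι 0 w = gen₁ w.1 + gen₂ w.2 := by
  change ExteriorAlgebra.ι ℂ w = _
  simp only [gen₁, gen₂, LinearMap.comp_apply, ← map_add]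
  simp

/-- Splitting each generator into its two kinds makes bidegree statements accessible to induction,
since `comp` has a simple recursion for each kind separately. -/
theorem Lam.induction {P : Lam n → Prop} (scalar : ∀ c, P (algebraMap ℂ (Lam n) c))
    (add : ∀ a b, P a → P b → P (a + b)) (gen₁_mul : ∀ v a, P a → P (gen₁ v * a))
    (gen₂_mul : ∀ v a, P a → P (gen₂ v * a)) (a : Lam n) : P a := by
  induction a using CliffordAlgebra.left_induction with
  | algebraMap c => exact scalar c
  | add a b ha hb => exact add a b ha hb
  | ι_mul a v ha =>
    rw [ι_eq_gen₁_add_gen₂, add_mul]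
    exact add _ _ (gen₁_mul _ _ ha) (gen₂_mul _ _ ha)

/-! ### Parity and supercommutativity of the exterior algebra. -/

@[simp] theorem inv_algebraMap (c : ℂ) : inv (algebraMap ℂ (Lam n) c) = algebraMap ℂ _ c :=
  AlgHom.commutes (CliffordAlgebra.involute (Q := 0)) c

theorem inv_mul (a b : Lam n) : inv (a * b) = inv a * inv b :=
  map_mul (CliffordAlgebra.involute (Q := 0)) a b

@[simp] theorem inv_inv (a : Lam n) : inv (inv a) = a := CliffordAlgebra.involute_involute a

@[simp] theorem inv_ι (w : Cn n × Cn n) :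
    inv (CliffordAlgebra.ι 0 w : Lam n) = -CliffordAlgebra.ι 0 w :=
  CliffordAlgebra.involute_ι w

@[simp] theorem inv_gen₁ (v : Cn n) : inv (gen₁ v) = -gen₁ v := inv_ι _

@[simp] theorem inv_gen₂ (v : Cn n) : inv (gen₂ v) = -gen₂ v := inv_ι _

theorem ι_mul_comm (w : Cn n × Cn n) (b : Lam n) :
    (CliffordAlgebra.ι 0 w : Lam n) * b = inv b * CliffordAlgebra.ι 0 w := by
  induction b using CliffordAlgebra.left_induction with
  | algebraMap c => rw [inv_algebraMap]; exact (Algebra.commutes c _).symm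
  | add a b ha hb => rw [map_add, mul_add, add_mul, ha, hb]
  | ι_mul a v ha =>
    have h : (CliffordAlgebra.ι 0 w : Lam n) * CliffordAlgebra.ι 0 v =
        -(CliffordAlgebra.ι 0 v * CliffordAlgebra.ι 0 w) :=
      eq_neg_of_add_eq_zero_left (ExteriorAlgebra.ι_add_mul_swap w v)
    rw [← mul_assoc, h, neg_mul, mul_assoc, ha, inv_mul, inv_ι, neg_mul, neg_mul, mul_assoc]

/-- Up to a factor 2 the two combinations are the even and odd parts of `a`. The claims must be
proved together: left multiplication by a generator exchanges the two parts, so each inductive step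
uses the other claim. -/
theorem add_inv_mul_comm_and_sub_inv_mul_comm (a : Lam n) :
    (∀ b, (a + inv a) * b = b * (a + inv a)) ∧
      ∀ b, (a - inv a) * b = inv b * (a - inv a) := by
  induction a using CliffordAlgebra.left_induction with
  | algebraMap c =>
    refine ⟨fun b => ?_, fun b => ?_⟩
    · rw [inv_algebraMap, ← map_add]; exact Algebra.commutes _ b
    · rw [inv_algebraMap, sub_self, zero_mul, mul_zero]
  | add a b ha hb =>
    refine ⟨fun c => ?_, fun c => ?_⟩
    · rw [map_add, add_add_add_comm, add_mul, mul_add, ha.1, hb.1]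
    · rw [map_add, add_sub_add_comm, add_mul, mul_add, ha.2, hb.2]
  | ι_mul a w ha =>
    refine ⟨fun b => ?_, fun b => ?_⟩
    · rw [inv_mul, inv_ι, neg_mul, ← sub_eq_add_neg, ← mul_sub, mul_assoc, ha.2, ← mul_assoc,
        ι_mul_comm, inv_inv, mul_assoc]
    · rw [inv_mul, inv_ι, neg_mul, sub_neg_eq_add, ← mul_add, mul_assoc, ha.1, ← mul_assoc,
        ι_mul_comm, mul_assoc]

theorem mul_comm_of_inv_eq {a : Lam n} (ha : inv a = a) (b : Lam n) : a * b = b * a := by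
  have h := (add_inv_mul_comm_and_sub_inv_mul_comm a).1 b
  rw [ha, ← two_smul ℂ a, smul_mul_assoc, mul_smul_comm] at h
  exact smul_right_injective _ two_ne_zero h

theorem mul_comm_of_inv_eq_neg {a : Lam n} (ha : inv a = -a) (b : Lam n) :
    a * b = inv b * a := by
  have h := (add_inv_mul_comm_and_sub_inv_mul_comm a).2 b
  rw [ha, sub_neg_eq_add, ← two_smul ℂ a, smul_mul_assoc, mul_smul_comm] at h
  exact smul_right_injective _ two_ne_zero h

theorem contractLeft_inv (d : Module.Dual ℂ (Cn n × Cn n)) (b : Lam n) :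
    CliffordAlgebra.contractLeft d (inv b) = -inv (CliffordAlgebra.contractLeft d b) := by
  induction b using CliffordAlgebra.left_induction with
  | algebraMap c => simp [CliffordAlgebra.contractLeft_algebraMap]
  | add a b ha hb => rw [map_add, map_add, map_add, map_add, ha, hb, neg_add]
  | ι_mul a w ha =>
    rw [inv_mul, inv_ι, neg_mul, map_neg, CliffordAlgebra.contractLeft_ι_mul,
      CliffordAlgebra.contractLeft_ι_mul, ha, map_sub, map_smul, inv_mul, inv_ι]
    simp

theorem contrGen_inv (w : Cn n × Cn n) (b : Lam n) :
    contrGen w (inv b) = -inv (contrGen w b) := by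
  rw [contrGen_apply, contrGen_apply, contractLeft_inv, map_add, inv_mul, inv_gen₂, neg_add,
    neg_mul, neg_neg]

/-! ### Contractions on the exterior algebra. -/

theorem contr_ι (w : Cn n × Cn n) : contr (CliffordAlgebra.ι 0 w) = contrGen w :=
  ExteriorAlgebra.lift_ι_apply ℂ contrGen contrGen_sq w

theorem contr_ι_mul (w : Cn n × Cn n) (a b : Lam n) :
    contr (CliffordAlgebra.ι 0 w * a) b = contrGen w (contr a b) := by
  rw [map_mul, contr_ι, Module.End.mul_apply]

theorem contr_mul (a b c : Lam n) : contr (a * b) c = contr a (contr b c) := by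
  rw [map_mul, Module.End.mul_apply]

/-- Both kinds of generators act by operators that change parity (`contrGen_inv`), so `contr` is an
even operation. This is what makes Koszul signs consistent once coefficients are added. -/
theorem contr_inv (a b : Lam n) : inv (contr a b) = contr (inv a) (inv b) := by
  induction a using CliffordAlgebra.left_induction generalizing b with
  | algebraMap c => rw [inv_algebraMap, AlgHom.commutes]; simp
  | add a a' ha ha' => simp only [map_add, LinearMap.add_apply, ha, ha']
  | ι_mul a w ha =>
    rw [contr_ι_mul, inv_mul, inv_ι, neg_mul, map_neg, LinearMap.neg_apply, contr_ι_mul, ← ha,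
      contrGen_inv, neg_neg]

theorem contr_gen₂ (v : Cn n) (b : Lam n) : contr (gen₂ v) b = gen₂ v * b := by
  change contr (CliffordAlgebra.ι 0 (0, v)) b = _
  rw [contr_ι, contrGen_apply]
  simp

/-- The supercommutator of `dz_i ∧` with `i_a` is the contraction with `∂a/∂(∂/∂z_i)`. -/
theorem gen₁_mul_contr (i : Fin n) (a b : Lam n) :
    gen₁ (Pi.single i 1) * contr a b =
      contr (inv a) (gen₁ (Pi.single i 1) * b) + contr (leftDer i a) b := by
  -- The case of one generator is a Clifford relation: multiplication by dz̄ anticommutes with dz_i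
  -- exactly, contraction only up to the pairing with dz_i.
  have key : ∀ (w : Cn n × Cn n) (c : Lam n), contrGen w (gen₁ (Pi.single i 1) * c) =
      w.1 i • c - gen₁ (Pi.single i 1) * contrGen w c := by
    intro w c
    have h₁ : CliffordAlgebra.contractLeft (pair₁ w.1) (gen₁ (Pi.single i 1) * c) =
        w.1 i • c - gen₁ (Pi.single i 1) * CliffordAlgebra.contractLeft (pair₁ w.1) c := by
      refine (CliffordAlgebra.contractLeft_ι_mul _ _ _).trans ?_
      simp only [pair₁, LinearMap.mk₂_apply, LinearMap.inl_apply, dotProduct_single, mul_one]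
      rfl
    have h₂ : gen₂ w.2 * (gen₁ (Pi.single i 1) * c) =
        -(gen₁ (Pi.single i 1) * (gen₂ w.2 * c)) := by
      have := mul_comm_of_inv_eq_neg (inv_gen₂ w.2) (gen₁ (Pi.single i 1))
      rw [← mul_assoc, this, inv_gen₁, neg_mul, neg_mul, mul_assoc]
    rw [contrGen_apply, contrGen_apply, h₁, h₂, mul_add]
    abel
  induction a using CliffordAlgebra.left_induction generalizing b with
  | algebraMap c =>
    rw [inv_algebraMap, AlgHom.commutes, leftDer, CliffordAlgebra.contractLeft_algebraMap]
    simp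
  | add a a' ha ha' =>
    simp only [map_add, LinearMap.add_apply, mul_add, ha, ha']
    abel
  | ι_mul a w ha =>
    have e : leftDer i (CliffordAlgebra.ι 0 w * a) =
        w.1 i • a - CliffordAlgebra.ι 0 w * leftDer i a := by
      rw [leftDer, CliffordAlgebra.contractLeft_ι_mul]
      simp [pair₁]
    have h := key w (contr a b)
    rw [ha, map_add] at h
    rw [contr_ι_mul, e, inv_mul, inv_ι, neg_mul, map_neg, LinearMap.neg_apply, contr_ι_mul,
      map_sub, LinearMap.sub_apply, contr_ι_mul, map_smul, LinearMap.smul_apply]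
    rw [eq_sub_iff_add_eq, add_comm, ← eq_sub_iff_add_eq] at h
    rw [h]
    abel

/-! ### Bidegrees -/

theorem comp_apply (p q : ℕ) (a : Lam n) :
    comp p q a = (ExteriorAlgebra.lift ℂ ⟨bidegGen, bidegGen_sq⟩ a).coeff (p, q) := rfl

theorem lift_bidegGen_gen₁ (v : Cn n) :
    ExteriorAlgebra.lift ℂ ⟨bidegGen, bidegGen_sq⟩ (gen₁ v) =
      AddMonoidAlgebra.single (1, 0) (gen₁ v) := by
  have : bidegGen (v, 0) = AddMonoidAlgebra.single (1, 0) (gen₁ v) := by simp [bidegGen]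
  rw [← this]
  exact ExteriorAlgebra.lift_ι_apply ℂ bidegGen bidegGen_sq (v, 0)

theorem lift_bidegGen_gen₂ (v : Cn n) :
    ExteriorAlgebra.lift ℂ ⟨bidegGen, bidegGen_sq⟩ (gen₂ v) =
      AddMonoidAlgebra.single (0, 1) (gen₂ v) := by
  have : bidegGen (0, v) = AddMonoidAlgebra.single (0, 1) (gen₂ v) := by simp [bidegGen]
  rw [← this]
  exact ExteriorAlgebra.lift_ι_apply ℂ bidegGen bidegGen_sq (0, v)

/-- Components are coefficients of an algebra morphism into a monoid algebra, where a generator goes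
to a single monomial; multiplying by it only shifts the index. Together with the next three rules
and the value on scalars, this determines `comp`. -/
theorem comp_gen₁_mul (p q : ℕ) (v : Cn n) (a : Lam n) :
    comp (p + 1) q (gen₁ v * a) = gen₁ v * comp p q a := by
  rw [comp_apply, map_mul, lift_bidegGen_gen₁]
  refine AddMonoidAlgebra.coeff_single_mul_eq_mul_coeff (p, q) fun m _ => ?_
  simp only [Prod.ext_iff, Prod.fst_add, Prod.snd_add]
  omega

theorem comp_zero_gen₁_mul (q : ℕ) (v : Cn n) (a : Lam n) : comp 0 q (gen₁ v * a) = 0 := by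
  rw [comp_apply, map_mul, lift_bidegGen_gen₁]
  refine AddMonoidAlgebra.coeff_single_mul_of_forall_add_ne _ _ fun m => ?_
  simp only [ne_eq, Prod.ext_iff, Prod.fst_add, Prod.snd_add]
  omega

theorem comp_gen₂_mul (p q : ℕ) (v : Cn n) (a : Lam n) :
    comp p (q + 1) (gen₂ v * a) = gen₂ v * comp p q a := by
  rw [comp_apply, map_mul, lift_bidegGen_gen₂]
  refine AddMonoidAlgebra.coeff_single_mul_eq_mul_coeff (p, q) fun m _ => ?_
  simp only [Prod.ext_iff, Prod.fst_add, Prod.snd_add]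
  omega

theorem comp_zero_gen₂_mul (p : ℕ) (v : Cn n) (a : Lam n) : comp p 0 (gen₂ v * a) = 0 := by
  rw [comp_apply, map_mul, lift_bidegGen_gen₂]
  refine AddMonoidAlgebra.coeff_single_mul_of_forall_add_ne _ _ fun m => ?_
  simp only [ne_eq, Prod.ext_iff, Prod.fst_add, Prod.snd_add]
  omega

theorem comp_algebraMap (p q : ℕ) (c : ℂ) :
    comp p q (algebraMap ℂ (Lam n) c) =
      if p = 0 ∧ q = 0 then algebraMap ℂ (Lam n) c else 0 := by
  rw [comp_apply, AlgHom.commutes]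
  rw [show algebraMap ℂ (AddMonoidAlgebra (Lam n) (ℕ × ℕ)) c =
    AddMonoidAlgebra.single 0 (algebraMap ℂ (Lam n) c) from rfl]
  rw [AddMonoidAlgebra.coeff_single, Finsupp.single_apply]
  simp only [Prod.ext_iff, Prod.fst_zero, Prod.snd_zero, eq_comm (a := 0)]

theorem comp_comp (p q p' q' : ℕ) (a : Lam n) :
    comp p q (comp p' q' a) = if p = p' ∧ q = q' then comp p q a else 0 := by
  induction a using Lam.induction generalizing p q p' q' with
  | scalar c =>
    rw [comp_algebraMap]
    split_ifs with h₁ h₂ h₂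
    · rw [comp_algebraMap]
    · rw [comp_algebraMap, if_neg (by omega)]
    · rw [map_zero, comp_algebraMap, if_neg (by omega)]
    · rw [map_zero]
  | add a b ha hb =>
    rw [map_add, map_add, ha, hb]
    split_ifs <;> simp
  | gen₁_mul v a ha =>
    rcases p' with _ | p' <;> rcases p with _ | p <;>
      simp only [comp_gen₁_mul, comp_zero_gen₁_mul, map_zero, ha] <;> simp
  | gen₂_mul v a ha =>
    rcases q' with _ | q' <;> rcases q with _ | q <;>
      simp only [comp_gen₂_mul, comp_zero_gen₂_mul, map_zero, ha] <;> simp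

theorem inv_comp (p q : ℕ) (a : Lam n) :
    inv (comp p q a) = (-1 : ℂ) ^ (p + q) • comp p q a := by
  induction a using Lam.induction generalizing p q with
  | scalar c =>
    rw [comp_algebraMap]
    split_ifs with h
    · simp [h.1, h.2]
    · simp
  | add a b ha hb => rw [map_add, map_add, ha, hb, smul_add]
  | gen₁_mul v a ha =>
    rcases p with _ | p
    · simp [comp_zero_gen₁_mul]
    · rw [comp_gen₁_mul, inv_mul, ha, inv_gen₁, add_right_comm, pow_succ]
      simp
  | gen₂_mul v a ha =>
    rcases q with _ | q
    · simp [comp_zero_gen₂_mul]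
    · rw [comp_gen₂_mul, inv_mul, ha, inv_gen₂, ← add_assoc, pow_succ]
      simp

theorem comp_inv (p q : ℕ) (a : Lam n) : comp p q (inv a) = inv (comp p q a) := by
  induction a using Lam.induction generalizing p q with
  | scalar c =>
    rw [inv_algebraMap, comp_algebraMap]
    split_ifs <;> simp
  | add a b ha hb => simp only [map_add, ha, hb]
  | gen₁_mul v a ha =>
    rcases p with _ | p <;>
      simp [inv_mul, comp_gen₁_mul, comp_zero_gen₁_mul, ha]
  | gen₂_mul v a ha =>
    rcases q with _ | q <;>
      simp [inv_mul, comp_gen₂_mul, comp_zero_gen₂_mul, ha]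

theorem map_prodMap_gen₁ (f g : Cn n →ₗ[ℂ] Cn n) (v : Cn n) :
    ExteriorAlgebra.map (f.prodMap g) (gen₁ v) = gen₁ (f v) := by
  simp [gen₁, ExteriorAlgebra.map_apply_ι]

theorem map_prodMap_gen₂ (f g : Cn n →ₗ[ℂ] Cn n) (v : Cn n) :
    ExteriorAlgebra.map (f.prodMap g) (gen₂ v) = gen₂ (g v) := by
  simp [gen₂, ExteriorAlgebra.map_apply_ι]

/-- Holomorphic coordinate changes act on dz and dz̄ by separate blocks, so the type (p,q) does not
depend on the chart. -/
theorem map_prodMap_comp (f g : Cn n →ₗ[ℂ] Cn n) (p q : ℕ) (a : Lam n) :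
    ExteriorAlgebra.map (f.prodMap g) (comp p q a) =
      comp p q (ExteriorAlgebra.map (f.prodMap g) a) := by
  induction a using Lam.induction generalizing p q with
  | scalar c =>
    rw [AlgHom.commutes, comp_algebraMap]
    split_ifs <;> simp
  | add a b ha hb => simp only [map_add, ha, hb]
  | gen₁_mul v a ha =>
    rcases p with _ | p <;>
      simp [map_prodMap_gen₁, comp_gen₁_mul, comp_zero_gen₁_mul, ha]
  | gen₂_mul v a ha =>
    rcases q with _ | q <;>
      simp [map_prodMap_gen₂, comp_gen₂_mul, comp_zero_gen₂_mul, ha]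

/-- Anticommutation lets a dz̄ be moved to the right past any number of dz's, at the cost of a sign
that a subspace does not see. -/
theorem range_gen₂_mul_pow_range_gen₁_le (p : ℕ) :
    LinearMap.range (gen₂ (n := n)) * LinearMap.range gen₁ ^ p ≤
      LinearMap.range gen₁ ^ p * LinearMap.range gen₂ := by
  induction p with
  | zero => simp
  | succ p ih =>
    have h : LinearMap.range (gen₂ (n := n)) * LinearMap.range gen₁ ≤
        LinearMap.range gen₁ * LinearMap.range gen₂ := by
      rw [Submodule.mul_le]
      rintro _ ⟨v, rfl⟩ _ ⟨w, rfl⟩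
      rw [mul_comm_of_inv_eq_neg (inv_gen₂ v), inv_gen₁, neg_mul]
      exact neg_mem (Submodule.mul_mem_mul ⟨w, rfl⟩ ⟨v, rfl⟩)
    calc _ = LinearMap.range (gen₂ (n := n)) * LinearMap.range gen₁ ^ p * LinearMap.range gen₁ := by
          rw [pow_succ, mul_assoc]
      _ ≤ LinearMap.range (gen₁ (n := n)) ^ p * LinearMap.range gen₂ * LinearMap.range gen₁ :=
          mul_le_mul' ih le_rfl
      _ ≤ _ := by
          rw [pow_succ, mul_assoc, mul_assoc]
          exact mul_le_mul' le_rfl h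

theorem comp_mem (p q : ℕ) (a : Lam n) :
    comp p q a ∈ LinearMap.range (gen₁ (n := n)) ^ p * LinearMap.range gen₂ ^ q := by
  induction a using Lam.induction generalizing p q with
  | scalar c =>
    rw [comp_algebraMap]
    split_ifs with h
    · rw [h.1, h.2, pow_zero, pow_zero, one_mul]
      exact Submodule.algebraMap_mem c
    · exact zero_mem _
  | add a b ha hb => rw [map_add]; exact add_mem (ha p q) (hb p q)
  | gen₁_mul v a ha =>
    rcases p with _ | p
    · rw [comp_zero_gen₁_mul]; exact zero_mem _
    · rw [comp_gen₁_mul, pow_succ', mul_assoc]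
      exact Submodule.mul_mem_mul ⟨v, rfl⟩ (ha p q)
  | gen₂_mul v a ha =>
    rcases q with _ | q
    · rw [comp_zero_gen₂_mul]; exact zero_mem _
    · rw [comp_gen₂_mul, pow_succ', ← mul_assoc]
      refine mul_le_mul' (range_gen₂_mul_pow_range_gen₁_le p) le_rfl ?_
      rw [mul_assoc]
      exact Submodule.mul_mem_mul ⟨v, rfl⟩ (ha p q)

/-- The power is the image of the exterior power Λ^p(ℂⁿ) under the map induced by `f`, and that
exterior power has dimension `n.choose p = 0`. -/
theorem pow_range_ι_comp_eq_bot (f : Cn n →ₗ[ℂ] Cn n × Cn n) {p : ℕ} (hp : n < p) :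
    LinearMap.range ((ExteriorAlgebra.ι ℂ : _ →ₗ[ℂ] Lam n) ∘ₗ f) ^ p = ⊥ := by
  have e : (ExteriorAlgebra.ι ℂ : _ →ₗ[ℂ] Lam n) ∘ₗ f =
      (ExteriorAlgebra.map f).toLinearMap ∘ₗ ExteriorAlgebra.ι ℂ :=
    (ExteriorAlgebra.map_comp_ι f).symm
  have h : (⋀[ℂ]^p (Cn n)) = ⊥ := by
    have := exteriorPower.finrank_eq (R := ℂ) (M := Cn n) (n := p)
    rw [Module.finrank_fin_fun, Nat.choose_eq_zero_of_lt hp] at this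
    exact Submodule.finrank_eq_zero.mp this
  rw [e, LinearMap.range_comp, ← Submodule.map_pow]
  exact (congrArg _ h).trans (Submodule.map_bot _)

theorem comp_eq_zero_of_lt_left {p : ℕ} (hp : n < p) (q : ℕ) (a : Lam n) : comp p q a = 0 := by
  have h := comp_mem p q a
  have e : LinearMap.range (gen₁ (n := n)) ^ p = ⊥ := pow_range_ι_comp_eq_bot _ hp
  rwa [e, Submodule.bot_mul, Submodule.mem_bot] at h

theorem comp_eq_zero_of_lt_right (p : ℕ) {q : ℕ} (hq : n < q) (a : Lam n) : comp p q a = 0 := by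
  have h := comp_mem p q a
  have e : LinearMap.range (gen₂ (n := n)) ^ q = ⊥ := pow_range_ι_comp_eq_bot _ hq
  rwa [e, Submodule.mul_bot, Submodule.mem_bot] at h

theorem sum_comp (a : Lam n) :
    ∑ p ∈ Finset.range (n + 1), ∑ q ∈ Finset.range (n + 1), comp p q a = a := by
  induction a using Lam.induction with
  | scalar c =>
    simp only [comp_algebraMap]
    rw [Finset.sum_eq_single 0, Finset.sum_eq_single 0]
    · simp
    · intro q _ hq; simp [hq]
    · simp
    · intro p _ hp; simp [hp]
    · simp
  | add a b ha hb => simp only [map_add, Finset.sum_add_distrib, ha, hb]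
  | gen₁_mul v a ha =>
    rw [Finset.sum_range_succ']
    simp only [comp_gen₁_mul, comp_zero_gen₁_mul, Finset.sum_const_zero, add_zero]
    rw [Finset.sum_range_succ] at ha
    conv_rhs => rw [← ha]
    -- Shifting the index leaves only p < n on the left-hand side; the missing term p = n would have
    -- bidegree (n+1, q) after multiplication, which vanishes.
    have h : gen₁ v * ∑ q ∈ Finset.range (n + 1), comp n q a = 0 := by
      rw [Finset.mul_sum]
      refine Finset.sum_eq_zero fun q _ => ?_
      rw [← comp_gen₁_mul, comp_eq_zero_of_lt_left (Nat.lt_succ_self n)]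
    rw [mul_add, h, add_zero]
    simp only [Finset.mul_sum]
  | gen₂_mul v a ha =>
    conv_rhs => rw [← ha, Finset.mul_sum]
    refine Finset.sum_congr rfl fun p _ => ?_
    rw [Finset.sum_range_succ', comp_zero_gen₂_mul, add_zero, Finset.sum_range_succ, mul_add,
      ← comp_gen₂_mul, comp_eq_zero_of_lt_right p (Nat.lt_succ_self n), add_zero, Finset.mul_sum]
    simp only [comp_gen₂_mul]

/-! ### Parity in graded Artin algebras -/

namespace GradedArtin

variable (A : GradedArtin.{u})

theorem homogeneous_induction {P : A.carrier → Prop} (add : ∀ r s, P r → P s → P (r + s))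
    (homogeneous : ∀ k, ∀ r ∈ A.gr k, P r) (r : A.carrier) : P r :=
  DirectSum.Decomposition.inductionOn A.gr (homogeneous 0 0 (zero_mem _))
    (fun m => homogeneous _ m m.2) (fun r s => add r s) r

variable {A}

theorem evenPart_apply_of_mem {k : ℤ} {r : A.carrier} (hr : r ∈ A.gr k) :
    A.evenPart r = if Even k then r else 0 := by
  simp only [evenPart, LinearMap.comp_apply, LinearEquiv.coe_coe,
    DirectSum.decomposeLinearEquiv_apply]
  rw [DirectSum.decompose_of_mem A.gr hr]
  refine (DirectSum.toModule_lof ℂ (M := fun k => A.gr k) k (⟨r, hr⟩ : A.gr k)).trans ?_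
  split_ifs <;> rfl

theorem oddPart_apply (r : A.carrier) : A.oddPart r = r - A.evenPart r := rfl

theorem oddPart_apply_of_mem {k : ℤ} {r : A.carrier} (hr : r ∈ A.gr k) :
    A.oddPart r = if Even k then 0 else r := by
  rw [oddPart_apply, evenPart_apply_of_mem hr]
  split_ifs <;> simp

theorem evenPart_add_oddPart (r : A.carrier) : A.evenPart r + A.oddPart r = r :=
  add_sub_cancel _ _

@[simp] theorem evenPart_evenPart (r : A.carrier) : A.evenPart (A.evenPart r) = A.evenPart r := by
  induction r using homogeneous_induction with
  | add r s hr hs => simp only [map_add, hr, hs]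
  | homogeneous k r hr =>
    simp only [evenPart_apply_of_mem hr]
    split_ifs with h
    · simp [evenPart_apply_of_mem hr, h]
    · simp

@[simp] theorem evenPart_oddPart (r : A.carrier) : A.evenPart (A.oddPart r) = 0 := by
  rw [oddPart_apply, map_sub, evenPart_evenPart, sub_self]

theorem evenPart_mul (r s : A.carrier) :
    A.evenPart (r * s) = A.evenPart r * A.evenPart s + A.oddPart r * A.oddPart s := by
  induction r using homogeneous_induction with
  | add r r' hr hr' => simp only [map_add, add_mul, hr, hr']; abel
  | homogeneous i r hr =>
    induction s using homogeneous_induction with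
    | add s s' hs hs' => simp only [map_add, mul_add, hs, hs']; abel
    | homogeneous j s hs =>
      rw [evenPart_apply_of_mem (SetLike.mul_mem_graded hr hs), evenPart_apply_of_mem hr,
        evenPart_apply_of_mem hs, oddPart_apply_of_mem hr, oddPart_apply_of_mem hs]
      by_cases hi : Even i <;> by_cases hj : Even j <;> simp [Int.even_add, hi, hj]

theorem evenPart_mul_comm (r s : A.carrier) : A.evenPart r * s = s * A.evenPart r := by
  induction r using homogeneous_induction with
  | add r r' hr hr' => simp only [map_add, add_mul, mul_add, hr, hr']
  | homogeneous i r hr =>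
    induction s using homogeneous_induction with
    | add s s' hs hs' => simp only [mul_add, add_mul, hs, hs']
    | homogeneous j s hs =>
      rw [evenPart_apply_of_mem hr]
      split_ifs with hi
      · rw [A.comm hr hs, Int.negOnePow_even _ (hi.mul_right j), one_smul]
      · simp

theorem oddPart_mul_oddPart_comm (r s : A.carrier) :
    A.oddPart r * A.oddPart s = -(A.oddPart s * A.oddPart r) := by
  induction r using homogeneous_induction with
  | add r r' hr hr' => simp only [map_add, add_mul, mul_add, hr, hr', neg_add]
  | homogeneous i r hr =>
    induction s using homogeneous_induction with
    | add s s' hs hs' => simp only [map_add, mul_add, add_mul, hs, hs', neg_add]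
    | homogeneous j s hs =>
      rw [oddPart_apply_of_mem hr, oddPart_apply_of_mem hs]
      by_cases hi : Even i <;> by_cases hj : Even j <;> simp only [hi, hj, if_true, if_false,
        zero_mul, mul_zero, neg_zero]
      rw [A.comm hr hs, Int.negOnePow_odd _
        ((Int.not_even_iff_odd.mp hi).mul (Int.not_even_iff_odd.mp hj))]
      simp

/-- Elements concentrated in even degrees. -/
def IsEven (r : A.carrier) : Prop := A.evenPart r = r

/-- Elements concentrated in odd degrees. -/
def IsOdd (r : A.carrier) : Prop := A.evenPart r = 0

theorem IsOdd.oddPart_eq {r : A.carrier} (h : A.IsOdd r) : A.oddPart r = r := by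
  rw [oddPart_apply, h, sub_zero]

theorem IsEven.oddPart_eq {r : A.carrier} (h : A.IsEven r) : A.oddPart r = 0 := by
  rw [oddPart_apply, h, sub_self]

theorem isEven_evenPart (r : A.carrier) : A.IsEven (A.evenPart r) := evenPart_evenPart r

theorem isOdd_oddPart (r : A.carrier) : A.IsOdd (A.oddPart r) := evenPart_oddPart r

variable {r s : A.carrier}

theorem IsEven.mul (hr : A.IsEven r) (hs : A.IsEven s) : A.IsEven (r * s) := by
  rw [IsEven, evenPart_mul, hr, hs, hr.oddPart_eq, zero_mul, add_zero]

theorem IsOdd.mul (hr : A.IsOdd r) (hs : A.IsOdd s) : A.IsEven (r * s) := by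
  rw [IsEven, evenPart_mul, hr, hr.oddPart_eq, hs.oddPart_eq, zero_mul, zero_add]

theorem IsEven.mul_isOdd (hr : A.IsEven r) (hs : A.IsOdd s) : A.IsOdd (r * s) := by
  rw [IsOdd, evenPart_mul, hs, hr.oddPart_eq, mul_zero, zero_mul, add_zero]

theorem IsOdd.mul_isEven (hr : A.IsOdd r) (hs : A.IsEven s) : A.IsOdd (r * s) := by
  rw [IsOdd, evenPart_mul, hr, hs.oddPart_eq, mul_zero, zero_mul, add_zero]

theorem IsEven.mul_comm (hr : A.IsEven r) (s : A.carrier) : r * s = s * r := by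
  rw [← hr, evenPart_mul_comm]

theorem IsOdd.mul_comm (hr : A.IsOdd r) (hs : A.IsOdd s) : r * s = -(s * r) := by
  rw [← hr.oddPart_eq, ← hs.oddPart_eq, oddPart_mul_oddPart_comm]

/-- The maximal ideal absorbs multiplication by arbitrary elements on the right. -/
theorem mul_mem_max {k : ℤ} (hk : r ∈ A.gr k) (hr : r ∈ A.max) (s : A.carrier) :
    r * s ∈ A.max := by
  induction s using homogeneous_induction with
  | add s s' hs hs' => rw [mul_add]; exact add_mem hs hs'
  | homogeneous j s hs =>
    rw [A.comm hk hs]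
    rcases Int.units_eq_one_or (k * j).negOnePow with h | h
    · rw [h, one_smul]; exact A.max.mul_mem_left s hr
    · rw [h, Units.neg_smul, one_smul]; exact neg_mem (A.max.mul_mem_left s hr)

end GradedArtin

theorem ProArtin.map_evenPart (R : ProArtin.{u}) {i j : ℕ} (h : i ≤ j)
    (r : (R.level j).carrier) :
    R.map h ((R.level j).evenPart r) = (R.level i).evenPart (R.map h r) := by
  induction r using GradedArtin.homogeneous_induction with
  | add r s hr hs => simp only [map_add, hr, hs]
  | homogeneous k r hr =>
    rw [GradedArtin.evenPart_apply_of_mem hr, GradedArtin.evenPart_apply_of_mem (R.map_gr h k hr)]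
    split_ifs <;> simp

/-! ### The action of polyvector-valued forms on forms, with coefficients -/

variable {A : GradedArtin.{u}}

/-- Invariance under the total parity involution. -/
def IsEvenFib (w : Fib n A) : Prop :=
  TensorProduct.map inv (A.evenPart - A.oddPart) w = w

/-- On tensors whose coefficient has pure parity only one of the two summands of `koszul` survives,
so signs become explicit. -/
theorem Fib.induction {P : Fib n A → Prop} (add : ∀ w w', P w → P w' → P (w + w'))
    (even : ∀ a r, A.IsEven r → P (a ⊗ₜ r)) (odd : ∀ a r, A.IsOdd r → P (a ⊗ₜ r))
    (w : Fib n A) : P w := by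
  induction w using TensorProduct.induction_on with
  | zero => simpa using even 0 0 (map_zero _)
  | tmul a r =>
    rw [← A.evenPart_add_oddPart r, TensorProduct.tmul_add]
    exact add _ _ (even _ _ (A.isEven_evenPart r)) (odd _ _ (A.isOdd_oddPart r))
  | add w w' h h' => exact add _ _ h h'

/-- Averaging over the total parity involution fixes an even element and turns each tensor with a
coefficient of pure parity into one whose two factors have the same parity. -/
theorem IsEvenFib.induction {P : Fib n A → Prop} (add : ∀ w w', P w → P w' → P (w + w'))
    (even : ∀ a r, inv a = a → A.IsEven r → P (a ⊗ₜ r))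
    (odd : ∀ a r, inv a = -a → A.IsOdd r → P (a ⊗ₜ r)) {w : Fib n A} (hw : IsEvenFib w) :
    P w := by
  have key : ∀ w : Fib n A,
      P ((2⁻¹ : ℂ) • (w + TensorProduct.map inv (A.evenPart - A.oddPart) w)) := by
    refine Fib.induction (fun w w' h h' => ?_) (fun a r hr => ?_) (fun a r hr => ?_)
    · rw [map_add, add_add_add_comm, smul_add]
      exact add _ _ h h'
    · rw [TensorProduct.map_tmul, LinearMap.sub_apply, hr, hr.oddPart_eq, sub_zero,
        ← TensorProduct.add_tmul, TensorProduct.smul_tmul']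
      refine even _ _ ?_ hr
      rw [map_smul, map_add, inv_inv, add_comm]
    · rw [TensorProduct.map_tmul, LinearMap.sub_apply, hr, hr.oddPart_eq, zero_sub,
        TensorProduct.tmul_neg, ← sub_eq_add_neg, ← TensorProduct.sub_tmul,
        TensorProduct.smul_tmul']
      refine odd _ _ ?_ hr
      rw [map_smul, map_sub, inv_inv, ← smul_neg, neg_sub]
  have h := key w
  rw [hw, ← two_smul ℂ w, smul_smul, inv_mul_cancel₀ two_ne_zero, one_smul] at h
  exact h

theorem koszul_tmul_of_isEven (f : Lam n →ₗ[ℂ] Lam n →ₗ[ℂ] Lam n) (a b : Lam n)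
    {r : A.carrier} (hr : A.IsEven r) (s : A.carrier) :
    koszul f (a ⊗ₜ r) (b ⊗ₜ s) = f a b ⊗ₜ[ℂ] (r * s) := by
  simp only [koszul, LinearMap.add_apply, TensorProduct.map₂_apply_tmul, LinearMap.comp_apply,
    hr.oddPart_eq]
  rw [hr]
  simp

theorem koszul_tmul_of_isOdd (f : Lam n →ₗ[ℂ] Lam n →ₗ[ℂ] Lam n) (a b : Lam n)
    {r : A.carrier} (hr : A.IsOdd r) (s : A.carrier) :
    koszul f (a ⊗ₜ r) (b ⊗ₜ s) = f a (inv b) ⊗ₜ[ℂ] (r * s) := by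
  simp only [koszul, LinearMap.add_apply, TensorProduct.map₂_apply_tmul, LinearMap.comp_apply,
    hr.oddPart_eq]
  rw [hr]
  simp

theorem fibContr_tmul_of_isEven (a b : Lam n) {r : A.carrier} (hr : A.IsEven r)
    (s : A.carrier) : fibContr (a ⊗ₜ r) (b ⊗ₜ s) = contr a b ⊗ₜ[ℂ] (r * s) :=
  koszul_tmul_of_isEven _ a b hr s

theorem fibContr_tmul_of_isOdd (a b : Lam n) {r : A.carrier} (hr : A.IsOdd r)
    (s : A.carrier) : fibContr (a ⊗ₜ r) (b ⊗ₜ s) = contr a (inv b) ⊗ₜ[ℂ] (r * s) :=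
  koszul_tmul_of_isOdd _ a b hr s

theorem fibMul_tmul_of_isEven (a b : Lam n) {r : A.carrier} (hr : A.IsEven r)
    (s : A.carrier) : fibMul (a ⊗ₜ r) (b ⊗ₜ s) = (a * b) ⊗ₜ[ℂ] (r * s) :=
  koszul_tmul_of_isEven _ a b hr s

theorem fibMul_tmul_of_isOdd (a b : Lam n) {r : A.carrier} (hr : A.IsOdd r)
    (s : A.carrier) : fibMul (a ⊗ₜ r) (b ⊗ₜ s) = (a * inv b) ⊗ₜ[ℂ] (r * s) :=
  koszul_tmul_of_isOdd _ a b hr s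

theorem lmul_tmul (a b : Lam n) (r : A.carrier) : lmul a (b ⊗ₜ r) = (a * b) ⊗ₜ[ℂ] r := rfl

/-- Multiplicativity of `contr` survives the Koszul signs because `contr` and the product are both
compatible with `inv`. It reduces commutation of contractions to commutation in the algebra of
polyvector-valued forms. -/
theorem fibContr_fibMul (α β w : Fib n A) :
    fibContr (fibMul α β) w = fibContr α (fibContr β w) := by
  induction w using TensorProduct.induction_on with
  | zero => simp
  | add w w' h h' => simp only [map_add, h, h']
  | tmul c s =>
    induction α using Fib.induction with
    | add α α' h h' => simp only [map_add, LinearMap.add_apply, h, h']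
    | even a r hr =>
      induction β using Fib.induction with
      | add β β' h h' => simp only [map_add, LinearMap.add_apply, h, h']
      | even b t ht =>
        rw [fibMul_tmul_of_isEven _ _ hr, fibContr_tmul_of_isEven _ _ (hr.mul ht),
          fibContr_tmul_of_isEven _ _ ht, fibContr_tmul_of_isEven _ _ hr, contr_mul, mul_assoc]
      | odd b t ht =>
        rw [fibMul_tmul_of_isEven _ _ hr, fibContr_tmul_of_isOdd _ _ (hr.mul_isOdd ht),
          fibContr_tmul_of_isOdd _ _ ht, fibContr_tmul_of_isEven _ _ hr, contr_mul, mul_assoc]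
    | odd a r hr =>
      induction β using Fib.induction with
      | add β β' h h' => simp only [map_add, LinearMap.add_apply, h, h']
      | even b t ht =>
        rw [fibMul_tmul_of_isOdd _ _ hr, fibContr_tmul_of_isOdd _ _ (hr.mul_isEven ht),
          fibContr_tmul_of_isEven _ _ ht, fibContr_tmul_of_isOdd _ _ hr, contr_mul, contr_inv,
          mul_assoc]
      | odd b t ht =>
        rw [fibMul_tmul_of_isOdd _ _ hr, fibContr_tmul_of_isEven _ _ (hr.mul ht),
          fibContr_tmul_of_isOdd _ _ ht, fibContr_tmul_of_isOdd _ _ hr, contr_mul, contr_inv,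
          inv_inv, mul_assoc]

theorem fibMul_comm_of_isEvenFib {γ : Fib n A} (hγ : IsEvenFib γ) (β : Fib n A) :
    fibMul γ β = fibMul β γ := by
  refine hγ.induction (P := fun γ => fibMul γ β = fibMul β γ) (fun w w' h h' => ?_)
    (fun a r ha hr => ?_) (fun a r ha hr => ?_)
  · simp only [map_add, LinearMap.add_apply, h, h']
  · induction β using Fib.induction with
    | add β β' h h' => simp only [map_add, LinearMap.add_apply, h, h']
    | even b t ht =>
      rw [fibMul_tmul_of_isEven _ _ hr, fibMul_tmul_of_isEven _ _ ht, hr.mul_comm,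
        mul_comm_of_inv_eq ha]
    | odd b t ht =>
      rw [fibMul_tmul_of_isEven _ _ hr, fibMul_tmul_of_isOdd _ _ ht, hr.mul_comm, ha,
        mul_comm_of_inv_eq ha]
  · induction β using Fib.induction with
    | add β β' h h' => simp only [map_add, LinearMap.add_apply, h, h']
    | even b t ht =>
      rw [fibMul_tmul_of_isOdd _ _ hr, fibMul_tmul_of_isEven _ _ ht, ← ht.mul_comm,
        mul_comm_of_inv_eq_neg ha, inv_inv]
    | odd b t ht =>
      rw [fibMul_tmul_of_isOdd _ _ hr, fibMul_tmul_of_isOdd _ _ ht, hr.mul_comm ht, ha,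
        mul_comm_of_inv_eq_neg ha, inv_inv, mul_neg, TensorProduct.tmul_neg,
        TensorProduct.neg_tmul]

theorem fibContr_comm_of_isEvenFib {γ : Fib n A} (hγ : IsEvenFib γ) (β w : Fib n A) :
    fibContr γ (fibContr β w) = fibContr β (fibContr γ w) := by
  rw [← fibContr_fibMul, ← fibContr_fibMul, fibMul_comm_of_isEvenFib hγ]

theorem fibContr_lmul_gen₂ (v : Cn n) (β w : Fib n A) :
    fibContr (lmul (gen₂ v) β) w = lmul (gen₂ v) (fibContr β w) := by
  induction w using TensorProduct.induction_on with
  | zero => simp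
  | add w w' h h' => simp only [map_add, h, h']
  | tmul c s =>
    induction β using Fib.induction with
    | add β β' h h' => simp only [map_add, LinearMap.add_apply, h, h']
    | even b t ht =>
      rw [lmul_tmul, fibContr_tmul_of_isEven _ _ ht, fibContr_tmul_of_isEven _ _ ht, lmul_tmul,
        contr_mul, contr_gen₂]
    | odd b t ht =>
      rw [lmul_tmul, fibContr_tmul_of_isOdd _ _ ht, fibContr_tmul_of_isOdd _ _ ht, lmul_tmul,
        contr_mul, contr_gen₂]

/-- Multiplication by dz̄ is itself a contraction, by an element with coefficient 1, so it commutes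
with every even contraction. -/
theorem lmul_gen₂_fibContr {γ : Fib n A} (hγ : IsEvenFib γ) (v : Cn n) (w : Fib n A) :
    lmul (gen₂ v) (fibContr γ w) = fibContr γ (lmul (gen₂ v) w) := by
  have e : ∀ w : Fib n A, lmul (gen₂ v) w = fibContr (gen₂ v ⊗ₜ (1 : A.carrier)) w := by
    intro w
    have h1 : A.IsEven 1 := by
      rw [GradedArtin.IsEven, GradedArtin.evenPart_apply_of_mem (SetLike.one_mem_graded A.gr)]
      simp
    induction w using TensorProduct.induction_on with
    | zero => simp
    | add w w' h h' => simp only [map_add, h, h']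
    | tmul c s => rw [lmul_tmul, fibContr_tmul_of_isEven _ _ h1, contr_gen₂, one_mul]
  rw [e, e, fibContr_comm_of_isEvenFib hγ]

/-- The failure of dz_i to commute with i_γ is the only source of the Schouten bracket. Evenness
makes the sign from the form factor cancel the one from the coefficient, leaving an ordinary
commutator. -/
theorem lmul_gen₁_fibContr {γ : Fib n A} (hγ : IsEvenFib γ) (i : Fin n) (w : Fib n A) :
    lmul (gen₁ (Pi.single i 1)) (fibContr γ w) =
      fibContr γ (lmul (gen₁ (Pi.single i 1)) w) +
        fibContr ((leftDer i).rTensor A.carrier γ) w := by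
  induction w using TensorProduct.induction_on with
  | zero => simp
  | add w w' h h' => simp only [map_add, h, h']; abel
  | tmul c s =>
    refine hγ.induction (P := fun γ => lmul (gen₁ (Pi.single i 1)) (fibContr γ (c ⊗ₜ s)) =
      fibContr γ (lmul (gen₁ (Pi.single i 1)) (c ⊗ₜ s)) +
        fibContr ((leftDer i).rTensor A.carrier γ) (c ⊗ₜ s)) (fun w w' h h' => ?_)
      (fun a r ha hr => ?_) (fun a r ha hr => ?_)
    · simp only [map_add, LinearMap.add_apply, h, h']; abel
    · rw [fibContr_tmul_of_isEven _ _ hr, lmul_tmul, lmul_tmul, LinearMap.rTensor_tmul,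
        fibContr_tmul_of_isEven _ _ hr, fibContr_tmul_of_isEven _ _ hr, gen₁_mul_contr, ha,
        TensorProduct.add_tmul]
    · rw [fibContr_tmul_of_isOdd _ _ hr, lmul_tmul, lmul_tmul, LinearMap.rTensor_tmul,
        fibContr_tmul_of_isOdd _ _ hr, fibContr_tmul_of_isOdd _ _ hr, gen₁_mul_contr, ha,
        TensorProduct.add_tmul, inv_mul, inv_gen₁, neg_mul, map_neg, map_neg,
        LinearMap.neg_apply]

theorem fibEven_of_isEvenFib {γ : Fib n A} (hγ : IsEvenFib γ) : fibEven γ = γ := by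
  rw [fibEven, LinearMap.smul_apply, LinearMap.add_apply, hγ, LinearMap.id_apply,
    ← two_smul ℂ γ, smul_smul, inv_mul_cancel₀ two_ne_zero, one_smul]

theorem fibOdd_of_isEvenFib {γ : Fib n A} (hγ : IsEvenFib γ) : fibOdd γ = 0 := by
  rw [fibOdd, LinearMap.smul_apply, LinearMap.sub_apply, hγ, LinearMap.id_apply, sub_self,
    smul_zero]

/-- In total degree 0 a coefficient of type (p,q) has degree p − q, which has the parity of p + q,
so the two signs in the involution cancel. -/
theorem isEvenFib_of_mem_polyDeg {γ : Fib n A} (hγ : γ ∈ polyDeg n A 0) : IsEvenFib γ := by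
  induction hγ using Submodule.span_induction with
  | zero => exact map_zero _
  | add w w' _ _ h h' => rw [IsEvenFib, map_add, h, h']
  | smul c w _ h => rw [IsEvenFib, map_smul, h]
  | mem w h =>
    obtain ⟨p, q, a, r, hr, -, rfl⟩ := h
    rw [IsEvenFib, TensorProduct.map_tmul, inv_comp, LinearMap.sub_apply,
      GradedArtin.evenPart_apply_of_mem hr, GradedArtin.oddPart_apply_of_mem hr]
    by_cases h : Even (p + q)
    · rw [h.neg_one_pow, if_pos, if_pos]
      · simp
      all_goals
        rw [← Int.even_coe_nat] at h
        push_cast at h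
        simpa [Int.even_sub, Int.even_add] using h
    · rw [(Nat.not_even_iff_odd.mp h).neg_one_pow, if_neg, if_neg]
      · simp [TensorProduct.tmul_neg, TensorProduct.neg_tmul]
      all_goals
        rw [← Int.even_coe_nat] at h
        push_cast at h
        simpa [Int.even_sub, Int.even_add] using h

/-- Contraction with coefficients in the maximal ideal raises the adic order. -/
theorem fibContr_pow_mem {d : ℤ} {γ : Fib n A} (hγ : γ ∈ polyDeg n A d) (k : ℕ) (w : Fib n A) :
    (fibContr γ ^ (k + 1)) w ∈
      Submodule.span ℂ {t : Fib n A | ∃ (a : Lam n) (r : A.carrier),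
        r ∈ A.max.restrictScalars ℂ ^ (k + 1) ∧ t = a ⊗ₜ[ℂ] r} := by
  induction k with
  | zero =>
    simp only [zero_add, pow_one]
    induction hγ using Submodule.span_induction with
    | zero => simp
    | add w w' _ _ h h' => rw [map_add, LinearMap.add_apply]; exact add_mem h h'
    | smul c w _ h => rw [map_smul, LinearMap.smul_apply]; exact Submodule.smul_mem _ c h
    | mem γ h =>
      obtain ⟨p, q, a, r, hr, hm, rfl⟩ := h
      induction w using TensorProduct.induction_on with
      | zero => simp
      | add w w' h h' => rw [map_add]; exact add_mem h h'
      | tmul b s =>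
        apply Submodule.subset_span
        by_cases h : Even (d + p - q)
        · have hr' : A.IsEven r := by
            rw [GradedArtin.IsEven, GradedArtin.evenPart_apply_of_mem hr, if_pos h]
          exact ⟨_, _, GradedArtin.mul_mem_max hr hm s, fibContr_tmul_of_isEven _ _ hr' s⟩
        · have hr' : A.IsOdd r := by
            rw [GradedArtin.IsOdd, GradedArtin.evenPart_apply_of_mem hr, if_neg h]
          exact ⟨_, _, GradedArtin.mul_mem_max hr hm s, fibContr_tmul_of_isOdd _ _ hr' s⟩
  | succ k ih =>
    rw [pow_succ' (fibContr γ), Module.End.mul_apply]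
    generalize (fibContr γ ^ (k + 1)) w = w' at ih
    clear w
    induction hγ using Submodule.span_induction with
    | zero => simp
    | add w w' _ _ h h' => rw [map_add, LinearMap.add_apply]; exact add_mem h h'
    | smul c w _ h => rw [map_smul, LinearMap.smul_apply]; exact Submodule.smul_mem _ c h
    | mem γ h =>
      obtain ⟨p, q, a, r, hr, hm, rfl⟩ := h
      induction ih using Submodule.span_induction with
      | zero => simp
      | add w w' _ _ h h' => rw [map_add]; exact add_mem h h'
      | smul c w _ h => rw [map_smul]; exact Submodule.smul_mem _ c h
      | mem w hw =>
        obtain ⟨b, s, hs, rfl⟩ := hw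
        apply Submodule.subset_span
        have hrs : r * s ∈ A.max.restrictScalars ℂ ^ (k + 1 + 1) := by
          rw [pow_succ']
          exact Submodule.mul_mem_mul hm hs
        by_cases h : Even (d + p - q)
        · have hr' : A.IsEven r := by
            rw [GradedArtin.IsEven, GradedArtin.evenPart_apply_of_mem hr, if_pos h]
          exact ⟨_, _, hrs, fibContr_tmul_of_isEven _ _ hr' s⟩
        · have hr' : A.IsOdd r := by
            rw [GradedArtin.IsOdd, GradedArtin.evenPart_apply_of_mem hr, if_neg h]
          exact ⟨_, _, hrs, fibContr_tmul_of_isOdd _ _ hr' s⟩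

variable (A) in
/-- A bound on the length of products of contractions with coefficients in the maximal ideal,
uniform over the fibres. -/
theorem exists_fibContr_pow_eq_zero :
    ∃ N : ℕ, ∀ (n : ℕ) (d : ℤ), ∀ γ ∈ polyDeg n A d, fibContr γ ^ N = 0 := by
  obtain ⟨N, hN⟩ := A.max_nilpotent
  -- `fibContr_pow_mem` is stated for positive exponents only, hence one more than the nilpotency
  -- order of the maximal ideal.
  refine ⟨N + 1, fun n d γ hγ => LinearMap.ext fun w => ?_⟩
  have h := fibContr_pow_mem hγ N w
  rw [pow_succ, hN, Submodule.bot_mul] at h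
  rw [LinearMap.zero_apply]
  refine (Submodule.mem_bot ℂ).mp (Submodule.span_le.mpr ?_ h)
  rintro _ ⟨a, r, hr, rfl⟩
  rw [(Submodule.mem_bot ℂ).mp hr]
  simp

/-! ### Derivations of the coefficients -/

section Coefficients

variable {R : ProArtin.{u}}

theorem ProArtin.map_isEven {i j : ℕ} (h : i ≤ j) {r : (R.level j).carrier}
    (hr : (R.level j).IsEven r) : (R.level i).IsEven (R.map h r) := by
  rw [GradedArtin.IsEven, ← R.map_evenPart, hr]

theorem ProArtin.map_isOdd {i j : ℕ} (h : i ≤ j) {r : (R.level j).carrier}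
    (hr : (R.level j).IsOdd r) : (R.level i).IsOdd (R.map h r) := by
  rw [GradedArtin.IsOdd, ← R.map_evenPart, hr, map_zero]

theorem lTensor_fibContr {i j : ℕ} (h : i ≤ j) (γ w : Fib n (R.level j)) :
    (R.map h).toLinearMap.lTensor (Lam n) (fibContr γ w) =
      fibContr ((R.map h).toLinearMap.lTensor (Lam n) γ)
        ((R.map h).toLinearMap.lTensor (Lam n) w) := by
  induction w using TensorProduct.induction_on with
  | zero => simp
  | add w w' h h' => simp only [map_add, h, h']
  | tmul c s =>
    induction γ using Fib.induction with
    | add γ γ' h h' => simp only [map_add, LinearMap.add_apply, h, h']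
    | even a r hr =>
      rw [fibContr_tmul_of_isEven _ _ hr, LinearMap.lTensor_tmul, LinearMap.lTensor_tmul,
        LinearMap.lTensor_tmul]
      simp only [AlgHom.toLinearMap_apply]
      rw [fibContr_tmul_of_isEven _ _ (ProArtin.map_isEven h hr), map_mul]
    | odd a r hr =>
      rw [fibContr_tmul_of_isOdd _ _ hr, LinearMap.lTensor_tmul, LinearMap.lTensor_tmul,
        LinearMap.lTensor_tmul]
      simp only [AlgHom.toLinearMap_apply]
      rw [fibContr_tmul_of_isOdd _ _ (ProArtin.map_isOdd h hr), map_mul]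

theorem lTensor_fibContr_pow {i j : ℕ} (h : i ≤ j) (γ w : Fib n (R.level j)) (k : ℕ) :
    (R.map h).toLinearMap.lTensor (Lam n) ((fibContr γ ^ k) w) =
      (fibContr ((R.map h).toLinearMap.lTensor (Lam n) γ) ^ k)
        ((R.map h).toLinearMap.lTensor (Lam n) w) := by
  induction k with
  | zero => rfl
  | succ k ih =>
    rw [pow_succ', pow_succ', Module.End.mul_apply, Module.End.mul_apply, lTensor_fibContr, ih]

variable (v : R.Der) (i : ℕ) {r : (R.level (v.shift i)).carrier}

theorem ProArtin.Der.even_isEven (hr : (R.level (v.shift i)).IsEven r) :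
    (R.level i).IsEven (v.even i r) := by
  rw [GradedArtin.IsEven, ← v.even_parity, hr]

theorem ProArtin.Der.even_isOdd (hr : (R.level (v.shift i)).IsOdd r) :
    (R.level i).IsOdd (v.even i r) := by
  rw [GradedArtin.IsOdd, ← v.even_parity, hr, map_zero]

theorem ProArtin.Der.odd_isEven (hr : (R.level (v.shift i)).IsEven r) :
    (R.level i).IsOdd (v.odd i r) := by
  have h := v.odd_parity i r
  rw [hr, GradedArtin.oddPart_apply, eq_sub_iff_add_eq, add_eq_left] at h
  exact h

theorem ProArtin.Der.odd_isOdd (hr : (R.level (v.shift i)).IsOdd r) :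
    (R.level i).IsEven (v.odd i r) := by
  have h := v.odd_parity i r
  rw [hr, map_zero, GradedArtin.oddPart_apply] at h
  exact (sub_eq_zero.mp h.symm).symm

/-- `∂_v` on a fibre, from the coefficients `R_{shift i}` to the coefficients `R_i`. -/
def ProArtin.Der.fib (n : ℕ) : Fib n (R.level (v.shift i)) →ₗ[ℂ] Fib n (R.level i) :=
  TensorProduct.map LinearMap.id (v.even i) + TensorProduct.map inv (v.odd i)

theorem ProArtin.Der.fib_tmul (a : Lam n) (r : (R.level (v.shift i)).carrier) :
    v.fib i n (a ⊗ₜ r) = a ⊗ₜ[ℂ] v.even i r + inv a ⊗ₜ[ℂ] v.odd i r := rfl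

/-- The Leibniz rule for `∂_v` and the contraction with an even element. -/
theorem ProArtin.Der.fib_fibContr {γ : Fib n (R.level (v.shift i))} (hγ : IsEvenFib γ)
    (w : Fib n (R.level (v.shift i))) :
    v.fib i n (fibContr γ w) =
      fibContr (v.fib i n γ) ((R.map (v.le_shift i)).toLinearMap.lTensor (Lam n) w) +
        fibContr ((R.map (v.le_shift i)).toLinearMap.lTensor (Lam n) γ) (v.fib i n w) := by
  induction w using TensorProduct.induction_on with
  | zero => simp
  | add w w' h h' => simp only [map_add, h, h']; abel
  | tmul c s =>
    refine hγ.induction (P := fun γ => v.fib i n (fibContr γ (c ⊗ₜ s)) =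
      fibContr (v.fib i n γ) ((R.map (v.le_shift i)).toLinearMap.lTensor (Lam n) (c ⊗ₜ s)) +
        fibContr ((R.map (v.le_shift i)).toLinearMap.lTensor (Lam n) γ) (v.fib i n (c ⊗ₜ s)))
      (fun w w' h h' => ?_) (fun a r ha hr => ?_) (fun a r ha hr => ?_)
    · simp only [map_add, LinearMap.add_apply, h, h']; abel
    · rw [fibContr_tmul_of_isEven _ _ hr, v.fib_tmul, v.fib_tmul, v.fib_tmul, map_add, map_add,
        LinearMap.add_apply, LinearMap.lTensor_tmul, LinearMap.lTensor_tmul]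
      simp only [AlgHom.toLinearMap_apply]
      rw [fibContr_tmul_of_isEven _ _ (v.even_isEven i hr),
        fibContr_tmul_of_isOdd _ _ (v.odd_isEven i hr),
        fibContr_tmul_of_isEven _ _ (ProArtin.map_isEven _ hr),
        fibContr_tmul_of_isEven _ _ (ProArtin.map_isEven _ hr), v.even_mul, v.odd_mul,
        hr.oddPart_eq, contr_inv, ha, TensorProduct.tmul_add, TensorProduct.tmul_add]
      rw [hr, sub_zero]
      abel
    · rw [fibContr_tmul_of_isOdd _ _ hr, v.fib_tmul, v.fib_tmul, v.fib_tmul, map_add, map_add,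
        LinearMap.add_apply, LinearMap.lTensor_tmul, LinearMap.lTensor_tmul]
      simp only [AlgHom.toLinearMap_apply]
      rw [fibContr_tmul_of_isOdd _ _ (v.even_isOdd i hr),
        fibContr_tmul_of_isEven _ _ (v.odd_isOdd i hr),
        fibContr_tmul_of_isOdd _ _ (ProArtin.map_isOdd _ hr),
        fibContr_tmul_of_isOdd _ _ (ProArtin.map_isOdd _ hr), v.even_mul, v.odd_mul,
        hr.oddPart_eq, contr_inv, ha, inv_inv, TensorProduct.tmul_add, TensorProduct.tmul_add]
      -- The sign from moving the odd part of the derivation past the odd coefficient `r` is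
      -- cancelled by the sign in `inv a = -a`.
      rw [hr, zero_sub]
      simp only [map_neg, LinearMap.neg_apply, TensorProduct.neg_tmul, TensorProduct.tmul_neg,
        neg_mul, neg_neg]
      abel

end Coefficients

/-! ### Leibniz rules for `∂̄`, `∂` and contractions -/

section Leibniz

set_option linter.unusedSectionVars false

variable {W : Type*} [AddCommGroup W] [Module ℂ W] [Module.Finite ℂ W]

/-- A bilinear map in linear coordinates, as a real continuous bilinear map. -/
theorem exists_coord_bilin (F : W →ₗ[ℂ] W →ₗ[ℂ] W) :
    ∃ G : (Fin (Module.finrank ℂ W) → ℂ) →L[ℝ] (Fin (Module.finrank ℂ W) → ℂ) →L[ℝ]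
      (Fin (Module.finrank ℂ W) → ℂ), ∀ a b, G (coords W a) (coords W b) = coords W (F a b) := by
  let G : (Fin (Module.finrank ℂ W) → ℂ) →ₗ[ℝ] (Fin (Module.finrank ℂ W) → ℂ) →ₗ[ℝ]
      (Fin (Module.finrank ℂ W) → ℂ) :=
    LinearMap.mk₂ ℝ (fun a b => coords W (F ((coords W).symm a) ((coords W).symm b)))
      (by intros; simp)
      (by intro c a b; simp only [← Complex.coe_smul, map_smul, LinearMap.smul_apply])
      (by intros; simp) (by intro c a b; simp only [← Complex.coe_smul, map_smul])
  refine ⟨LinearMap.toContinuousLinearMap (LinearMap.toContinuousLinearMap.toLinearMap ∘ₗ G),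
    fun a b => ?_⟩
  change coords W (F ((coords W).symm (coords W a)) ((coords W).symm (coords W b))) = _
  rw [LinearEquiv.symm_apply_apply, LinearEquiv.symm_apply_apply]

theorem dirDeriv_bilin (F : W →ₗ[ℂ] W →ₗ[ℂ] W) {f g : Cn n → W} {y : Cn n} (hf : DiffAt f y)
    (hg : DiffAt g y) (u : Cn n) :
    dirDeriv (fun z => F (f z) (g z)) y u =
      F (dirDeriv f y u) (g y) + F (f y) (dirDeriv g y u) := by
  obtain ⟨G, hG⟩ := exists_coord_bilin F
  have h₁ : (fun z => coords W (F (f z) (g z))) =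
      fun z => G (coords W (f z)) (coords W (g z)) := by funext z; rw [hG]
  have h₂ := G.hasFDerivAt_of_bilinear hf.hasFDerivAt hg.hasFDerivAt
  unfold dirDeriv
  rw [h₁, h₂.fderiv, LinearEquiv.symm_apply_eq, map_add, ← hG, ← hG,
    LinearEquiv.apply_symm_apply, LinearEquiv.apply_symm_apply, add_comm]
  rfl

theorem dz_bilin (F : W →ₗ[ℂ] W →ₗ[ℂ] W) {f g : Cn n → W} {y : Cn n} (hf : DiffAt f y)
    (hg : DiffAt g y) (i : Fin n) :
    dz (fun z => F (f z) (g z)) y i = F (dz f y i) (g y) + F (f y) (dz g y i) := by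
  simp only [dz, dirDeriv_bilin F hf hg, map_smul, map_sub, LinearMap.smul_apply,
    LinearMap.sub_apply, smul_add, smul_sub]
  abel

theorem dzbar_bilin (F : W →ₗ[ℂ] W →ₗ[ℂ] W) {f g : Cn n → W} {y : Cn n} (hf : DiffAt f y)
    (hg : DiffAt g y) (i : Fin n) :
    dzbar (fun z => F (f z) (g z)) y i = F (dzbar f y i) (g y) + F (f y) (dzbar g y i) := by
  simp only [dzbar, dirDeriv_bilin F hf hg, map_smul, map_add, LinearMap.smul_apply,
    LinearMap.add_apply, smul_add]
  abel

theorem dirDeriv_congr {f g : Cn n → W} {y : Cn n} (h : f =ᶠ[nhds y] g) (u : Cn n) :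
    dirDeriv f y u = dirDeriv g y u := by
  have h' : (fun z => coords W (f z)) =ᶠ[nhds y] fun z => coords W (g z) :=
    h.fun_comp (coords W)
  rw [dirDeriv, dirDeriv, h'.fderiv_eq]

theorem dz_congr {f g : Cn n → W} {y : Cn n} (h : f =ᶠ[nhds y] g) (i : Fin n) :
    dz f y i = dz g y i := by
  simp only [dz, dirDeriv_congr h]

theorem dzbar_congr {f g : Cn n → W} {y : Cn n} (h : f =ᶠ[nhds y] g) (i : Fin n) :
    dzbar f y i = dzbar g y i := by
  simp only [dzbar, dirDeriv_congr h]

variable {A : GradedArtin.{u}} {X : Type*} [TopologicalSpace X] [ChartedSpace (Cn n) X]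
  [IsManifold 𝓘(ℂ, Cn n) ω X]

theorem jac_self (x : X) : (jac x x x : Matrix (Fin n) (Fin n) ℂ) = 1 := by
  rw [jac, ← LinearMap.toMatrix'_id]
  congr 1
  exact LinearMap.ext fun v => tangentCoordChange_self (mem_extChartAt_source x)

/-- At the base point of its preferred chart a field is read without any Jacobian, so the
undifferentiated factors in Leibniz rules are plain values. -/
theorem read_chartAt_self {T : X → X → Cn n × Cn n →ₗ[ℂ] Cn n × Cn n} (s : X → Fib n A) (x : X)
    (hT : T x x = LinearMap.id) : read T x s (chartAt (Cn n) x x) = s x := by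
  rw [read, (chartAt (Cn n) x).left_inv (mem_chart_source (Cn n) x), hT, ExteriorAlgebra.map_id]
  exact LinearMap.rTensor_id_apply _ _ _

theorem formChange_self (x : X) : formChange (n := n) x x = LinearMap.id := by
  simp only [formChange, jac_self, Matrix.transpose_one, Matrix.conjTranspose_one,
    Matrix.toLin'_one, LinearMap.prodMap_id]

theorem polyChange_self (x : X) : polyChange (n := n) x x = LinearMap.id := by
  simp only [polyChange, jac_self, Matrix.conjTranspose_one, Matrix.toLin'_one,
    LinearMap.prodMap_id]

variable {γ s : X → Fib n A}

/-- The coordinate formula for a contraction holds only on the target of the chart; that target is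
open, which suffices for derivatives at the base point. -/
theorem read_contr_eventuallyEq (γ s : X → Fib n A) (x : X) :
    read formChange x (fun z => fibContr (γ z) (s z)) =ᶠ[nhds (chartAt (Cn n) x x)]
      fun y => fibContr (read polyChange x γ y) (read formChange x s y) :=
  Filter.eventuallyEq_of_mem ((chartAt (Cn n) x).open_target.mem_nhds
    (mem_chart_target (Cn n) x)) fun _ hy => read_contr γ s hy

theorem dz_read_contr (hγ : IsSmooth polyChange γ) (hs : IsSmooth formChange s) (x : X)
    (i : Fin n) :
    dz (read formChange x fun z => fibContr (γ z) (s z)) (chartAt (Cn n) x x) i =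
      fibContr (dz (read polyChange x γ) (chartAt (Cn n) x x) i) (s x) +
        fibContr (γ x) (dz (read formChange x s) (chartAt (Cn n) x x) i) := by
  rw [dz_congr (read_contr_eventuallyEq γ s x), dz_bilin fibContr (hγ.diffAt x) (hs.diffAt x),
    read_chartAt_self _ _ (formChange_self x), read_chartAt_self _ _ (polyChange_self x)]

theorem dzbar_read_contr (hγ : IsSmooth polyChange γ) (hs : IsSmooth formChange s) (x : X)
    (i : Fin n) :
    dzbar (read formChange x fun z => fibContr (γ z) (s z)) (chartAt (Cn n) x x) i =
      fibContr (dzbar (read polyChange x γ) (chartAt (Cn n) x x) i) (s x) +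
        fibContr (γ x) (dzbar (read formChange x s) (chartAt (Cn n) x x) i) := by
  rw [dzbar_congr (read_contr_eventuallyEq γ s x),
    dzbar_bilin fibContr (hγ.diffAt x) (hs.diffAt x),
    read_chartAt_self _ _ (formChange_self x), read_chartAt_self _ _ (polyChange_self x)]

/-- `[∂̄, i_γ] = i_{∂̄γ}` -/
theorem delbar_contr (hγ : IsSmooth polyChange γ) (heven : ∀ z, IsEvenFib (γ z))
    (hs : IsSmooth formChange s) (x : X) :
    delbar (fun z => fibContr (γ z) (s z)) x =
      fibContr (γ x) (delbar s x) + fibContr (polyDelbar γ x) (s x) := by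
  simp only [delbar, polyDelbar, dzbar_read_contr hγ hs, map_add, map_sum, LinearMap.sum_apply,
    Finset.sum_add_distrib, fibContr_lmul_gen₂, lmul_gen₂_fibContr (heven x)]
  abel

/-- `[∂, i_γ]` -/
def delBracket (γ s : X → Fib n A) (x : X) : Fib n A :=
  del (fun z => fibContr (γ z) (s z)) x - fibContr (γ x) (del s x)

theorem del_contr (γ s : X → Fib n A) (x : X) :
    del (fun z => fibContr (γ z) (s z)) x = fibContr (γ x) (del s x) + delBracket γ s x :=
  (add_sub_cancel _ _).symm

/-- In the commutator the terms i_γ(dz_i ∧ ∂_i s) cancel. What remains is the derivative falling on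
γ, and the defect of commuting dz_i past i_γ. -/
theorem delBracket_eq (hγ : IsSmooth polyChange γ) (heven : ∀ z, IsEvenFib (γ z))
    (hs : IsSmooth formChange s) (x : X) :
    delBracket γ s x = ∑ i,
      (lmul (gen₁ (Pi.single i 1))
          (fibContr (dz (read polyChange x γ) (chartAt (Cn n) x x) i) (s x)) +
        fibContr ((leftDer i).rTensor A.carrier (γ x))
          (dz (read formChange x s) (chartAt (Cn n) x x) i)) := by
  simp only [delBracket, del, dz_read_contr hγ hs, map_add, map_sum,
    lmul_gen₁_fibContr (heven x), ← Finset.sum_sub_distrib]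
  refine Finset.sum_congr rfl fun i _ => ?_
  abel

/-- For an even field the symmetric half of the bracket equals the first half and the odd correction
vanishes. -/
theorem schouten_self (heven : ∀ z, IsEvenFib (γ z)) (x : X) :
    schouten γ γ x = (2 : ℂ) • halfSchouten γ γ x := by
  have h₁ : (fun y => fibEven (γ y)) = γ := funext fun y => fibEven_of_isEvenFib (heven y)
  have h₂ : (fun y => fibOdd (γ y)) = 0 := funext fun y => fibOdd_of_isEvenFib (heven y)
  have h₃ : ∀ β : X → Fib n A, halfSchouten β 0 x = 0 := by
    intro β
    have : read polyChange x (0 : X → Fib n A) = fun _ => 0 := by funext y; simp [read]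
    simp [halfSchouten, this, dz, dirDeriv]
  rw [schouten, h₁, h₂, h₃, add_zero, two_smul]

/-- `[[∂, i_γ], i_γ] = i_{[γ,γ]}` -/
theorem delBracket_contr (hγ : IsSmooth polyChange γ) (heven : ∀ z, IsEvenFib (γ z))
    (hs : IsSmooth formChange s) (x : X) :
    delBracket γ (fun z => fibContr (γ z) (s z)) x =
      fibContr (γ x) (delBracket γ s x) + fibContr (schouten γ γ x) (s x) := by
  rw [delBracket_eq hγ heven (hγ.contr hs), delBracket_eq hγ heven hs, schouten_self heven,
    map_smul, LinearMap.smul_apply, halfSchouten, map_sum, map_sum, LinearMap.sum_apply,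
    Finset.smul_sum, ← Finset.sum_add_distrib]
  refine Finset.sum_congr rfl fun i _ => ?_
  -- Each of the two terms of `delBracket_eq` produces one copy of i_{∂γ/∂(∂_i)} i_{∂_iγ} s: one
  -- from moving dz_i past i_γ, one from differentiating i_γ s. This accounts for the factor 2 in
  -- [γ,γ].
  rw [dz_read_contr hγ hs, map_add, map_add, fibContr_fibMul,
    ← fibContr_comm_of_isEvenFib (heven x) _ (s x), lmul_gen₁_fibContr (heven x),
    ← fibContr_comm_of_isEvenFib (heven x) _ (dz _ _ i), two_smul]
  abel

end Leibniz

/-! ### Powers of a contraction -/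

section ExpSum

variable {V : Type*} [AddCommGroup V] [Module ℂ V]

/-- The coefficient of `ħ^m` in the truncation of `exp(ħ⁻¹ c) f`. -/
def expSum (c : Module.End ℂ V) (f : ℤ → V) (K : ℕ) (m : ℤ) : V :=
  ∑ k ∈ Finset.range K, ((k.factorial : ℂ)⁻¹) • (c ^ k) (f (m + k))

variable {c : Module.End ℂ V}

theorem expSum_add (f g : ℤ → V) (K : ℕ) (m : ℤ) :
    expSum c (f + g) K m = expSum c f K m + expSum c g K m := by
  simp only [expSum, Pi.add_apply, map_add, smul_add, Finset.sum_add_distrib]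

theorem expSum_smul (a : ℂ) (f : ℤ → V) (K : ℕ) (m : ℤ) :
    expSum c (a • f) K m = a • expSum c f K m := by
  simp only [expSum, Pi.smul_apply, map_smul, Finset.smul_sum, smul_comm a]

theorem expSum_shift (f : ℤ → V) (K : ℕ) (j m : ℤ) :
    expSum c (fun l => f (l + j)) K m = expSum c f K (m + j) :=
  Finset.sum_congr rfl fun k _ => by rw [add_right_comm]

theorem expSum_eq_of_le {N K : ℕ} (hN : c ^ N = 0) (h : N ≤ K) (f : ℤ → V) (m : ℤ) :
    expSum c f K m = expSum c f N m := by
  refine (Finset.sum_subset (Finset.range_mono h) fun k _ hk => ?_).symm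
  rw [pow_eq_zero_of_le (by simpa using hk) hN, LinearMap.zero_apply, smul_zero]

theorem finsum_eq_expSum {N K : ℕ} (hN : c ^ N = 0) (h : N ≤ K) (f : ℤ → V) (m : ℤ) :
    ∑ᶠ k : ℕ, ((k.factorial : ℂ)⁻¹) • (c ^ k) (f (m + k)) = expSum c f K m := by
  refine finsum_eq_sum_of_support_subset _ fun k hk => ?_
  rw [Finset.coe_range, Set.mem_Iio]
  by_contra hKk
  refine hk ?_
  dsimp only
  rw [pow_eq_zero_of_le (h.trans (not_lt.mp hKk)) hN, LinearMap.zero_apply, smul_zero]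

/-- Since k/k! = 1/(k−1)!, a single commutator with each power reproduces the exponential, with one
extra factor ħ⁻¹ seen as the shift to `m + 1`. -/
theorem sum_smul_pow_pred (f : ℤ → V) (K : ℕ) (m : ℤ) :
    ∑ k ∈ Finset.range (K + 1), ((k.factorial : ℂ)⁻¹) • (k : ℂ) • (c ^ (k - 1)) (f (m + k)) =
      expSum c f K (m + 1) := by
  rw [Finset.sum_range_succ']
  simp only [Nat.cast_zero, zero_smul, smul_zero, add_zero, expSum]
  refine Finset.sum_congr rfl fun k _ => ?_
  have h : (k : ℂ) + 1 ≠ 0 := Nat.cast_add_one_ne_zero k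
  rw [smul_smul, Nat.factorial_succ, Nat.add_sub_cancel]
  congr 1
  · push_cast
    field_simp
  · congr 2
    push_cast
    ring

/-- The second-order analogue: `k.choose 2` divided by k! is half of 1/(k−2)!, which is the ½ in
front of [γ,γ]. -/
theorem sum_smul_choose_two_pow_pred (f : ℤ → V) (K : ℕ) (m : ℤ) :
    ∑ k ∈ Finset.range (K + 2), ((k.factorial : ℂ)⁻¹) • (k.choose 2 : ℂ) •
        (c ^ (k - 2)) (f (m + k)) =
      (2⁻¹ : ℂ) • expSum c f K (m + 2) := by
  rw [Finset.sum_range_succ', Finset.sum_range_succ']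
  simp only [Nat.choose_zero_succ, zero_add, Nat.cast_zero, zero_smul,
    smul_zero, add_zero, expSum, Finset.smul_sum, show Nat.choose 1 2 = 0 from rfl]
  refine Finset.sum_congr rfl fun k _ => ?_
  have h₁ : (k : ℂ) + 1 ≠ 0 := Nat.cast_add_one_ne_zero k
  have h₂ : (k : ℂ) + 1 + 1 ≠ 0 := by
    simpa using Nat.cast_add_one_ne_zero (R := ℂ) (k + 1)
  rw [smul_smul, smul_smul, Nat.factorial_succ, Nat.factorial_succ]
  congr 1
  · rw [Nat.cast_choose_two]
    push_cast
    field_simp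
    ring
  · congr 2
    push_cast
    ring

/-- The operator `ħ⁻¹ c` on two-sided series. -/
def shiftEnd (c : Module.End ℂ V) : Module.End ℂ (ℤ → V) where
  toFun f m := c (f (m + 1))
  map_add' f g := by funext m; simp
  map_smul' a f := by funext m; simp

theorem shiftEnd_pow_apply (c : Module.End ℂ V) (k : ℕ) (f : ℤ → V) (m : ℤ) :
    (shiftEnd c ^ k) f m = (c ^ k) (f (m + k)) := by
  induction k generalizing m with
  | zero => simp
  | succ k ih =>
    rw [pow_succ', pow_succ', Module.End.mul_apply, Module.End.mul_apply]
    change c ((shiftEnd c ^ k) f (m + 1)) = _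
    rw [ih]
    congr 3
    push_cast
    ring

theorem shiftEnd_pow_eq_zero {N : ℕ} (hN : c ^ N = 0) : shiftEnd c ^ N = 0 := by
  refine LinearMap.ext fun f => funext fun m => ?_
  rw [shiftEnd_pow_apply, hN]
  rfl

/-- Viewed on whole series, ħ⁻¹c is a single nilpotent operator, and exponentials of commuting
nilpotent operators multiply. -/
theorem expSum_neg_expSum {N : ℕ} (hN : c ^ N = 0) (hN' : (-c) ^ N = 0) (f : ℤ → V) (m : ℤ) :
    expSum (-c) (expSum c f N) N m = f m := by
  -- `IsNilpotent.exp` uses rational scalars; restricting them from ℂ makes its coefficients agree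
  -- by definition with those of `expSum`.
  let _ : Module ℚ (Module.End ℂ (ℤ → V)) := Module.compHom _ (algebraMap ℚ ℂ)
  have e : ∀ (a : ℚ) (T : Module.End ℂ (ℤ → V)), a • T = (a : ℂ) • T := fun a T => rfl
  have hcomm : Commute (shiftEnd (-c)) (shiftEnd c) :=
    LinearMap.ext fun f => funext fun m => by
      change (-c) (c _) = c ((-c) _)
      simp
  have hadd : shiftEnd (-c) + shiftEnd c = 0 :=
    LinearMap.ext fun f => funext fun m => by
      change (-c) (f (m + 1)) + c (f (m + 1)) = 0
      simp
  have h := IsNilpotent.exp_add_of_commute hcomm ⟨N, shiftEnd_pow_eq_zero hN'⟩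
    ⟨N, shiftEnd_pow_eq_zero hN⟩
  rw [hadd, IsNilpotent.exp_zero, IsNilpotent.exp_eq_sum (shiftEnd_pow_eq_zero hN),
    IsNilpotent.exp_eq_sum (shiftEnd_pow_eq_zero hN')] at h
  have h' := congrFun (LinearMap.congr_fun h f) m
  rw [Module.End.mul_apply] at h'
  simp only [e, LinearMap.sum_apply, LinearMap.smul_apply, Finset.sum_apply, Pi.smul_apply,
    shiftEnd_pow_apply, Rat.cast_inv, Rat.cast_natCast] at h'
  exact h'.symm

end ExpSum

/-! ### Commuting ∂̄ and ∂ past powers of i_γ. -/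

section ContrPow

variable {A : GradedArtin.{u}} {X : Type*} [TopologicalSpace X] [ChartedSpace (Cn n) X]
  [IsManifold 𝓘(ℂ, Cn n) ω X] {γ s : X → Fib n A}

set_option linter.unusedSectionVars false

theorem IsSmooth.contr_pow (hγ : IsSmooth polyChange γ) (hs : IsSmooth formChange s) (k : ℕ) :
    IsSmooth formChange (fun z => (fibContr (γ z) ^ k) (s z)) := by
  induction k with
  | zero => exact hs
  | succ k ih =>
    simp only [pow_succ', Module.End.mul_apply]
    exact hγ.contr ih

theorem IsSmooth.sum {T : X → X → Cn n × Cn n →ₗ[ℂ] Cn n × Cn n} {ι : Type*} (S : Finset ι)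
    {f : ι → X → Fib n A} (hf : ∀ k ∈ S, IsSmooth T (f k)) : IsSmooth T (∑ k ∈ S, f k) := by
  classical
  induction S using Finset.induction_on with
  | empty => exact IsSmooth.zero
  | insert a S ha ih =>
    rw [Finset.sum_insert ha]
    exact (hf a (Finset.mem_insert_self a S)).add
      (ih fun k hk => hf k (Finset.mem_insert_of_mem hk))

theorem del_zero : del (0 : X → Fib n A) = 0 := by
  simpa using del_smul (0 : ℂ) (IsSmooth.zero (T := formChange) (X := X) (A := A) (n := n))

theorem delbar_zero : delbar (0 : X → Fib n A) = 0 := by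
  simpa using delbar_smul (0 : ℂ) (IsSmooth.zero (T := formChange) (X := X) (A := A) (n := n))

theorem del_sum {ι : Type*} (S : Finset ι) {f : ι → X → Fib n A}
    (hf : ∀ k ∈ S, IsSmooth formChange (f k)) : del (∑ k ∈ S, f k) = ∑ k ∈ S, del (f k) := by
  classical
  induction S using Finset.induction_on with
  | empty => exact del_zero
  | insert a S ha ih =>
    have h := fun k hk => hf k (Finset.mem_insert_of_mem hk)
    rw [Finset.sum_insert ha, Finset.sum_insert ha,
      del_add (hf a (Finset.mem_insert_self a S)) (IsSmooth.sum S h), ih h]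

theorem delbar_sum {ι : Type*} (S : Finset ι) {f : ι → X → Fib n A}
    (hf : ∀ k ∈ S, IsSmooth formChange (f k)) :
    delbar (∑ k ∈ S, f k) = ∑ k ∈ S, delbar (f k) := by
  classical
  induction S using Finset.induction_on with
  | empty => exact delbar_zero
  | insert a S ha ih =>
    have h := fun k hk => hf k (Finset.mem_insert_of_mem hk)
    rw [Finset.sum_insert ha, Finset.sum_insert ha,
      delbar_add (hf a (Finset.mem_insert_self a S)) (IsSmooth.sum S h), ih h]

theorem commute_fibContr {γ : Fib n A} (hγ : IsEvenFib γ) (β : Fib n A) :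
    Commute (fibContr γ) (fibContr β) :=
  LinearMap.ext fun w => fibContr_comm_of_isEvenFib hγ β w

/-- The coefficient `k c^{k-1}` of an iterated commutator grows by one `c^k` at each step. -/
theorem smul_pow_pred_succ {V : Type*} [AddCommGroup V] [Module ℂ V] (c : Module.End ℂ V) (k : ℕ)
    (w : V) : c ((k : ℂ) • (c ^ (k - 1)) w) + (c ^ k) w =
      ((k + 1 : ℕ) : ℂ) • (c ^ (k + 1 - 1)) w := by
  rcases k with _ | k
  · simp
  · rw [map_smul, ← Module.End.mul_apply, Nat.add_sub_cancel, Nat.add_sub_cancel, ← pow_succ']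
    push_cast
    rw [add_smul ((k : ℂ) + 1), one_smul]

/-- Pascal's rule; the truncated exponents for small `k` are harmless because their coefficients
vanish. -/
theorem smul_choose_two_pow_pred_succ {V : Type*} [AddCommGroup V] [Module ℂ V]
    (c : Module.End ℂ V) (k : ℕ) (w : V) :
    c ((k.choose 2 : ℂ) • (c ^ (k - 2)) w) + (k : ℂ) • (c ^ (k - 1)) w =
      ((k + 1).choose 2 : ℂ) • (c ^ (k + 1 - 2)) w := by
  rcases k with _ | _ | k
  · simp
  · simp
  · rw [map_smul, ← Module.End.mul_apply, ← pow_succ',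
      show k + 1 + 1 - 2 + 1 = k + 1 by omega, show k + 1 + 1 - 1 = k + 1 by omega,
      show k + 1 + 1 + 1 - 2 = k + 1 by omega, ← add_smul, Nat.choose_succ_succ' (k + 1 + 1) 1,
      Nat.choose_one_right]
    push_cast
    rw [add_comm]

/-- The commutator i_{∂̄γ} commutes with i_γ, so each of the k positions contributes equally. -/
theorem delbar_contr_pow (hγ : IsSmooth polyChange γ) (heven : ∀ z, IsEvenFib (γ z))
    (hs : IsSmooth formChange s) (k : ℕ) (x : X) :
    delbar (fun z => (fibContr (γ z) ^ k) (s z)) x = (fibContr (γ x) ^ k) (delbar s x) +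
      (k : ℂ) • (fibContr (γ x) ^ (k - 1)) (fibContr (polyDelbar γ x) (s x)) := by
  induction k with
  | zero => simp
  | succ k ih =>
    have h := delbar_contr hγ heven (hγ.contr_pow hs k) x
    simp only [← Module.End.mul_apply, ← pow_succ'] at h
    rw [h, ih, map_add, ← (commute_fibContr (heven x) _).pow_left k, Module.End.mul_apply,
      ← smul_pow_pred_succ, pow_succ', Module.End.mul_apply, add_assoc]

theorem delBracket_contr_pow (hγ : IsSmooth polyChange γ) (heven : ∀ z, IsEvenFib (γ z))
    (hs : IsSmooth formChange s) (k : ℕ) (x : X) :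
    delBracket γ (fun z => (fibContr (γ z) ^ k) (s z)) x =
      (fibContr (γ x) ^ k) (delBracket γ s x) +
        (k : ℂ) • (fibContr (γ x) ^ (k - 1)) (fibContr (schouten γ γ x) (s x)) := by
  induction k with
  | zero => simp
  | succ k ih =>
    have h := delBracket_contr hγ heven (hγ.contr_pow hs k) x
    simp only [← Module.End.mul_apply, ← pow_succ'] at h
    rw [h, ih, map_add, ← (commute_fibContr (heven x) _).pow_left k, Module.End.mul_apply,
      ← smul_pow_pred_succ, pow_succ', Module.End.mul_apply, add_assoc]

/-- Here [∂, i_γ] does not commute with i_γ, but the double commutator i_{[γ,γ]} does, so the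
expansion ends at second order with coefficients 1, k and `k.choose 2`. -/
theorem del_contr_pow (hγ : IsSmooth polyChange γ) (heven : ∀ z, IsEvenFib (γ z))
    (hs : IsSmooth formChange s) (k : ℕ) (x : X) :
    del (fun z => (fibContr (γ z) ^ k) (s z)) x = (fibContr (γ x) ^ k) (del s x) +
      (k : ℂ) • (fibContr (γ x) ^ (k - 1)) (delBracket γ s x) +
      (k.choose 2 : ℂ) • (fibContr (γ x) ^ (k - 2)) (fibContr (schouten γ γ x) (s x)) := by
  induction k with
  | zero => simp
  | succ k ih =>
    have h := del_contr γ (fun z => (fibContr (γ z) ^ k) (s z)) x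
    simp only [← Module.End.mul_apply, ← pow_succ'] at h
    rw [h, ih, delBracket_contr_pow hγ heven hs, ← smul_pow_pred_succ,
      ← smul_choose_two_pow_pred_succ, map_add, map_add, pow_succ', Module.End.mul_apply]
    abel

/-- For a Maurer–Cartan element, `exp(ħ⁻¹ i_γ)` conjugates `∂̄ + [∂, i_γ] + ħ∂` into `∂̄ + ħ∂`. -/
theorem delbar_add_del_expSum (hγ : IsSmooth polyChange γ) (heven : ∀ z, IsEvenFib (γ z))
    (hMC : ∀ x, polyDelbar γ x + (2⁻¹ : ℂ) • schouten γ γ x = 0) {N : ℕ}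
    (hN : ∀ x, fibContr (γ x) ^ N = 0) {Φ : ℤ → X → Fib n A}
    (hΦ : ∀ m, IsSmooth formChange (Φ m)) (m : ℤ) (x : X) :
    delbar (fun z => expSum (fibContr (γ z)) (fun l => Φ l z) N m) x +
        del (fun z => expSum (fibContr (γ z)) (fun l => Φ l z) N (m - 1)) x =
      expSum (fibContr (γ x))
        (fun l => delbar (Φ l) x + delBracket γ (Φ l) x + del (Φ (l - 1)) x) N m := by
  -- Two vanishing terms are appended so that N terms remain after the double commutator shifts the
  -- summation index by two.
  have e : ∀ l, (fun z => expSum (fibContr (γ z)) (fun l => Φ l z) N l) =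
      ∑ k ∈ Finset.range (N + 2), ((k.factorial : ℂ)⁻¹) •
        fun z => (fibContr (γ z) ^ k) (Φ (l + k) z) := by
    intro l
    funext z
    rw [← expSum_eq_of_le (hN z) (Nat.le_add_right N 2), expSum, Finset.sum_apply]
    rfl
  have hsm : ∀ l, ∀ k ∈ Finset.range (N + 2), IsSmooth formChange (((k.factorial : ℂ)⁻¹) •
      fun z => (fibContr (γ z) ^ k) (Φ (l + k) z)) :=
    fun l k _ => (hγ.contr_pow (hΦ _) k).smul _
  have hS : schouten γ γ x = (-2 : ℂ) • polyDelbar γ x := by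
    rw [eq_neg_of_add_eq_zero_left (hMC x), neg_smul_neg, smul_smul,
      mul_inv_cancel₀ two_ne_zero, one_smul]
  have h₁ : delbar (fun z => expSum (fibContr (γ z)) (fun l => Φ l z) N m) x =
      expSum (fibContr (γ x)) (fun l => delbar (Φ l) x) N m +
        expSum (fibContr (γ x)) (fun l => fibContr (polyDelbar γ x) (Φ l x)) N (m + 1) := by
    rw [e, delbar_sum _ (hsm m), Finset.sum_apply,
      ← expSum_eq_of_le (hN x) (Nat.le_add_right N 2),
      ← expSum_eq_of_le (hN x) (Nat.le_add_right N 1) _ (m + 1), ← sum_smul_pow_pred, expSum,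
      ← Finset.sum_add_distrib]
    refine Finset.sum_congr rfl fun k _ => ?_
    rw [delbar_smul _ (hγ.contr_pow (hΦ _) k), Pi.smul_apply,
      delbar_contr_pow hγ heven (hΦ _), smul_add]
  have h₂ : del (fun z => expSum (fibContr (γ z)) (fun l => Φ l z) N (m - 1)) x =
      expSum (fibContr (γ x)) (fun l => del (Φ l) x) N (m - 1) +
        expSum (fibContr (γ x)) (fun l => delBracket γ (Φ l) x) N (m - 1 + 1) +
        (2⁻¹ : ℂ) • expSum (fibContr (γ x)) (fun l => fibContr (schouten γ γ x) (Φ l x)) N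
          (m - 1 + 2) := by
    rw [e, del_sum _ (hsm (m - 1)), Finset.sum_apply,
      ← expSum_eq_of_le (hN x) (Nat.le_add_right N 2) _ (m - 1),
      ← expSum_eq_of_le (hN x) (Nat.le_add_right N 1) _ (m - 1 + 1), ← sum_smul_pow_pred,
      ← sum_smul_choose_two_pow_pred, expSum, ← Finset.sum_add_distrib,
      ← Finset.sum_add_distrib]
    refine Finset.sum_congr rfl fun k _ => ?_
    rw [del_smul _ (hγ.contr_pow (hΦ _) k), Pi.smul_apply,
      del_contr_pow hγ heven (hΦ _), smul_add, smul_add]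
  have h₃ : (fun l => fibContr (schouten γ γ x) (Φ l x)) =
      (-2 : ℂ) • fun l => fibContr (polyDelbar γ x) (Φ l x) := by
    funext l
    rw [hS, map_smul]
    rfl
  have h₄ : (fun l => delbar (Φ l) x + delBracket γ (Φ l) x + del (Φ (l - 1)) x) =
      (fun l => delbar (Φ l) x) + (fun l => delBracket γ (Φ l) x) +
        fun l => (fun l => del (Φ l) x) (l + (-1)) := rfl
  -- The coefficient ½ · (−2) = −1 is the Maurer–Cartan equation at work: the i_{∂̄γ} term from ∂̄
  -- and the i_{[γ,γ]} term from ħ∂ both sit at index `m + 1` and cancel.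
  rw [h₁, h₂, h₃, h₄, expSum_smul, expSum_add, expSum_add, expSum_shift (fun l => del (Φ l) x),
    smul_smul, sub_add_cancel, show m - 1 + 2 = m + 1 by ring, ← sub_eq_add_neg,
    show (2⁻¹ : ℂ) * -2 = -1 by norm_num, neg_one_smul]
  abel

end ContrPow

/-! ### The exponential of a contraction on series -/

section Series

variable {X : Type*} [TopologicalSpace X] [ChartedSpace (Cn n) X]
  [IsManifold 𝓘(ℂ, Cn n) ω X] {R : ProArtin.{u}}

set_option linter.unusedSectionVars false

theorem IsCompat.contrFam {γ s : Fam n X R} (hγ : IsCompat γ) (hs : IsCompat s) :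
    IsCompat (contrFam γ s) := fun i j h x => by
  simp only [SemiInfinite.contrFam]
  rw [lTensor_fibContr, hγ i j h x, hs i j h x]

theorem IsCompat.derFam (v : R.Der) {s : Fam n X R} (hs : IsCompat s) :
    IsCompat (derFam v s) := by
  intro i j h x
  have hi : v.shift i ≤ max (v.shift i) (v.shift j) := le_max_left _ _
  have hj : v.shift j ≤ max (v.shift i) (v.shift j) := le_max_right _ _
  simp only [SemiInfinite.derFam, ← hs _ _ hi x, ← hs _ _ hj x]
  generalize s (max (v.shift i) (v.shift j)) x = w
  induction w using TensorProduct.induction_on with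
  | zero => simp
  | tmul a r => simp [v.even_compat h hi hj, v.odd_compat h hi hj]
  | add w w' hw hw' =>
    simp only [map_add] at hw hw' ⊢
    rw [add_add_add_comm, hw, hw', add_add_add_comm]

theorem contrFam_mem {γ s : Fam n X R} (hγ : ∀ i, IsSmooth polyChange (γ i)) (hγ' : IsCompat γ)
    (hs : s ∈ forms n X R) : contrFam γ s ∈ forms n X R :=
  ⟨fun i => (hγ i).contr (hs.1 i), hγ'.contrFam hs.2⟩

theorem nablaSeries_mem (γ : MC n X R) (v : R.Der) {Φ : Series n X R}
    (hΦ : Φ ∈ intSeries n X R) : nablaSeries γ v Φ ∈ intSeries n X R := fun m =>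
  add_mem (derFam_mem v (hΦ m)) <| contrFam_mem
    (fun i => ((γ.isPolyField.1 (v.shift i)).map _ _ map_comp_id).add
      ((γ.isPolyField.1 (v.shift i)).map _ _ map_comp_inv))
    (γ.isPolyField.2.1.derFam v) (hΦ (m + 1))

/-- The bound depends on the level but not on the point, so the exponential is one fixed finite sum
of smooth fields and may be differentiated termwise. -/
theorem IsPolyField.exists_pow_eq_zero {d : ℤ} {γ : Fam n X R} (hγ : IsPolyField n X R d γ)
    (i : ℕ) : ∃ N : ℕ, ∀ x, fibContr (γ i x) ^ N = 0 := by
  obtain ⟨N, hN⟩ := exists_fibContr_pow_eq_zero (R.level i)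
  exact ⟨N, fun x => hN n d _ (hγ.2.2 i x)⟩

theorem IsPolyField.neg {d : ℤ} {γ : Fam n X R} (hγ : IsPolyField n X R d γ) :
    IsPolyField n X R d (-γ) := by
  refine ⟨fun i => ?_, fun i j h x => ?_, fun i x => neg_mem (hγ.2.2 i x)⟩
  · have h := (hγ.1 i).smul (-1)
    rwa [neg_one_smul] at h
  · simp only [Pi.neg_apply, map_neg, hγ.2.1 i j h x]

/-- The operator `exp(ħ⁻¹ i_γ)`. -/
def expFam (γ : Fam n X R) (Φ : Series n X R) : Series n X R := fun m i x =>
  ∑ᶠ k : ℕ, ((k.factorial : ℂ)⁻¹) • ((fibContr (γ i x)) ^ k) (Φ (m + k) i x)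

theorem expFam_apply {γ : Fam n X R} {N : ℕ} {i : ℕ} {x : X} (hN : fibContr (γ i x) ^ N = 0)
    {K : ℕ} (h : N ≤ K) (Φ : Series n X R) (m : ℤ) :
    expFam γ Φ m i x = expSum (fibContr (γ i x)) (fun l => Φ l i x) K m :=
  finsum_eq_expSum hN h (fun l => Φ l i x) m

/-- The inverse operator is the exponential for −γ, which need not satisfy the Maurer–Cartan
equation; hence the passage to arbitrary families. -/
theorem expContr_eq_expFam (γ : MC n X R) (Φ : Series n X R) :
    expContr γ Φ = expFam γ.val Φ := rfl

theorem IsPolyField.expFam_mem {d : ℤ} {γ : Fam n X R} (hγ : IsPolyField n X R d γ)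
    {Φ : Series n X R} (hΦ : Φ ∈ intSeries n X R) : expFam γ Φ ∈ intSeries n X R := by
  refine fun m => ⟨fun i => ?_, fun i j h x => ?_⟩
  · obtain ⟨N, hN⟩ := hγ.exists_pow_eq_zero i
    have e : expFam γ Φ m i = ∑ k ∈ Finset.range N, ((k.factorial : ℂ)⁻¹) •
        fun z => (fibContr (γ i z) ^ k) (Φ (m + k) i z) := by
      funext z
      rw [expFam_apply (hN z) le_rfl, expSum, Finset.sum_apply]
      rfl
    rw [e]
    exact IsSmooth.sum _ fun k _ => ((hγ.1 i).contr_pow ((hΦ _).1 i) k).smul _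
  · obtain ⟨N, hN⟩ := hγ.exists_pow_eq_zero i
    obtain ⟨N', hN'⟩ := hγ.exists_pow_eq_zero j
    -- Truncating both levels at the common length `N + N'` lets the transition map be compared term
    -- by term.
    rw [expFam_apply (hN x) (Nat.le_add_right N N'), expFam_apply (hN' x) (Nat.le_add_left N' N),
      expSum, expSum, map_sum]
    refine Finset.sum_congr rfl fun k _ => ?_
    rw [map_smul]
    congr 1
    rw [lTensor_fibContr_pow, (hΦ (m + k)).2 i j h x, hγ.2.1 i j h x]

theorem expFam_add {d : ℤ} {γ : Fam n X R} (hγ : IsPolyField n X R d γ) (Φ Ψ : Series n X R) :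
    expFam γ (Φ + Ψ) = expFam γ Φ + expFam γ Ψ := by
  funext m i x
  obtain ⟨N, hN⟩ := hγ.exists_pow_eq_zero i
  simp only [Pi.add_apply, expFam_apply (hN x) le_rfl]
  exact expSum_add (fun l => Φ l i x) (fun l => Ψ l i x) N m

theorem expFam_smul {d : ℤ} {γ : Fam n X R} (hγ : IsPolyField n X R d γ) (c : ℂ)
    (Φ : Series n X R) : expFam γ (c • Φ) = c • expFam γ Φ := by
  funext m i x
  obtain ⟨N, hN⟩ := hγ.exists_pow_eq_zero i
  simp only [Pi.smul_apply, expFam_apply (hN x) le_rfl]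
  exact expSum_smul c (fun l => Φ l i x) N m

theorem expFam_neg_expFam {d : ℤ} {γ : Fam n X R} (hγ : IsPolyField n X R d γ)
    (Φ : Series n X R) : expFam (-γ) (expFam γ Φ) = Φ := by
  funext m i x
  obtain ⟨N₁, hN₁⟩ := hγ.exists_pow_eq_zero i
  obtain ⟨N₂, hN₂⟩ := hγ.neg.exists_pow_eq_zero i
  have e : fibContr ((-γ) i x) = -fibContr (γ i x) := map_neg _ _
  have h₁ : fibContr (γ i x) ^ (N₁ + N₂) = 0 :=
    pow_eq_zero_of_le (Nat.le_add_right N₁ N₂) (hN₁ x)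
  have h₂ : (-fibContr (γ i x)) ^ (N₁ + N₂) = 0 := by
    rw [← e]
    exact pow_eq_zero_of_le (Nat.le_add_left N₂ N₁) (hN₂ x)
  rw [expFam_apply (hN₂ x) (Nat.le_add_left N₂ N₁), e]
  simp only [expFam_apply (hN₁ x) (Nat.le_add_right N₁ N₂)]
  exact expSum_neg_expSum h₁ h₂ (fun l => Φ l i x) m

theorem expFam_expFam_neg {d : ℤ} {γ : Fam n X R} (hγ : IsPolyField n X R d γ)
    (Φ : Series n X R) : expFam γ (expFam (-γ) Φ) = Φ := by
  have h := expFam_neg_expFam hγ.neg Φ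
  rwa [neg_neg] at h

/-- The differential `∂̄ + ħ∂` on series in integral powers of `ħ`. -/
def dInt (Φ : Series n X R) : Series n X R := fun m i x =>
  delbar (Φ m i) x + del (Φ (m - 1) i) x

theorem expContr_dTwist (γ : MC n X R) {Φ : Series n X R} (hΦ : Φ ∈ intSeries n X R) :
    expContr γ (dTwist γ.val Φ) = dInt (expContr γ Φ) := by
  funext m i x
  obtain ⟨N, hN⟩ := γ.isPolyField.exists_pow_eq_zero i
  have heven : ∀ z, IsEvenFib (γ.val i z) := fun z =>
    isEvenFib_of_mem_polyDeg (γ.isPolyField.2.2 i z)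
  have h := delbar_add_del_expSum (γ.isPolyField.1 i) heven (γ.maurerCartan i) hN
    (Φ := fun l => Φ l i) (fun l => (hΦ l).1 i) m x
  have e : ∀ l, expContr γ Φ l i =
      fun z => expSum (fibContr (γ.val i z)) (fun l => Φ l i z) N l := fun l =>
    funext fun z => expFam_apply (hN z) le_rfl Φ l
  rw [dInt, e, e, h, expContr_eq_expFam, expFam_apply (hN x) le_rfl]
  rfl

theorem derFam_apply (v : R.Der) (s : Fam n X R) (i : ℕ) (x : X) :
    derFam v s i x = v.fib i n (s (v.shift i) x) := rfl

/-- The derivation lowers the level from `v.shift i` to `i`, so γ reappears through its image γ'. As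
i_{γ'} commutes with i_{∂_vγ}, the k Leibniz terms are equal. -/
theorem ProArtin.Der.fib_fibContr_pow (v : R.Der) (i : ℕ) {γ : Fib n (R.level (v.shift i))}
    (hγ : IsEvenFib γ) {γ' : Fib n (R.level i)} (hγ' : IsEvenFib γ')
    (h : (R.map (v.le_shift i)).toLinearMap.lTensor (Lam n) γ = γ') (k : ℕ)
    (w : Fib n (R.level (v.shift i))) :
    v.fib i n ((fibContr γ ^ k) w) = (fibContr γ' ^ k) (v.fib i n w) +
      (k : ℂ) • (fibContr γ' ^ (k - 1))
        (fibContr (v.fib i n γ) ((R.map (v.le_shift i)).toLinearMap.lTensor (Lam n) w)) := by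
  induction k with
  | zero => simp
  | succ k ih =>
    rw [pow_succ' (fibContr γ), Module.End.mul_apply, v.fib_fibContr i hγ, ih,
      lTensor_fibContr_pow, h, map_add,
      ← Module.End.mul_apply (fibContr (v.fib i n γ)),
      ← (commute_fibContr hγ' (v.fib i n γ)).pow_left k, Module.End.mul_apply,
      ← smul_pow_pred_succ, pow_succ', Module.End.mul_apply]
    abel

/-- `∂_v exp(ħ⁻¹ i_γ) = exp(ħ⁻¹ i_γ) ∇_v` -/
theorem derSeries_expContr (γ : MC n X R) (v : R.Der) {Φ : Series n X R}
    (hΦ : Φ ∈ intSeries n X R) :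
    derSeries v (expContr γ Φ) = expContr γ (nablaSeries γ v Φ) := by
  funext m i x
  obtain ⟨N₁, hN₁⟩ := γ.isPolyField.exists_pow_eq_zero i
  obtain ⟨N₂, hN₂⟩ := γ.isPolyField.exists_pow_eq_zero (v.shift i)
  have hev : ∀ j, IsEvenFib (γ.val j x) := fun j =>
    isEvenFib_of_mem_polyDeg (γ.isPolyField.2.2 j x)
  have e : (fun l => nablaSeries γ v Φ l i x) = (fun l => v.fib i n (Φ l (v.shift i) x)) +
      fun l => (fun l => fibContr (v.fib i n (γ.val (v.shift i) x)) (Φ l i x)) (l + 1) := rfl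
  change derFam v (expContr γ Φ m) i x = _
  -- The nilpotency orders at the two levels may differ. The length `N₁ + N₂ + 1` covers both and
  -- leaves room for the shift k ↦ k − 1 in the Leibniz term.
  rw [derFam_apply, expContr_eq_expFam, expContr_eq_expFam,
    expFam_apply (hN₂ x) (K := N₁ + N₂ + 1) (by omega), expFam_apply (hN₁ x) le_rfl, e,
    expSum_add, expSum_shift (fun l => fibContr (v.fib i n (γ.val (v.shift i) x)) (Φ l i x)),
    ← expSum_eq_of_le (hN₁ x) (K := N₁ + N₂ + 1) (by omega),
    ← expSum_eq_of_le (hN₁ x) (K := N₁ + N₂) (by omega) _ (m + 1), ← sum_smul_pow_pred, expSum,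
    expSum, map_sum, ← Finset.sum_add_distrib]
  refine Finset.sum_congr rfl fun k _ => ?_
  rw [map_smul, v.fib_fibContr_pow i (hev _) (hev i)
    (γ.isPolyField.2.1 i (v.shift i) (v.le_shift i) x), (hΦ (m + k)).2 i _ (v.le_shift i) x,
    smul_add]

end Series

/-! ### The rescaling `l_ħ` -/

section Rescale

variable {A : GradedArtin.{u}}

/-- The component of bidegree `(p,q)` of a form with coefficients. -/
def fibComp (A : GradedArtin.{u}) (p q : ℕ) : Fib n A →ₗ[ℂ] Fib n A :=
  (comp p q).rTensor A.carrier

theorem fibComp_tmul (p q : ℕ) (a : Lam n) (r : A.carrier) :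
    fibComp A p q (a ⊗ₜ r) = comp p q a ⊗ₜ[ℂ] r := rfl

theorem fibComp_eq_zero_of_lt_left {p : ℕ} (hp : n < p) (q : ℕ) (w : Fib n A) :
    fibComp A p q w = 0 := by
  induction w using TensorProduct.induction_on with
  | zero => simp
  | tmul a r => rw [fibComp_tmul, comp_eq_zero_of_lt_left hp, TensorProduct.zero_tmul]
  | add w w' h h' => rw [map_add, h, h', add_zero]

theorem fibComp_eq_zero_of_lt_right (p : ℕ) {q : ℕ} (hq : n < q) (w : Fib n A) :
    fibComp A p q w = 0 := by
  induction w using TensorProduct.induction_on with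
  | zero => simp
  | tmul a r => rw [fibComp_tmul, comp_eq_zero_of_lt_right p hq, TensorProduct.zero_tmul]
  | add w w' h h' => rw [map_add, h, h', add_zero]

theorem fibComp_fibComp (p q p' q' : ℕ) (w : Fib n A) :
    fibComp A p q (fibComp A p' q' w) = if p = p' ∧ q = q' then fibComp A p q w else 0 := by
  induction w using TensorProduct.induction_on with
  | zero => simp
  | tmul a r =>
    rw [fibComp_tmul, fibComp_tmul, fibComp_tmul, comp_comp]
    split_ifs <;> simp
  | add w w' h h' =>
    simp only [map_add, h, h']
    split_ifs <;> simp

theorem sum_fibComp (w : Fib n A) :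
    ∑ p ∈ Finset.range (n + 1), ∑ q ∈ Finset.range (n + 1), fibComp A p q w = w := by
  induction w using TensorProduct.induction_on with
  | zero => simp
  | tmul a r => simp only [fibComp_tmul, ← TensorProduct.sum_tmul, sum_comp]
  | add w w' h h' => simp only [map_add, Finset.sum_add_distrib, h, h']

theorem inv_fibComp (p q : ℕ) (w : Fib n A) :
    inv.rTensor A.carrier (fibComp A p q w) = (-1 : ℂ) ^ (p + q) • fibComp A p q w := by
  induction w using TensorProduct.induction_on with
  | zero => simp
  | tmul a r =>
    rw [fibComp_tmul, LinearMap.rTensor_tmul, inv_comp, TensorProduct.smul_tmul']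
  | add w w' h h' => simp only [map_add, smul_add, h, h']

theorem fibComp_inv (p q : ℕ) (w : Fib n A) :
    fibComp A p q (inv.rTensor A.carrier w) = inv.rTensor A.carrier (fibComp A p q w) := by
  induction w using TensorProduct.induction_on with
  | zero => simp
  | tmul a r =>
    rw [fibComp_tmul, LinearMap.rTensor_tmul, LinearMap.rTensor_tmul, fibComp_tmul, comp_inv]
  | add w w' h h' => simp only [h', h, map_add]

/-- A component of the wrong parity vanishes. -/
theorem fibComp_eq_zero_of_parity {k : ℤ} {w : Fib n A}
    (hw : inv.rTensor A.carrier w = k.negOnePow • w) {p q : ℕ}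
    (h : ¬Even (k - ((q : ℤ) - p))) : fibComp A p q w = 0 := by
  have h₁ := inv_fibComp p q w
  rw [← fibComp_inv, hw] at h₁
  have h₂ : ¬(Even k ↔ Even (p + q)) := by
    rw [← Int.even_coe_nat]
    push_cast
    rw [Int.even_sub, Int.even_sub] at h
    rw [Int.even_add]
    tauto
  have h₃ : fibComp A p q w = -fibComp A p q w := by
    by_cases hk : Even k
    · have hpq : Odd (p + q) := Nat.not_even_iff_odd.mp (by tauto)
      rwa [Int.negOnePow_even k hk, one_smul, hpq.neg_one_pow, neg_one_smul] at h₁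
    · have hpq : Even (p + q) := by tauto
      rw [Int.negOnePow_odd k (Int.not_even_iff_odd.mp hk), Units.neg_smul, one_smul, map_neg,
        hpq.neg_one_pow, one_smul] at h₁
      exact h₁.symm
  rw [eq_neg_iff_add_eq_zero, ← two_smul ℂ] at h₃
  exact (smul_eq_zero.mp h₃).resolve_left two_ne_zero

theorem fibComp_map {B : GradedArtin.{u}} (L : Lam n →ₗ[ℂ] Lam n)
    (f : A.carrier →ₗ[ℂ] B.carrier) (p q : ℕ) (hL : ∀ a, comp p q (L a) = L (comp p q a))
    (w : Fib n A) :
    fibComp B p q (TensorProduct.map L f w) = TensorProduct.map L f (fibComp A p q w) := by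
  induction w using TensorProduct.induction_on with
  | zero => simp
  | tmul a r =>
    rw [fibComp_tmul, TensorProduct.map_tmul, fibComp_tmul, TensorProduct.map_tmul, hL]
  | add w w' h h' => simp only [map_add, h, h']

theorem lmul_gen₁_fibComp (v : Cn n) (p q : ℕ) (w : Fib n A) :
    lmul (gen₁ v) (fibComp A p q w) = fibComp A (p + 1) q (lmul (gen₁ v) w) := by
  induction w using TensorProduct.induction_on with
  | zero => simp
  | tmul a r => rw [fibComp_tmul, lmul_tmul, lmul_tmul, fibComp_tmul, comp_gen₁_mul]
  | add w w' h h' => simp only [map_add, h, h']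

theorem lmul_gen₂_fibComp (v : Cn n) (p q : ℕ) (w : Fib n A) :
    lmul (gen₂ v) (fibComp A p q w) = fibComp A p (q + 1) (lmul (gen₂ v) w) := by
  induction w using TensorProduct.induction_on with
  | zero => simp
  | tmul a r => rw [fibComp_tmul, lmul_tmul, lmul_tmul, fibComp_tmul, comp_gen₂_mul]
  | add w w' h h' => simp only [map_add, h, h']

theorem fibComp_zero_lmul_gen₁ (v : Cn n) (q : ℕ) (w : Fib n A) :
    fibComp A 0 q (lmul (gen₁ v) w) = 0 := by
  induction w using TensorProduct.induction_on with
  | zero => simp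
  | tmul a r => rw [lmul_tmul, fibComp_tmul, comp_zero_gen₁_mul, TensorProduct.zero_tmul]
  | add w w' h h' => simp only [map_add, h, h', add_zero]

theorem fibComp_zero_lmul_gen₂ (v : Cn n) (p : ℕ) (w : Fib n A) :
    fibComp A p 0 (lmul (gen₂ v) w) = 0 := by
  induction w using TensorProduct.induction_on with
  | zero => simp
  | tmul a r => rw [lmul_tmul, fibComp_tmul, comp_zero_gen₂_mul, TensorProduct.zero_tmul]
  | add w w' h h' => simp only [map_add, h, h', add_zero]

variable {X : Type*} [TopologicalSpace X] [ChartedSpace (Cn n) X]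
  [IsManifold 𝓘(ℂ, Cn n) ω X]

set_option linter.unusedSectionVars false

theorem read_fibComp (p q : ℕ) (s : X → Fib n A) (x : X) :
    read formChange x (fun z => fibComp A p q (s z)) =
      fun y => fibComp A p q (read formChange x s y) := by
  funext y
  simp only [read]
  generalize s _ = w
  induction w using TensorProduct.induction_on with
  | zero => simp
  | tmul a r =>
    rw [fibComp_tmul, LinearMap.rTensor_tmul, LinearMap.rTensor_tmul, fibComp_tmul]
    exact congrArg (· ⊗ₜ[ℂ] r) (map_prodMap_comp _ _ p q a)
  | add w w' h h' => simp only [map_add, h, h']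

theorem IsSmooth.fibComp {s : X → Fib n A} (hs : IsSmooth formChange s) (p q : ℕ) :
    IsSmooth formChange (fun z => fibComp A p q (s z)) := by
  intro x
  simp only [read_fibComp, ← coordMap_apply]
  exact (coordMap (SemiInfinite.fibComp A p q)).contDiff.comp_contDiffOn (hs x)

theorem del_fibComp {s : X → Fib n A} (hs : IsSmooth formChange s) (p q : ℕ) (x : X) :
    del (fun z => fibComp A p q (s z)) x = fibComp A (p + 1) q (del s x) := by
  simp only [del, read_fibComp, dz_linear (fibComp A p q) (hs.diffAt x), lmul_gen₁_fibComp,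
    map_sum]

theorem delbar_fibComp {s : X → Fib n A} (hs : IsSmooth formChange s) (p q : ℕ) (x : X) :
    delbar (fun z => fibComp A p q (s z)) x = fibComp A p (q + 1) (delbar s x) := by
  simp only [delbar, read_fibComp, dzbar_linear (fibComp A p q) (hs.diffAt x),
    lmul_gen₂_fibComp, map_sum]

theorem fibComp_zero_del (q : ℕ) (s : X → Fib n A) (x : X) : fibComp A 0 q (del s x) = 0 := by
  simp only [del, map_sum, fibComp_zero_lmul_gen₁, Finset.sum_const_zero]

theorem fibComp_zero_delbar (p : ℕ) (s : X → Fib n A) (x : X) :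
    fibComp A p 0 (delbar s x) = 0 := by
  simp only [delbar, map_sum, fibComp_zero_lmul_gen₂, Finset.sum_const_zero]

/-! ### From powers of ħ to powers of ħ^{1/2}. -/

variable {R : ProArtin.{u}}

/-- A series in `ħ` as a series in `ħ^{1/2}`. -/
def toHalf (Φ : Series n X R) : Series n X R := fun j => if Even j then Φ (j / 2) else 0

theorem toHalf_two_mul (Φ : Series n X R) (m : ℤ) : toHalf Φ (2 * m) = Φ m := by
  rw [toHalf, if_pos (even_two_mul m), Int.mul_ediv_cancel_left m two_ne_zero]

theorem toHalf_mem {Φ : Series n X R} (hΦ : Φ ∈ intSeries n X R) :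
    toHalf Φ ∈ intSeries n X R := by
  intro j
  rw [toHalf]
  split_ifs
  · exact hΦ _
  · exact zero_mem _

theorem rescale_apply (Φ : Series n X R) (k : ℤ) (i : ℕ) (x : X) :
    rescale Φ k i x = ∑ p ∈ Finset.range (n + 1), ∑ q ∈ Finset.range (n + 1),
      fibComp (R.level i) p q (toHalf Φ (k - ((q : ℤ) - p)) i x) := by
  refine Finset.sum_congr rfl fun p _ => Finset.sum_congr rfl fun q _ => ?_
  rw [toHalf]
  split_ifs
  · rfl
  · simp

theorem rescale_add (Φ Ψ : Series n X R) : rescale (Φ + Ψ) = rescale Φ + rescale Ψ := by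
  funext k i x
  simp only [rescale, Pi.add_apply, ← Finset.sum_add_distrib]
  refine Finset.sum_congr rfl fun p _ => Finset.sum_congr rfl fun q _ => ?_
  split_ifs <;> simp

theorem rescale_smul (c : ℂ) (Φ : Series n X R) : rescale (c • Φ) = c • rescale Φ := by
  funext k i x
  simp only [rescale, Pi.smul_apply, Finset.smul_sum]
  refine Finset.sum_congr rfl fun p _ => Finset.sum_congr rfl fun q _ => ?_
  split_ifs <;> simp

theorem fibComp_mem {s : Fam n X R} (hs : s ∈ forms n X R) (p q : ℕ) :
    (fun i x => fibComp (R.level i) p q (s i x)) ∈ forms n X R := by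
  refine ⟨fun i => (hs.1 i).fibComp p q, fun i j h x => ?_⟩
  dsimp only
  rw [← hs.2 i j h x]
  exact (fibComp_map LinearMap.id _ p q (fun _ => rfl) _).symm

theorem rescale_mem_half {Φ : Series n X R} (hΦ : Φ ∈ intSeries n X R) :
    rescale Φ ∈ halfSeries n X R := by
  refine ⟨fun k => ?_, fun k i x => ?_⟩
  · have e : rescale Φ k = ∑ p ∈ Finset.range (n + 1), ∑ q ∈ Finset.range (n + 1),
        fun i x => fibComp (R.level i) p q (toHalf Φ (k - ((q : ℤ) - p)) i x) := by
      funext i x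
      simp only [rescale_apply, Finset.sum_apply]
    rw [e]
    exact sum_mem fun p _ => sum_mem fun q _ => fibComp_mem (toHalf_mem hΦ _) p q
  · simp only [rescale_apply, map_sum, Finset.smul_sum]
    refine Finset.sum_congr rfl fun p _ => Finset.sum_congr rfl fun q _ => ?_
    rw [inv_fibComp, toHalf]
    split_ifs with h
    · have h' : Even k ↔ Even (p + q) := by
        rw [← Int.even_coe_nat]
        push_cast
        rw [Int.even_sub, Int.even_sub] at h
        rw [Int.even_add]
        tauto
      by_cases hk : Even k
      · rw [Int.negOnePow_even k hk, (h'.mp hk).neg_one_pow, one_smul, one_smul]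
      · rw [Int.negOnePow_odd k (Int.not_even_iff_odd.mp hk),
          (Nat.not_even_iff_odd.mp (fun h => hk (h'.mpr h))).neg_one_pow, neg_one_smul,
          Units.neg_smul, one_smul]
    · simp

/-- A factor ħ shifts the half-integral index by two, which preserves parity and hence the vanishing
at odd indices. -/
theorem toHalf_dInt (Φ : Series n X R) (j : ℤ) (i : ℕ) (x : X) :
    toHalf (dInt Φ) j i x = delbar (toHalf Φ j i) x + del (toHalf Φ (j - 2) i) x := by
  have h : Even (j - 2) ↔ Even j := by simp
  simp only [toHalf, h]
  split_ifs with hj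
  · rw [dInt, show (j - 2) / 2 = j / 2 - 1 by omega]
  · have h₁ := congrFun (delbar_zero (X := X) (n := n) (A := R.level i)) x
    have h₂ := congrFun (del_zero (X := X) (n := n) (A := R.level i)) x
    rw [Pi.zero_apply] at h₁ h₂
    simp only [Pi.zero_apply, h₁, h₂, add_zero]

/-- `l_ħ (∂̄ + ħ∂) = ħ^{1/2} (∂̄ + ∂) l_ħ` -/
theorem rescale_dInt {Φ : Series n X R} (hΦ : Φ ∈ intSeries n X R) :
    rescale (dInt Φ) = dHalf (rescale Φ) := by
  funext k i x
  have hs : ∀ j, IsSmooth formChange (toHalf Φ j i) := fun j => (toHalf_mem hΦ j).1 i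
  have e : rescale Φ (k - 1) i = ∑ p ∈ Finset.range (n + 1), ∑ q ∈ Finset.range (n + 1),
      fun z => fibComp (R.level i) p q (toHalf Φ (k - 1 - ((q : ℤ) - p)) i z) := by
    funext z
    simp only [rescale_apply, Finset.sum_apply]
  -- As ∂̄ raises q by one, l_ħ gains exactly the factor ħ^{1/2}. The boundary terms drop out: ∂̄
  -- has no component with q = 0, and q = n + 1 is out of range.
  have h₁ : delbar (rescale Φ (k - 1) i) x =
      ∑ p ∈ Finset.range (n + 1), ∑ q ∈ Finset.range (n + 1),
        fibComp (R.level i) p q (delbar (toHalf Φ (k - ((q : ℤ) - p)) i) x) := by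
    rw [e, delbar_sum _ fun p _ => IsSmooth.sum _ fun q _ => (hs _).fibComp p q,
      Finset.sum_apply]
    refine Finset.sum_congr rfl fun p _ => ?_
    rw [delbar_sum _ fun q _ => (hs _).fibComp p q, Finset.sum_apply, Finset.sum_range_succ,
      Finset.sum_range_succ', fibComp_zero_delbar, delbar_fibComp (hs _),
      fibComp_eq_zero_of_lt_right p (Nat.lt_succ_self n)]
    congr 1
    refine Finset.sum_congr rfl fun q _ => ?_
    rw [delbar_fibComp (hs _),
      show k - 1 - ((q : ℤ) - p) = k - (((q + 1 : ℕ) : ℤ) - p) by push_cast; ring]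
  -- As ∂ raises p by one, l_ħ gains ħ^{−1/2}. This turns the prefactor ħ of ∂ into ħ^{1/2}, whence
  -- the extra `- 2` in the index.
  have h₂ : del (rescale Φ (k - 1) i) x =
      ∑ p ∈ Finset.range (n + 1), ∑ q ∈ Finset.range (n + 1),
        fibComp (R.level i) p q (del (toHalf Φ (k - ((q : ℤ) - p) - 2) i) x) := by
    rw [e, del_sum _ fun p _ => IsSmooth.sum _ fun q _ => (hs _).fibComp p q,
      Finset.sum_apply]
    refine (Finset.sum_range_succ _ n).trans
      ((congrArg₂ (· + ·) ?_ ?_).trans (Finset.sum_range_succ' _ n).symm)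
    · refine Finset.sum_congr rfl fun p _ => ?_
      rw [del_sum _ fun q _ => (hs _).fibComp p q, Finset.sum_apply]
      refine Finset.sum_congr rfl fun q _ => ?_
      rw [del_fibComp (hs _),
        show k - 1 - ((q : ℤ) - p) = k - ((q : ℤ) - (p + 1 : ℕ)) - 2 by push_cast; ring]
    · rw [del_sum _ fun q _ => (hs _).fibComp n q, Finset.sum_apply, Finset.sum_eq_zero,
        Finset.sum_eq_zero]
      · exact fun q _ => fibComp_zero_del q _ x
      · intro q _
        rw [del_fibComp (hs _), fibComp_eq_zero_of_lt_left (Nat.lt_succ_self n)]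
  rw [dHalf, h₁, h₂, rescale_apply, ← Finset.sum_add_distrib]
  refine Finset.sum_congr rfl fun p _ => ?_
  rw [← Finset.sum_add_distrib]
  refine Finset.sum_congr rfl fun q _ => ?_
  rw [toHalf_dInt, map_add]

/-- `∂_v l_ħ = l_ħ ∂_v` -/
theorem derSeries_rescale (v : R.Der) (Φ : Series n X R) :
    derSeries v (rescale Φ) = rescale (derSeries v Φ) := by
  funext k i x
  change derFam v (rescale Φ k) i x = _
  rw [derFam_apply, rescale_apply, rescale_apply, map_sum]
  refine Finset.sum_congr rfl fun p _ => ?_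
  rw [map_sum]
  refine Finset.sum_congr rfl fun q _ => ?_
  have h : toHalf (derSeries v Φ) (k - ((q : ℤ) - p)) i x =
      v.fib i n (toHalf Φ (k - ((q : ℤ) - p)) (v.shift i) x) := by
    simp only [toHalf]
    split_ifs
    · rfl
    · exact (map_zero _).symm
  rw [h, ProArtin.Der.fib, LinearMap.add_apply, LinearMap.add_apply, map_add,
    fibComp_map LinearMap.id _ p q (fun _ => rfl), fibComp_map inv _ p q (comp_inv p q)]

/-- The inverse of `l_ħ`. -/
def unrescale (Ψ : Series n X R) : Series n X R := fun m i x =>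
  ∑ p ∈ Finset.range (n + 1), ∑ q ∈ Finset.range (n + 1),
    fibComp (R.level i) p q (Ψ (2 * m + ((q : ℤ) - p)) i x)

theorem fibComp_sum_fibComp {p q : ℕ} (hp : p ∈ Finset.range (n + 1))
    (hq : q ∈ Finset.range (n + 1)) (w : ℕ → ℕ → Fib n A) :
    fibComp A p q (∑ p' ∈ Finset.range (n + 1), ∑ q' ∈ Finset.range (n + 1),
      fibComp A p' q' (w p' q')) = fibComp A p q (w p q) := by
  simp only [map_sum, fibComp_fibComp]
  rw [Finset.sum_eq_single_of_mem p hp, Finset.sum_eq_single_of_mem q hq]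
  · simp
  · intro q' _ h
    rw [if_neg fun h' => h h'.2.symm]
  · intro p' _ h
    exact Finset.sum_eq_zero fun q' _ => by rw [if_neg fun h' => h h'.1.symm]

theorem unrescale_rescale (Φ : Series n X R) : unrescale (rescale Φ) = Φ := by
  funext m i x
  rw [unrescale]
  conv_rhs => rw [← sum_fibComp (Φ m i x)]
  refine Finset.sum_congr rfl fun p hp => Finset.sum_congr rfl fun q hq => ?_
  rw [rescale_apply, fibComp_sum_fibComp hp hq
    (fun p' q' => toHalf Φ (2 * m + ((q : ℤ) - p) - ((q' : ℤ) - p')) i x), add_sub_cancel_right,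
    toHalf_two_mul]

theorem rescale_unrescale {Ψ : Series n X R} (hΨ : Ψ ∈ halfSeries n X R) :
    rescale (unrescale Ψ) = Ψ := by
  funext k i x
  rw [rescale_apply]
  conv_rhs => rw [← sum_fibComp (Ψ k i x)]
  refine Finset.sum_congr rfl fun p hp => Finset.sum_congr rfl fun q hq => ?_
  by_cases h : Even (k - ((q : ℤ) - p))
  · rw [toHalf, if_pos h]
    simp only [unrescale]
    rw [fibComp_sum_fibComp hp hq
      (fun p' q' => Ψ (2 * ((k - ((q : ℤ) - p)) / 2) + ((q' : ℤ) - p')) i x),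
      Int.two_mul_ediv_two_of_even h, sub_add_cancel]
  -- The indices that l_ħ never reaches carry components of the wrong parity, which are zero in
  -- `halfSeries`; so the parity condition describes the image exactly.
  · rw [fibComp_eq_zero_of_parity (hΨ.2 k i x) h, toHalf, if_neg h]
    exact map_zero _

theorem unrescale_mem {Ψ : Series n X R} (hΨ : ∀ k, Ψ k ∈ forms n X R) :
    unrescale Ψ ∈ intSeries n X R := by
  intro m
  have e : unrescale Ψ m = ∑ p ∈ Finset.range (n + 1), ∑ q ∈ Finset.range (n + 1),
      fun i x => fibComp (R.level i) p q (Ψ (2 * m + ((q : ℤ) - p)) i x) := by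
    funext i x
    simp only [unrescale, Finset.sum_apply]
  rw [e]
  exact sum_mem fun p _ => sum_mem fun q _ => fibComp_mem (hΨ _) p q

end Rescale

/-! ### Parallel transport and transversality -/

section Transport

variable {X : Type*} [TopologicalSpace X] [ChartedSpace (Cn n) X]
  [IsManifold 𝓘(ℂ, Cn n) ω X] {R : ProArtin.{u}}

/-- The operator `l_ħ exp(ħ⁻¹ i_γ)` as a linear map. -/
def transportLin (γ : MC n X R) : Series n X R →ₗ[ℂ] Series n X R where
  toFun := transportSeries γ
  map_add' Φ Ψ := by
    rw [transportSeries, expContr_eq_expFam, expFam_add γ.isPolyField, rescale_add]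
    rfl
  map_smul' c Φ := by
    rw [transportSeries, expContr_eq_expFam, expFam_smul γ.isPolyField, rescale_smul]
    rfl

theorem transportSeries_injective (γ : MC n X R) : Function.Injective (transportSeries γ) :=
  Function.LeftInverse.injective (g := fun Ψ => expFam (-γ.val) (unrescale Ψ)) fun Φ => by
    dsimp only
    rw [transportSeries, unrescale_rescale, expContr_eq_expFam,
      expFam_neg_expFam γ.isPolyField]

theorem transportSeries_mem_half (γ : MC n X R) {Φ : Series n X R} (hΦ : Φ ∈ intSeries n X R) :
    transportSeries γ Φ ∈ halfSeries n X R :=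
  rescale_mem_half (γ.isPolyField.expFam_mem hΦ)

theorem exists_transportSeries_eq (γ : MC n X R) {Ψ : Series n X R}
    (hΨ : Ψ ∈ halfSeries n X R) : ∃ Φ ∈ intSeries n X R, transportSeries γ Φ = Ψ :=
  ⟨expFam (-γ.val) (unrescale Ψ), γ.isPolyField.neg.expFam_mem (unrescale_mem hΨ.1), by
    rw [transportSeries, expContr_eq_expFam, expFam_expFam_neg γ.isPolyField,
      rescale_unrescale hΨ]⟩

theorem transportSeries_dTwist (γ : MC n X R) {Φ : Series n X R} (hΦ : Φ ∈ intSeries n X R) :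
    transportSeries γ (dTwist γ.val Φ) = dHalf (transportSeries γ Φ) := by
  rw [transportSeries, expContr_dTwist γ hΦ]
  exact rescale_dInt (γ.isPolyField.expFam_mem hΦ)

theorem transportSeries_nabla (γ : MC n X R) (v : R.Der) {Φ : Series n X R}
    (hΦ : Φ ∈ intSeries n X R) :
    transportSeries γ (nablaSeries γ v Φ) = derSeries v (transportSeries γ Φ) := by
  rw [transportSeries, transportSeries, derSeries_rescale, derSeries_expContr γ v hΦ]

/-- The intertwining relation gives one direction and injectivity the other. The latter is needed
for L, whose definition imposes closedness only after transport. -/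
theorem transportSeries_mem_iff (γ : MC n X R) {Φ : Series n X R} (hΦ : Φ ∈ intSeries n X R) :
    transportSeries γ Φ ∈ dRCocycles n X R ↔ Φ ∈ gmCocycles γ := by
  refine ⟨fun h => ⟨hΦ, transportSeries_injective γ ?_⟩,
    fun h => ⟨transportSeries_mem_half γ hΦ, ?_⟩⟩
  · rw [transportSeries_dTwist γ hΦ, h.2]
    exact (map_zero (transportLin γ)).symm
  · rw [← transportSeries_dTwist γ hΦ, h.2]
    exact map_zero (transportLin γ)

theorem transportSeries_mem (γ : MC n X R) {Φ : Series n X R} (hΦ : Φ ∈ gmCocycles γ) :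
    transportSeries γ Φ ∈ dRCocycles n X R := (transportSeries_mem_iff γ hΦ.1).mpr hΦ

/-- `l_ħ exp(ħ⁻¹ i_γ)` as an isomorphism of cocycles. -/
def cocycleEquiv (γ : MC n X R) : gmCocycles γ ≃ₗ[ℂ] dRCocycles n X R :=
  LinearEquiv.ofBijective
    ((transportLin γ).restrict (p := gmCocycles γ) (q := dRCocycles n X R)
      fun _ h => transportSeries_mem γ h)
    ⟨fun Φ Ψ h => Subtype.ext (transportSeries_injective γ (congrArg Subtype.val h)),
      fun ⟨Ψ, hΨ⟩ => by
        obtain ⟨Φ, hΦ, rfl⟩ := exists_transportSeries_eq γ hΨ.1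
        exact ⟨⟨Φ, (transportSeries_mem_iff γ hΦ).mp hΨ⟩, rfl⟩⟩

/-- The transport is bijective on all cochains, so primitives can be carried in both directions, not
just cocycles. -/
theorem map_cocycleEquiv (γ : MC n X R) :
    ((gmCoboundaries γ).comap (gmCocycles γ).subtype).map (cocycleEquiv γ).toLinearMap =
      (dRCoboundaries n X R).comap (dRCocycles n X R).subtype := by
  apply le_antisymm
  · rintro _ ⟨⟨_, h⟩, ⟨η, hη, rfl⟩, rfl⟩
    exact ⟨transportSeries γ η, transportSeries_mem_half γ hη,
      (transportSeries_dTwist γ hη).symm⟩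
  · rintro ⟨_, h⟩ ⟨θ, hθ, rfl⟩
    obtain ⟨η, hη, rfl⟩ := exists_transportSeries_eq γ hθ
    obtain ⟨⟨Φ, hΦ⟩, e⟩ := (cocycleEquiv γ).surjective
      ⟨(dRCocycles n X R).subtype ⟨_, h⟩, h⟩
    refine ⟨⟨Φ, hΦ⟩, ⟨η, hη, transportSeries_injective γ ?_⟩, e⟩
    rw [transportSeries_dTwist γ hη]
    exact (congrArg Subtype.val e).symm

/-- The isomorphism `P_γ` of the fibre of the Gauss–Manin local system with
`H^*(X,ℂ)[[ħ⁻¹,ħ]] ⊗̂ R`. -/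
def transportEquiv (γ : MC n X R) : gmFibre γ ≃ₗ[ℂ] dRCohomology n X R :=
  Submodule.Quotient.equiv _ _ (cocycleEquiv γ) (map_cocycleEquiv γ)

theorem transportEquiv_gmClass (γ : MC n X R) {Φ : Series n X R} (h : Φ ∈ gmCocycles γ) :
    transportEquiv γ (gmClass γ Φ h) =
      dRClass (transportSeries γ Φ) (transportSeries_mem γ h) := rfl

theorem nablaSeries_mem_gmCocycles (γ : MC n X R) (v : R.Der) {Φ : Series n X R}
    (h : Φ ∈ gmCocycles γ) : nablaSeries γ v Φ ∈ gmCocycles γ := by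
  rw [← transportSeries_mem_iff γ (nablaSeries_mem γ v h.1), transportSeries_nabla γ v h.1]
  exact derSeries_mem v (transportSeries_mem γ h)

theorem transportEquiv_gmClass_nabla (γ : MC n X R) (v : R.Der) {Φ : Series n X R}
    (h : Φ ∈ gmCocycles γ) :
    transportEquiv γ (gmClass γ (nablaSeries γ v Φ) (nablaSeries_mem_gmCocycles γ v h)) =
      dRDer v (transportEquiv γ (gmClass γ Φ h)) :=
  congrArg Submodule.Quotient.mk (Subtype.ext (transportSeries_nabla γ v h.1))

/-- The Gauss–Manin connection on the fibre over `γ`. -/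
def nablaFibre (γ : MC n X R) (v : R.Der) : gmFibre γ →ₗ[ℂ] gmFibre γ :=
  (transportEquiv γ).symm.toLinearMap ∘ₗ dRDer v ∘ₗ (transportEquiv γ).toLinearMap

theorem transportEquiv_nablaFibre (γ : MC n X R) (v : R.Der) (x : gmFibre γ) :
    transportEquiv γ (nablaFibre γ v x) = dRDer v (transportEquiv γ x) :=
  (transportEquiv γ).apply_symm_apply _

/-- Carrying ∂_v back by P_γ makes the connection well defined without examining ∇_v on
coboundaries; ∂_v e = e ∇_v then recovers the explicit formula on representatives. -/
theorem nablaFibre_gmClass (γ : MC n X R) (v : R.Der) {Φ : Series n X R}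
    (h : Φ ∈ gmCocycles γ) :
    nablaFibre γ v (gmClass γ Φ h) =
      gmClass γ (nablaSeries γ v Φ) (nablaSeries_mem_gmCocycles γ v h) :=
  (transportEquiv γ).injective <| by
    rw [transportEquiv_nablaFibre, transportEquiv_gmClass_nabla]

/-- Multiplication by `ħ` on series in integral powers of `ħ`. -/
def hbarMul (Φ : Series n X R) : Series n X R := fun m => Φ (m - 1)

/-- Multiplication by ħ commutes with the exponential and with l_ħ; one step in the integral index
corresponds to two in the half-integral one. -/
theorem hbarInvSeries_transportSeries_hbarMul (γ : MC n X R) (Φ : Series n X R) :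
    hbarInvSeries (transportSeries γ (hbarMul Φ)) = transportSeries γ Φ := by
  funext k i x
  have e : ∀ m, expContr γ (hbarMul Φ) (m + 1) i x = expContr γ Φ m i x := by
    intro m
    simp only [expContr, hbarMul]
    refine finsum_congr fun l => ?_
    rw [show m + 1 + (l : ℤ) - 1 = m + l by ring]
  change rescale (expContr γ (hbarMul Φ)) (k + 2) i x = rescale (expContr γ Φ) k i x
  rw [rescale, rescale]
  refine Finset.sum_congr rfl fun p _ => Finset.sum_congr rfl fun q _ => ?_
  rw [show k + 2 - ((q : ℤ) - p) = k - ((q : ℤ) - p) + 2 by ring,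
    show (k - ((q : ℤ) - p) + 2) / 2 = (k - ((q : ℤ) - p)) / 2 + 1 by omega, e]
  simp only [Int.even_add, even_two, iff_true]

theorem hbarMul_mem_gmCocycles (γ : MC n X R) {Φ : Series n X R} (h : Φ ∈ gmCocycles γ) :
    hbarMul Φ ∈ gmCocycles γ :=
  ⟨fun m => h.1 (m - 1), funext fun m => congrFun h.2 (m - 1)⟩

/-- The witness is the class of e(ħ∇_vΦ): the only negative power in ∇_vΦ comes from the ħ⁻¹ in
front of i_{∂_vγ}, and the factor ħ absorbs it. -/
theorem dRDer_semiInfOf (γ : MC n X R) (v : R.Der) {c : dRCohomology n X R}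
    (hc : c ∈ semiInfOf γ) : dRDer v c ∈ hbarInv '' semiInfOf γ := by
  obtain ⟨Φ, hΦ, h, rfl⟩ := hc
  have hΦ' : Φ ∈ gmCocycles γ := (transportSeries_mem_iff γ hΦ.1).mp h
  have hmem := hbarMul_mem_gmCocycles γ (nablaSeries_mem_gmCocycles γ v hΦ')
  refine ⟨dRClass _ (transportSeries_mem γ hmem),
    ⟨hbarMul (nablaSeries γ v Φ), ⟨hmem.1, fun m hm => ?_⟩, _, rfl⟩, ?_⟩
  · have h₁ : Φ (m - 1) = 0 := hΦ.2 _ (by omega)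
    have h₂ : Φ (m - 1 + 1) = 0 := hΦ.2 _ (by omega)
    funext i x
    change derFam v (Φ (m - 1)) i x + contrFam (derFam v γ.val) (Φ (m - 1 + 1)) i x = 0
    rw [h₁, h₂, derFam_apply, contrFam]
    simp
  · refine congrArg Submodule.Quotient.mk (Subtype.ext ?_)
    exact (hbarInvSeries_transportSeries_hbarMul γ _).trans (transportSeries_nabla γ v hΦ.1)

end Transport

end SemiInfinite

end

/-! ### The Gauss–Manin connection and semi-infinite Griffiths transversality. -/

theorem mainTheorem2 {n : ℕ} {X : Type*} [TopologicalSpace X] [ChartedSpace (Cn n) X]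
    [IsManifold 𝓘(ℂ, Cn n) ω X] (R : ProArtin) (φ : Moduli n X R) (v : R.Der) :
    (∀ γ : MC n X R, γ.point = φ →
      ∃ (P : gmFibre γ ≃ₗ[ℂ] dRCohomology n X R) (nabla : gmFibre γ →ₗ[ℂ] gmFibre γ),
        (∀ (Φ : Series n X R) (h : Φ ∈ gmCocycles γ),
          ∃ h' : transportSeries γ Φ ∈ dRCocycles n X R,
            P (gmClass γ Φ h) = dRClass (transportSeries γ Φ) h') ∧
        (∀ (Φ : Series n X R) (h : Φ ∈ gmCocycles γ),
          ∃ h' : nablaSeries γ v Φ ∈ gmCocycles γ,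
            nabla (gmClass γ Φ h) = gmClass γ (nablaSeries γ v Φ) h') ∧
        (∀ x : gmFibre γ, P (nabla x) = dRDer v (P x)) ∧
        (∀ x : gmFibre γ, P x ∈ semiInfOf γ → P (nabla x) ∈ hbarInv '' semiInfOf γ)) ∧
    dRDer v '' semiInf φ ⊆ hbarInv '' semiInf φ := by
  refine ⟨fun γ _ => ⟨transportEquiv γ, nablaFibre γ v, fun Φ h => ⟨_, transportEquiv_gmClass γ h⟩,
    fun Φ h => ⟨_, nablaFibre_gmClass γ v h⟩, transportEquiv_nablaFibre γ v, fun x hx => ?_⟩, ?_⟩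
  · rw [transportEquiv_nablaFibre]
    exact dRDer_semiInfOf γ v hx
  -- A class in L(φ) comes with some γ describing φ, and the same γ serves for its derivative, so
  -- gauge invariance of L is not needed.
  · rintro _ ⟨c, ⟨γ, hγ, hc⟩, rfl⟩
    obtain ⟨c', hc', e⟩ := dRDer_semiInfOf γ v hc
    exact ⟨c', ⟨γ, hγ, hc'⟩, e⟩
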